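/- Let $q\ge 3$ and $p=2q+1$ both be prime, and write $q-1=2^r s$ with $s$ odd; let $\sigma_0(s)$ be the number of positive divisors of $s$. A permutation group of degree $n$ means a group $G$ acting faithfully and transitively on a set of $n$ elements; two such are isomorphic if there are a group isomorphism and a compatible bijection of the underlying sets. For a finite separable field extension $L/K$ with normal closure $E$, a Hopf-Galois structure on $L/K$ is a cocommutative $K$-Hopf algebra $H$ with an $H$-module algebra structure on $L$ such that the map $L\otimes_K H\to \mathrm{End}_K(L)$, $x\otimes h\mapsto (y\mapsto x(h\cdot y))$, is bijective; such structures are counted up to isomorphism of Hopf algebras compatible with the action on $L$. Its type is the group $N$ (up to isomorphism) with $E\otimes_K H\cong E[N]$ as $E$-Hopf algebras. The extension $L/K$ realises $G$ if there is an isomorphism $G\to\mathrm{Gal}(E/K)$ taking the stabiliser of a point to $\mathrm{Gal}(E/L)$; $G$ is realised by a Hopf-Galois structure of cyclic type if a finite separable extension realising $G$ admits a Hopf-Galois structure whose type is a cyclic group. The extension $L/K$ is almost classically Galois if $\mathrm{Gal}(E/L)$ has a normal complement in $\mathrm{Gal}(E/K)$. There are exactly $(6r+4)\,\sigma_0(s)+2$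 isomorphism types of permutation groups of degree $pq$ which are realised by a Hopf-Galois structure of cyclic type. These include the two regular permutation groups of degree $pq$ (up to isomorphism), one cyclic and the other non-abelian; every finite separable extension realising one of them is Galois, and it has exactly $1$ Hopf-Galois structure of cyclic type in the cyclic case and exactly $p$ in the non-abelian case. For each of the remaining permutation groups $G$, every finite separable field extension $L/K$ realising $G$ is almost classically Galois and admits exactly one Hopf-Galois structure of cyclic type. -/

import Mathlib

universe u

noncomputable section

open scoped TensorProduct

namespace HopfGalois

/-! ### Hopf-Galois structures -/

section Structures

variable (K L : Type u) [Field K] [Field L] [Algebra K L]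

/-- A Hopf-Galois structure on `L/K`: a cocommutative `K`-Hopf algebra `H` together with an
action of `H` on `L` making `L` an `H`-module algebra for which `L/K` is `H`-Galois. -/
structure HopfGaloisStructure where
  /-- The Hopf algebra. -/
  H : Type u
  [ring : Ring H]
  [hopf : HopfAlgebra K H]
  [cocomm : Coalgebra.IsCocomm K H]
  /-- The action of `H` on `L` by `K`-linear endomorphisms. -/
  act : H →ₐ[K] Module.End K L
  /-- `h · (x y) = ∑ (h₁ · x) (h₂ · y)`. -/
  act_mul : ∀ (h : H) (x y : L),
    act h (x * y) =
      LinearMap.mul' K L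
        (TensorProduct.map (LinearMap.applyₗ x ∘ₗ act.toLinearMap)
          (LinearMap.applyₗ y ∘ₗ act.toLinearMap) (Coalgebra.comul (R := K) h))
  /-- `h · k = ε(h) k` for `k ∈ K`. -/
  act_algebraMap : ∀ (h : H) (k : K),
    act h (algebraMap K L k) = algebraMap K L (Coalgebra.counit (R := K) h * k)
  /-- The map `L ⊗ H → End_K(L)`, `x ⊗ h ↦ (y ↦ x (h · y))`, is bijective. -/
  galois : Function.Bijective
    (LinearMap.mul' K (Module.End K L) ∘ₗ
      TensorProduct.map (LinearMap.mul K L) act.toLinearMap)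

attribute [instance] HopfGaloisStructure.ring HopfGaloisStructure.hopf
  HopfGaloisStructure.cocomm

variable {K L}

/-- Two Hopf-Galois structures on `L/K` are identified when there is an isomorphism of
`K`-Hopf algebras compatible with the actions on `L`. -/
def HopfGaloisStructure.Equivalent (S T : HopfGaloisStructure K L) : Prop :=
  ∃ e : S.H ≃ₐc[K] T.H, ∀ h : S.H, T.act (e h) = S.act h

theorem HopfGaloisStructure.equivalent_equivalence :
    Equivalence (HopfGaloisStructure.Equivalent (K := K) (L := L)) where
  refl S := ⟨BialgEquiv.refl K S.H, fun _ => rfl⟩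
  symm := by
    rintro S T ⟨e, he⟩
    refine ⟨e.symm, fun h => ?_⟩
    rw [← he (e.symm h), BialgEquiv.apply_symm_apply]
  trans := by
    rintro S T U ⟨e, he⟩ ⟨f, hf⟩
    exact ⟨e.trans f, fun h => (hf (e h)).trans (he h)⟩

variable (K L)

/-- Hopf-Galois structures up to isomorphism. -/
instance HopfGaloisStructure.setoid : Setoid (HopfGaloisStructure K L) where
  r := HopfGaloisStructure.Equivalent
  iseqv := HopfGaloisStructure.equivalent_equivalence

/-- The normal closure `E` of `L/K` inside an algebraic closure. -/
abbrev NormalClosure : IntermediateField K (AlgebraicClosure L) :=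
  IntermediateField.normalClosure K L (AlgebraicClosure L)

variable {K L}

/-- The Hopf-Galois structure has type `N`: `E ⊗_K H ≅ E[N]` as `E`-Hopf algebras, where `E`
is the normal closure of `L/K`. -/
def HopfGaloisStructure.HasType (S : HopfGaloisStructure K L) (N : Type*) [Group N] : Prop :=
  Nonempty ((NormalClosure K L ⊗[K] S.H) ≃ₐc[NormalClosure K L]
    MonoidAlgebra (NormalClosure K L) N)

variable (K L)

/-- The number of Hopf-Galois structures of type `N` on `L/K`, up to isomorphism. -/
def numStructures (N : Type*) [Group N] : ℕ :=
  {c : Quotient (HopfGaloisStructure.setoid K L) |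
    ∃ S : HopfGaloisStructure K L, ⟦S⟧ = c ∧ S.HasType N}.ncard

/-- `Gal(E/L)` as a subgroup of `Gal(E/K)`, with `E` the normal closure of `L/K`. -/
def stabGal : Subgroup (NormalClosure K L ≃ₐ[K] NormalClosure K L) where
  carrier := {g | ∀ x : L, g (algebraMap L (NormalClosure K L) x) =
    algebraMap L (NormalClosure K L) x}
  mul_mem' := by
    intro a b ha hb x
    rw [AlgEquiv.mul_apply, hb x, ha x]
  one_mem' := fun _ => rfl
  inv_mem' := by
    intro a ha x
    have h := ha x
    rw [AlgEquiv.aut_inv, AlgEquiv.symm_apply_eq]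
    exact h.symm

/-- `L/K` is almost classically Galois: `Gal(E/L)` has a normal complement in `Gal(E/K)`. -/
def AlmostClassicallyGalois : Prop :=
  ∃ C : Subgroup (NormalClosure K L ≃ₐ[K] NormalClosure K L),
    C.Normal ∧ Subgroup.IsComplement' C (stabGal K L)

/-- `L/K` realises the permutation group `G` acting on `X`: there is an isomorphism
`G ≅ Gal(E/K)` which takes the stabiliser of a point to `Gal(E/L)`. -/
def Realises (G X : Type*) [Group G] [MulAction G X] : Prop :=
  ∃ (θ : G ≃* (NormalClosure K L ≃ₐ[K] NormalClosure K L)) (x : X),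
    (MulAction.stabilizer G x).map θ.toMonoidHom = stabGal K L

end Structures

/-! ### Permutation groups -/

/-- Transitive permutation groups on `n` letters. -/
abbrev TransPermGroup (n : ℕ) : Type :=
  {G : Subgroup (Equiv.Perm (Fin n)) // MulAction.IsPretransitive G (Fin n)}

namespace TransPermGroup

variable {n : ℕ}

/-- Isomorphism of permutation groups: a group isomorphism together with a compatible bijection
of the underlying sets. -/
def Isom (G H : TransPermGroup n) : Prop :=
  ∃ (θ : G.1 ≃* H.1) (f : Fin n ≃ Fin n), ∀ (g : G.1) (x : Fin n), f (g • x) = θ g • f x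

theorem isom_equivalence : Equivalence (Isom (n := n)) where
  refl G := ⟨MulEquiv.refl _, Equiv.refl _, fun _ _ => rfl⟩
  symm := by
    rintro G H ⟨θ, f, h⟩
    refine ⟨θ.symm, f.symm, fun g x => ?_⟩
    rw [Equiv.symm_apply_eq, h, MulEquiv.apply_symm_apply, Equiv.apply_symm_apply]
  trans := by
    rintro G H J ⟨θ, f, h⟩ ⟨η, k, h'⟩
    refine ⟨θ.trans η, f.trans k, fun g x => ?_⟩
    simp [h, h']

/-- The setoid whose classes are the isomorphism types of permutation groups of degree `n`. -/
instance setoid (n : ℕ) : Setoid (TransPermGroup n) where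
  r := Isom
  iseqv := isom_equivalence

/-- A permutation group is regular if for all `x`, `y` a unique element takes `x` to `y`. -/
def IsRegular (G : TransPermGroup n) : Prop :=
  ∀ x y : Fin n, ∃! g : G.1, g • x = y

/-- `G` is realised by a Hopf-Galois structure of type `N`: some finite separable field extension
`L/K` which realises `G` admits a Hopf-Galois structure of type `N`. -/
def RealisedByType (G : TransPermGroup n) (N : Type*) [Group N] : Prop :=
  ∃ (K L : Type u) (_ : Field K) (_ : Field L) (_ : Algebra K L),
    FiniteDimensional K L ∧ Algebra.IsSeparable K L ∧ Realises K L G.1 (Fin n) ∧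
      ∃ S : HopfGaloisStructure K L, S.HasType N

end TransPermGroup

/-- The cyclic group of order `n`, written multiplicatively. -/
abbrev Cyc (n : ℕ) : Type := Multiplicative (ZMod n)

end HopfGalois

end

/-!
After base change to the normal closure `E` of `L/K`, a Hopf-Galois structure of type `N` becomes
an action of the group algebra `E[N]` on the functions on the set of `K`-embeddings `L → E`, and
the Galois condition says that `N` permutes these embeddings simply transitively. Galois descent
(taking fixed points under `Gal(E/K)`) then puts the structures of type `N` in bijection with the
regular subgroups isomorphic to `N` of the permutations of the embeddings that are normalised by
`Gal(E/K)` (Greither-Pareigis).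

So a permutation group of degree `pq` is realised by cyclic type if and only if it is isomorphic
to a transitive group `G` of affine permutations of `ZMod p × ZMod q`. If `G` contains all
translations, it is determined by its group of multipliers, an arbitrary subgroup of
`(ZMod p)ˣ × (ZMod q)ˣ`. As `(ZMod p)ˣ` is cyclic of order `2q` and `(ZMod q)ˣ` is cyclic of order
`2 ^ r * s`, Goursat's lemma gives `(6r + 4) σ₀(s)` such subgroups. Otherwise, since `q` divides
`p - 1`, the translations along `ZMod q` occur in `G` only twisted by a nontrivial character
`χ : ZMod q → (ZMod p)ˣ`, and this leaves two more groups, one of them regular and non-abelian.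

The shears `(x, y) ↦ (x + h * χ y, y)` normalise the regular non-abelian group and move the
translations through `p` regular cyclic groups normalised by it. In all other cases the
translations are the only such group.
-/

noncomputable section

open scoped TensorProduct

namespace HopfGalois

/-! ### Base change and descent of Hopf algebras -/

section BaseChange

variable {K E : Type*} [CommRing K] [CommRing E] [Algebra K E]
variable {M M' M₁ M₁' P P' P₁ P₁' Q Q' : Type*}
  [AddCommGroup M] [Module K M]
  [AddCommGroup M'] [Module K M'] [Module E M'] [IsScalarTower K E M']
  [AddCommGroup M₁] [Module K M₁]
  [AddCommGroup M₁'] [Module K M₁'] [Module E M₁'] [IsScalarTower K E M₁']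
  [AddCommGroup P] [Module K P]
  [AddCommGroup P'] [Module K P'] [Module E P'] [IsScalarTower K E P']
  [AddCommGroup P₁] [Module K P₁]
  [AddCommGroup P₁'] [Module K P₁'] [Module E P₁'] [IsScalarTower K E P₁']
  [AddCommGroup Q] [Module K Q]
  [AddCommGroup Q'] [Module K Q'] [Module E Q'] [IsScalarTower K E Q']

theorem injective_of_isBaseChange [Module.FaithfullyFlat K E] {f : M →ₗ[K] M'}
    (hf : IsBaseChange E f) : Function.Injective f := by
  have hcomp : ⇑f = hf.equiv ∘ TensorProduct.mk K E M 1 := by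
    funext m
    simp [hf.equiv_tmul]
  rw [hcomp]
  exact hf.equiv.injective.comp (Module.FaithfullyFlat.tensorProduct_mk_injective M)

variable (E) in
/-- The map `M ⊗[K] P → M' ⊗[E] P'` induced by `K`-linear maps from `K`-modules to `E`-modules. -/
def tensorMap (f : M →ₗ[K] M') (g : P →ₗ[K] P') : M ⊗[K] P →ₗ[K] M' ⊗[E] P' :=
  TensorProduct.mapOfCompatibleSMul E K K M' P' ∘ₗ TensorProduct.map f g

@[simp]
theorem tensorMap_tmul (f : M →ₗ[K] M') (g : P →ₗ[K] P') (m : M) (p : P) :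
    tensorMap E f g (m ⊗ₜ p) = f m ⊗ₜ g p := by
  simp [tensorMap]

theorem isBaseChange_tensorMap {f : M →ₗ[K] M'} {g : P →ₗ[K] P'}
    (hf : IsBaseChange E f) (hg : IsBaseChange E g) : IsBaseChange E (tensorMap E f g) := by
  refine .of_equiv ((TensorProduct.AlgebraTensorModule.distribBaseChange K E M P).trans
    (TensorProduct.congr hf.equiv hg.equiv)) fun t => ?_
  induction t with
  | zero => simp
  | add a b ha hb => simp only [TensorProduct.tmul_add, map_add, ha, hb]
  | tmul m p => simp [hf.equiv_tmul, hg.equiv_tmul]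

theorem tensorMap_rTensor {f : M →ₗ[K] M'} {f₁ : M₁ →ₗ[K] M₁'} (g : P →ₗ[K] P')
    {φ : M →ₗ[K] M₁} {φ' : M' →ₗ[E] M₁'} (h : f₁ ∘ₗ φ = φ'.restrictScalars K ∘ₗ f) (t : M ⊗[K] P) :
    tensorMap E f₁ g (φ.rTensor P t) = φ'.rTensor P' (tensorMap E f g t) := by
  induction t with
  | zero => simp
  | add a b ha hb => simp only [map_add, ha, hb]
  | tmul m p => simpa using congr($(LinearMap.congr_fun h m) ⊗ₜ g p)

theorem tensorMap_lTensor (f : M →ₗ[K] M') {g : P →ₗ[K] P'} {g₁ : P₁ →ₗ[K] P₁'}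
    {φ : P →ₗ[K] P₁} {φ' : P' →ₗ[E] P₁'} (h : g₁ ∘ₗ φ = φ'.restrictScalars K ∘ₗ g) (t : M ⊗[K] P) :
    tensorMap E f g₁ (φ.lTensor M t) = φ'.lTensor M' (tensorMap E f g t) := by
  induction t with
  | zero => simp
  | add a b ha hb => simp only [map_add, ha, hb]
  | tmul m p => simpa using congr(f m ⊗ₜ $(LinearMap.congr_fun h p))

theorem tensorMap_assoc (f : M →ₗ[K] M') (g : P →ₗ[K] P') (k : Q →ₗ[K] Q')
    (t : (M ⊗[K] P) ⊗[K] Q) :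
    tensorMap E f (tensorMap E g k) (TensorProduct.assoc K M P Q t) =
      TensorProduct.assoc E M' P' Q' (tensorMap E (tensorMap E f g) k t) := by
  induction t with
  | zero => simp
  | add a b ha hb => simp only [map_add, ha, hb]
  | tmul s q =>
    induction s with
    | zero => simp
    | add a b ha hb => simp only [map_add, TensorProduct.add_tmul, ha, hb]
    | tmul m p => simp

theorem tensorMap_comm (f : M →ₗ[K] M') (g : P →ₗ[K] P') (t : M ⊗[K] P) :
    tensorMap E g f (TensorProduct.comm K M P t) =
      TensorProduct.comm E M' P' (tensorMap E f g t) := by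
  induction t with
  | zero => simp
  | add a b ha hb => simp only [map_add, ha, hb]
  | tmul m p => simp

theorem map_lid_eq_lid_tensorMap (f : M →ₗ[K] M') (t : K ⊗[K] M) :
    f (TensorProduct.lid K M t) =
      TensorProduct.lid E M' (tensorMap E (Algebra.linearMap K E) f t) := by
  induction t with
  | zero => simp
  | add a b ha hb => simp only [map_add, ha, hb]
  | tmul k m => simp

theorem map_rid_eq_rid_tensorMap (f : M →ₗ[K] M') (t : M ⊗[K] K) :
    f (TensorProduct.rid K M t) =
      TensorProduct.rid E M' (tensorMap E f (Algebra.linearMap K E) t) := by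
  induction t with
  | zero => simp
  | add a b ha hb => simp only [map_add, ha, hb]
  | tmul m k => simp

variable {H C : Type*} [Ring H] [Algebra K H] [Ring C] [Algebra E C] [Algebra K C]
  [IsScalarTower K E C]

theorem tensorMap_mul (i : H →ₐ[K] C) (x y : H ⊗[K] H) :
    tensorMap E i.toLinearMap i.toLinearMap (x * y) =
      tensorMap E i.toLinearMap i.toLinearMap x * tensorMap E i.toLinearMap i.toLinearMap y := by
  induction x with
  | zero => simp
  | add a b ha hb => simp only [add_mul, map_add, ha, hb]
  | tmul a b =>
    induction y with
    | zero => simp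
    | add c d hc hd => simp only [mul_add, map_add, hc, hd]
    | tmul c d => simp

theorem map_mul'_eq_mul'_tensorMap (i : H →ₐ[K] C) (t : H ⊗[K] H) :
    i (LinearMap.mul' K H t) =
      LinearMap.mul' E C (tensorMap E i.toLinearMap i.toLinearMap t) := by
  induction t with
  | zero => simp
  | add a b ha hb => simp only [map_add, ha, hb]
  | tmul a b => simp

end BaseChange

section HopfForms

open Coalgebra

variable {K E H C : Type*} [CommRing K] [CommRing E] [Algebra K E] [Module.FaithfullyFlat K E]
  [Ring H] [Algebra K H] [Ring C] [HopfAlgebra E C] [Algebra K C] [IsScalarTower K E C]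

omit [Module.FaithfullyFlat K E] in
variable (E) in
/-- The algebra map `i : H → C` exhibits `H` as a `K`-form of the `E`-Hopf algebra `C`: the base
change of `H` to `E` is `C`, and the structure maps of `C` descend to `H`. -/
structure IsHopfForm (i : H →ₐ[K] C) : Prop where
  isBaseChange : IsBaseChange E i.toLinearMap
  comul_mem : ∀ h, comul (R := E) (i h) ∈
    LinearMap.range (tensorMap E i.toLinearMap i.toLinearMap)
  counit_mem : ∀ h, counit (R := E) (i h) ∈ LinearMap.range (Algebra.linearMap K E)
  antipode_mem : ∀ h, HopfAlgebra.antipode E (i h) ∈ LinearMap.range i.toLinearMap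

namespace IsHopfForm

variable {i : H →ₐ[K] C} (hi : IsHopfForm E i)
include hi

theorem injective : Function.Injective i := injective_of_isBaseChange hi.isBaseChange

theorem tensorMap_injective :
    Function.Injective (tensorMap E i.toLinearMap i.toLinearMap) :=
  injective_of_isBaseChange (isBaseChange_tensorMap hi.isBaseChange hi.isBaseChange)

/-- The comultiplication of a form of a Hopf algebra. -/
def comulMap : H →ₗ[K] H ⊗[K] H :=
  ((comul (R := E) (A := C)).restrictScalars K ∘ₗ i.toLinearMap).codRestrictOfInjective
    (tensorMap E i.toLinearMap i.toLinearMap) hi.tensorMap_injective hi.comul_mem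

theorem tensorMap_comp_comulMap :
    tensorMap E i.toLinearMap i.toLinearMap ∘ₗ hi.comulMap =
      (comul (R := E) (A := C)).restrictScalars K ∘ₗ i.toLinearMap :=
  LinearMap.codRestrictOfInjective_comp ..

theorem tensorMap_comulMap (h : H) :
    tensorMap E i.toLinearMap i.toLinearMap (hi.comulMap h) = comul (R := E) (i h) :=
  LinearMap.congr_fun hi.tensorMap_comp_comulMap h

/-- The counit of a form of a Hopf algebra. -/
def counitMap : H →ₗ[K] K :=
  ((counit (R := E) (A := C)).restrictScalars K ∘ₗ i.toLinearMap).codRestrictOfInjective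
    (Algebra.linearMap K E) (FaithfulSMul.algebraMap_injective K E) hi.counit_mem

theorem linearMap_comp_counitMap :
    Algebra.linearMap K E ∘ₗ hi.counitMap =
      (counit (R := E) (A := C)).restrictScalars K ∘ₗ i.toLinearMap :=
  LinearMap.codRestrictOfInjective_comp ..

theorem algebraMap_counitMap (h : H) :
    algebraMap K E (hi.counitMap h) = counit (R := E) (i h) :=
  LinearMap.congr_fun hi.linearMap_comp_counitMap h

/-- The antipode of a form of a Hopf algebra. -/
def antipodeMap : H →ₗ[K] H :=
  ((HopfAlgebra.antipode E (A := C)).restrictScalars K ∘ₗ i.toLinearMap).codRestrictOfInjective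
    i.toLinearMap hi.injective hi.antipode_mem

theorem toLinearMap_comp_antipodeMap :
    i.toLinearMap ∘ₗ hi.antipodeMap =
      (HopfAlgebra.antipode E (A := C)).restrictScalars K ∘ₗ i.toLinearMap :=
  LinearMap.codRestrictOfInjective_comp ..

/-- The coalgebra structure on a form of a Hopf algebra. -/
@[reducible]
def coalgebra : Coalgebra K H where
  comul := hi.comulMap
  counit := hi.counitMap
  coassoc := by
    ext h
    apply injective_of_isBaseChange (isBaseChange_tensorMap hi.isBaseChange
      (isBaseChange_tensorMap hi.isBaseChange hi.isBaseChange))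
    simp only [LinearMap.comp_apply, LinearEquiv.coe_coe]
    rw [tensorMap_assoc, tensorMap_rTensor _ hi.tensorMap_comp_comulMap,
      tensorMap_lTensor _ hi.tensorMap_comp_comulMap]
    simp only [hi.tensorMap_comulMap, coassoc_apply]
  rTensor_counit_comp_comul := by
    ext h
    apply (TensorProduct.lid K H).injective
    apply hi.injective
    change i.toLinearMap _ = i.toLinearMap _
    rw [map_lid_eq_lid_tensorMap (E := E), LinearMap.comp_apply,
      tensorMap_rTensor _ hi.linearMap_comp_counitMap, hi.tensorMap_comulMap, rTensor_counit_comul]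
    simp
  lTensor_counit_comp_comul := by
    ext h
    apply (TensorProduct.rid K H).injective
    apply hi.injective
    change i.toLinearMap _ = i.toLinearMap _
    rw [map_rid_eq_rid_tensorMap (E := E), LinearMap.comp_apply,
      tensorMap_lTensor _ hi.linearMap_comp_counitMap, hi.tensorMap_comulMap, lTensor_counit_comul]
    simp

/-- The bialgebra structure on a form of a Hopf algebra. -/
@[reducible]
def bialgebra : Bialgebra K H :=
  letI := hi.coalgebra
  Bialgebra.mk' K H
    (FaithfulSMul.algebraMap_injective K E <|
      (hi.algebraMap_counitMap 1).trans <| by simp)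
    (fun {a b} => FaithfulSMul.algebraMap_injective K E <|
      (hi.algebraMap_counitMap _).trans <| by
        rw [map_mul, Bialgebra.counit_mul, ← hi.algebraMap_counitMap, ← hi.algebraMap_counitMap,
          ← map_mul]
        rfl)
    (hi.tensorMap_injective <|
      (hi.tensorMap_comulMap 1).trans <| by simp [Algebra.TensorProduct.one_def])
    (fun {a b} => hi.tensorMap_injective <|
      (hi.tensorMap_comulMap _).trans <| by
        rw [map_mul, Bialgebra.comul_mul, ← hi.tensorMap_comulMap, ← hi.tensorMap_comulMap,
          ← tensorMap_mul]
        rfl)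

/-- The Hopf algebra structure on a form of a Hopf algebra. -/
@[reducible]
def hopfAlgebra : HopfAlgebra K H :=
  letI := hi.bialgebra
  have map_unit_counit (h : H) : i (algebraMap K H (hi.counitMap h)) =
      algebraMap E C (counit (i h)) := by
    rw [AlgHom.commutes, IsScalarTower.algebraMap_apply K E C, hi.algebraMap_counitMap]
  { antipode := hi.antipodeMap
    mul_antipode_rTensor_comul := by
      ext h
      apply hi.injective
      change i (LinearMap.mul' K H (hi.antipodeMap.rTensor H (hi.comulMap h))) =
        i (algebraMap K H (hi.counitMap h))
      rw [map_mul'_eq_mul'_tensorMap (E := E), tensorMap_rTensor _ hi.toLinearMap_comp_antipodeMap,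
        hi.tensorMap_comulMap, HopfAlgebra.mul_antipode_rTensor_comul_apply, map_unit_counit]
    mul_antipode_lTensor_comul := by
      ext h
      apply hi.injective
      change i (LinearMap.mul' K H (hi.antipodeMap.lTensor H (hi.comulMap h))) =
        i (algebraMap K H (hi.counitMap h))
      rw [map_mul'_eq_mul'_tensorMap (E := E), tensorMap_lTensor _ hi.toLinearMap_comp_antipodeMap,
        hi.tensorMap_comulMap, HopfAlgebra.mul_antipode_lTensor_comul_apply, map_unit_counit] }

theorem isCocomm [IsCocomm E C] :
    letI := hi.hopfAlgebra
    IsCocomm K H := by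
  let _ := hi.hopfAlgebra
  refine ⟨?_⟩
  ext h
  apply hi.tensorMap_injective
  change tensorMap E _ _ (TensorProduct.comm K H H (hi.comulMap h)) =
    tensorMap E _ _ (hi.comulMap h)
  rw [tensorMap_comm, hi.tensorMap_comulMap, comm_comul]

omit hi [Module.FaithfullyFlat K E] in
theorem map_comul_tmul (ψ : E ⊗[K] H →ₗ[E] C) {f : H →ₗ[K] C}
    (hψ : ∀ e h, ψ (e ⊗ₜ h) = e • f h) (e : E) (t : H ⊗[K] H) :
    TensorProduct.map ψ ψ
      (TensorProduct.AlgebraTensorModule.tensorTensorTensorComm K E K E E E H H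
        ((1 ⊗ₜ e) ⊗ₜ t)) = e • tensorMap E f f t := by
  induction t with
  | zero => simp
  | add a b ha hb => simp only [map_add, TensorProduct.tmul_add, ha, hb, smul_add]
  | tmul a b => simp [hψ]

theorem nonempty_bialgEquiv :
    letI := hi.hopfAlgebra
    Nonempty ((E ⊗[K] H) ≃ₐc[E] C) := by
  let _ := hi.hopfAlgebra
  let ψ : E ⊗[K] H →ₐ[E] C := Algebra.TensorProduct.lift (Algebra.ofId E C) i
    (fun e h => Algebra.commutes e (i h))
  have hψ (e h) : ψ (e ⊗ₜ h) = e • i h :=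
    (Algebra.TensorProduct.lift_tmul _ _ _ e h).trans (Algebra.smul_def e (i h)).symm
  have hbijective : Function.Bijective ψ := by
    have : ψ.toLinearMap = hi.isBaseChange.equiv.toLinearMap := by
      ext h
      simp [hψ, hi.isBaseChange.equiv_tmul]
    exact congr(Function.Bijective ⇑$this).mpr hi.isBaseChange.equiv.bijective
  have hcounit (x) : counit (R := E) (ψ x) = counit (R := E) x := by
    induction x with
    | zero => simp
    | add a b ha hb => simp only [map_add, ha, hb]
    | tmul e h =>
      rw [hψ, TensorProduct.counit_tmul, map_smul, ← hi.algebraMap_counitMap]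
      exact (mul_comm _ _).trans (Algebra.smul_def (hi.counitMap h) e).symm
  have hcomul (x) : TensorProduct.map ψ.toLinearMap ψ.toLinearMap (comul (R := E) x) =
      comul (R := E) (ψ x) := by
    induction x with
    | zero => simp
    | add a b ha hb => simp only [map_add, ha, hb]
    | tmul e h =>
      rw [hψ, TensorProduct.comul_tmul, map_smul, ← hi.tensorMap_comulMap]
      exact map_comul_tmul ψ.toLinearMap (f := i.toLinearMap) hψ e (hi.comulMap h)
  exact ⟨BialgEquiv.ofBijective
    (BialgHom.ofAlgHom ψ (AlgHom.ext hcounit) (AlgHom.ext hcomul)) hbijective⟩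

end IsHopfForm

end HopfForms

section Bases

open Module

variable {K E ι M M' : Type*} [Field K] [Field E] [Algebra K E]
  [AddCommGroup M] [Module K M] [AddCommGroup M'] [Module K M'] [Module E M']
  [IsScalarTower K E M']

theorem isBaseChange_of_basis {f : M →ₗ[K] M'} (b : Basis ι K M) (b' : Basis ι E M')
    (h : ∀ i, f (b i) = b' i) : IsBaseChange E f := by
  let φ := (b.baseChange E).equiv b' (Equiv.refl ι)
  have hφ : φ.toLinearMap.restrictScalars K ∘ₗ TensorProduct.mk K E M 1 = f :=
    b.ext fun i => by simp [φ, h, ← Basis.baseChange_apply]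
  exact .of_equiv φ (LinearMap.congr_fun hφ)

theorem repr_apply_of_semilinear {σ : E →+* E} (b : Basis ι E M') (T : M' →ₛₗ[σ] M')
    (hT : ∀ i, T (b i) = b i) (x : M') (i : ι) : b.repr (T x) i = σ (b.repr x i) := by
  have h : T x = Finsupp.linearCombination E b ((b.repr x).mapRange σ (map_zero σ)) := by
    conv_lhs => rw [← b.linearCombination_repr x]
    rw [Finsupp.linearCombination_apply, Finsupp.linearCombination_apply, Finsupp.sum,
      Finsupp.sum_mapRange_index (by simp), Finsupp.sum, map_sum]
    simp only [map_smulₛₗ, hT]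
  rw [h, b.repr_linearCombination]
  simp

theorem mem_span_range_of_fixed [FiniteDimensional K E] [IsGalois K E] (b : Basis ι E M')
    (T : (γ : E ≃ₐ[K] E) → M' →ₛₗ[(γ : E →+* E)] M') (hT : ∀ γ i, T γ (b i) = b i) {x : M'}
    (hx : ∀ γ, T γ x = x) : x ∈ Submodule.span K (Set.range b) := by
  rw [b.mem_span_iff_repr_mem K]
  refine fun i => (IsGalois.mem_range_algebraMap_iff_fixed _).2 fun γ => ?_
  exact (repr_apply_of_semilinear b (T γ) (hT γ) x i).symm.trans (by rw [hx γ])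

theorem mem_range_of_fixed [FiniteDimensional K E] [IsGalois K E] {f : M →ₗ[K] M'}
    (hf : IsBaseChange E f) (T : (γ : E ≃ₐ[K] E) → M' →ₛₗ[(γ : E →+* E)] M')
    (hT : ∀ γ m, T γ (f m) = f m) {x : M'} (hx : ∀ γ, T γ x = x) : x ∈ LinearMap.range f := by
  have hbasis := hf.basis_apply (Free.chooseBasis K M)
  refine Submodule.span_le.2 ?_ (mem_span_range_of_fixed (hf.basis (Free.chooseBasis K M)) T
    (fun γ i => by rw [hbasis, hT]) hx)
  rintro _ ⟨i, rfl⟩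
  exact ⟨_, (hbasis i).symm⟩

theorem mem_of_map_mem_span {f : M →ₗ[K] M'} (hf : IsBaseChange E f) {A : Submodule K M} {m : M}
    (hm : f m ∈ Submodule.span E (f '' A)) : m ∈ A := by
  by_contra hmA
  obtain ⟨φ, hφm, hφA⟩ := Submodule.exists_le_ker_of_notMem hmA
  let φ' : M' →ₗ[E] E := hf.lift (Algebra.linearMap K E ∘ₗ φ)
  have hφ' (x) : φ' (f x) = algebraMap K E (φ x) := hf.lift_eq _ x
  have hspan : Submodule.span E (f '' A) ≤ LinearMap.ker φ' := by
    refine Submodule.span_le.2 ?_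
    rintro _ ⟨a, ha, rfl⟩
    simp [hφ', LinearMap.mem_ker.1 (hφA ha)]
  exact hφm ((map_eq_zero (algebraMap K E)).1 ((hφ' m).symm.trans (hspan hm)))

end Bases

section Descent

open Module

variable (K E V : Type*) [Field K] [Field E] [Algebra K E] [AddCommGroup V] [Module E V]

/-- A semilinear representation of `Gal(E/K)` on an `E`-vector space, the datum of Galois
descent. -/
structure SemilinearRep where
  act (γ : E ≃ₐ[K] E) : V →ₛₗ[(γ : E →+* E)] V
  act_one (v : V) : act 1 v = v
  act_mul (γ δ : E ≃ₐ[K] E) (v : V) : act (γ * δ) v = act γ (act δ v)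

namespace SemilinearRep

variable {K E V} [Module K V] [IsScalarTower K E V] (ρ : SemilinearRep K E V)

/-- The `K`-form of `V` that a semilinear representation defines: its fixed points. -/
def fixedPoints : Submodule K V where
  carrier := {v | ∀ γ, ρ.act γ v = v}
  add_mem' hv hw γ := by rw [map_add, hv γ, hw γ]
  zero_mem' γ := map_zero _
  smul_mem' k v hv γ := by
    rw [← algebraMap_smul E k, map_smulₛₗ, hv γ]
    simp

variable [FiniteDimensional K E]

theorem sum_act_mem_fixedPoints (v : V) : ∑ γ, ρ.act γ v ∈ ρ.fixedPoints := fun δ => by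
  simp only [map_sum, ← ρ.act_mul]
  exact Fintype.sum_equiv (Equiv.mulLeft δ) _ _ fun _ => rfl

/- A functional `φ` killing all the traces `∑ γ(e) • γ(v)` gives a linear relation
`∑ φ(γ(v)) γ = 0` between the distinct characters `γ` of `E`. -/
theorem span_fixedPoints : Submodule.span E (ρ.fixedPoints : Set V) = ⊤ := by
  refine Submodule.eq_top_iff'.2 fun v => by_contra fun hv => ?_
  obtain ⟨φ, hφv, hφ⟩ := Submodule.exists_le_ker_of_notMem hv
  have hindep := Fintype.linearIndependent_iff.1 <|
    (linearIndependent_toLinearMap K E E).comp (fun γ : E ≃ₐ[K] E => (γ : E →ₐ[K] E))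
      fun _ _ h => AlgEquiv.coe_toAlgHom_injective h
  have hrel : ∑ γ : E ≃ₐ[K] E, φ (ρ.act γ v) • (γ : E →ₐ[K] E).toLinearMap = 0 := by
    ext e
    have htrace := hφ (Submodule.subset_span (ρ.sum_act_mem_fixedPoints (e • v)))
    simpa [mul_comm] using htrace
  exact hφv (by simpa [ρ.act_one] using hindep _ hrel 1)

theorem isBaseChange_fixedPoints [IsGalois K E] : IsBaseChange E ρ.fixedPoints.subtype := by
  let b' := Basis.ofSpan ρ.span_fixedPoints.ge
  have hb' (i) : b' i ∈ ρ.fixedPoints := Basis.ofSpan_subset ρ.span_fixedPoints.ge ⟨i, rfl⟩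
  have hspan : Submodule.span K (Set.range b') = ρ.fixedPoints :=
    le_antisymm (Submodule.span_le.2 (Set.range_subset_iff.2 hb')) fun _ hx =>
      mem_span_range_of_fixed b' ρ.act (fun γ i => hb' i γ) hx
  have hindep : LinearIndependent K b' := b'.linearIndependent.restrict_scalars' K
  exact isBaseChange_of_basis ((Basis.span hindep).map (LinearEquiv.ofEq _ _ hspan)) b'
    fun i => by simp [Basis.span_apply]

theorem isBaseChange_of_range_eq [IsGalois K E] {M : Type*} [AddCommGroup M] [Module K M]
    {f : M →ₗ[K] V} (hf : Function.Injective f) (hrange : LinearMap.range f = ρ.fixedPoints) :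
    IsBaseChange E f := by
  let φ := (LinearEquiv.ofInjective f hf).trans (LinearEquiv.ofEq _ _ hrange)
  exact .of_equiv ((φ.baseChange K E _ _).trans ρ.isBaseChange_fixedPoints.equiv) fun m => by
    simp [φ, IsBaseChange.equiv_tmul]

end SemilinearRep

end Descent

section FixedAlgebra

open MonoidAlgebra Coalgebra

variable {K E N : Type*} [Field K] [Field E] [Algebra K E] [Group N]
  (κ : (E ≃ₐ[K] E) →* MulAut N)

/-- The semilinear action of `Gal(E/K)` on `E[N]` which is `κ` on `N`. -/
def galAct (γ : E ≃ₐ[K] E) : MonoidAlgebra E N →+* MonoidAlgebra E N :=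
  (mapDomainRingHom E (κ γ).toMonoidHom).comp (mapRingHom N (γ : E →+* E))

@[simp]
theorem galAct_single (γ : E ≃ₐ[K] E) (n : N) (e : E) :
    galAct κ γ (single n e) = single (κ γ n) (γ e) := by
  simp [galAct]

theorem galAct_smul (γ : E ≃ₐ[K] E) (e : E) (x : MonoidAlgebra E N) :
    galAct κ γ (e • x) = γ e • galAct κ γ x := by
  induction x using MonoidAlgebra.induction_linear with
  | zero => simp
  | add x y hx hy => simp only [smul_add, map_add, hx, hy]
  | single n r => simp [smul_single]

/-- `galAct` as a semilinear representation. -/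
def galRep : SemilinearRep K E (MonoidAlgebra E N) where
  act γ := { galAct κ γ with map_smul' := galAct_smul κ γ }
  act_one x := by
    change galAct κ 1 x = x
    induction x using MonoidAlgebra.induction_linear <;> simp_all
  act_mul γ δ x := by
    change galAct κ (γ * δ) x = galAct κ γ (galAct κ δ x)
    induction x using MonoidAlgebra.induction_linear <;> simp_all

@[simp]
theorem galRep_act (γ : E ≃ₐ[K] E) (x : MonoidAlgebra E N) :
    (galRep κ).act γ x = galAct κ γ x := rfl

/-- The `K`-algebra of fixed points of `Gal(E/K)` in `E[N]`. -/
def fixedAlg : Subalgebra K (MonoidAlgebra E N) where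
  carrier := (galRep κ).fixedPoints
  mul_mem' ha hb γ := (map_mul (galAct κ γ) _ _).trans (congrArg₂ _ (ha γ) (hb γ))
  add_mem' := (galRep κ).fixedPoints.add_mem
  algebraMap_mem' k γ := by
    rw [Algebra.algebraMap_eq_smul_one, ← algebraMap_smul E k, galRep_act, galAct_smul, map_one,
      AlgEquiv.commutes]

theorem comul_galAct (γ : E ≃ₐ[K] E) (x : MonoidAlgebra E N) :
    comul (R := E) (galAct κ γ x) =
      TensorProduct.map ((galRep κ).act γ) ((galRep κ).act γ) (comul (R := E) x) := by
  induction x using MonoidAlgebra.induction_linear <;> simp_all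

theorem counit_galAct (γ : E ≃ₐ[K] E) (x : MonoidAlgebra E N) :
    counit (R := E) (galAct κ γ x) = γ (counit (R := E) x) := by
  induction x using MonoidAlgebra.induction_linear <;> simp_all

theorem antipode_galAct (γ : E ≃ₐ[K] E) (x : MonoidAlgebra E N) :
    HopfAlgebra.antipode E (galAct κ γ x) = galAct κ γ (HopfAlgebra.antipode E x) := by
  induction x using MonoidAlgebra.induction_linear <;> simp_all

variable [FiniteDimensional K E] [IsGalois K E]

theorem isBaseChange_fixedAlg : IsBaseChange E (fixedAlg κ).val.toLinearMap :=
  (galRep κ).isBaseChange_fixedPoints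

theorem isHopfForm_fixedAlg : IsHopfForm E (fixedAlg κ).val where
  isBaseChange := isBaseChange_fixedAlg κ
  comul_mem h := by
    refine mem_range_of_fixed
      (isBaseChange_tensorMap (isBaseChange_fixedAlg κ) (isBaseChange_fixedAlg κ))
      (fun γ => TensorProduct.map ((galRep κ).act γ) ((galRep κ).act γ)) (fun γ t => ?_)
      fun γ => (comul_galAct κ γ h).symm.trans (congrArg _ (h.2 γ))
    induction t with
    | zero => simp
    | add a b ha hb => simp only [map_add, ha, hb]
    | tmul a b => exact congrArg₂ (· ⊗ₜ[E] ·) (a.2 γ) (b.2 γ)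
  counit_mem h := (IsGalois.mem_range_algebraMap_iff_fixed _).2 fun γ =>
    (counit_galAct κ γ h).symm.trans (congrArg _ (h.2 γ))
  antipode_mem h := ⟨⟨HopfAlgebra.antipode E (h : MonoidAlgebra E N), fun γ =>
    (antipode_galAct κ γ h).symm.trans (congrArg _ (h.2 γ))⟩, rfl⟩

theorem finrank_fixedAlg : Module.finrank K (fixedAlg κ) = Nat.card N := by
  rw [← Module.finrank_baseChange (R := E) (M' := fixedAlg κ),
    (isBaseChange_fixedAlg κ).equiv.finrank_eq, (MonoidAlgebra.coeffLinearEquiv E).finrank_eq]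
  exact Module.finrank_eq_nat_card_basis Finsupp.basisSingleOne

end FixedAlgebra

section Embeddings

open Module MonoidAlgebra

variable {K L E : Type*} [Field K] [Field L] [Field E] [Algebra K L] [Algebra K E]

variable (K L E) in
/-- The `E`-vector space of families of `K`-linear maps `L → E` indexed by the embeddings of `L`
in `E`. It is the base change to `E` of `Module.End K L`, through `transMap`. -/
abbrev EmbSpace := (L →ₐ[K] E) → (L →ₗ[K] E)

variable (K L E) in
/-- The family of all `y ∘ T`, for `T` an endomorphism of `L`. -/
def transMap : Module.End K L →ₗ[K] EmbSpace K L E where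
  toFun T y := y.toLinearMap ∘ₗ T
  map_add' _ _ := by ext; simp
  map_smul' _ _ := by ext; simp

@[simp]
theorem transMap_apply (T : Module.End K L) (y : L →ₐ[K] E) (l : L) :
    transMap K L E T y l = y (T l) := rfl

theorem transMap_injective [Nonempty (L →ₐ[K] E)] : Function.Injective (transMap K L E) := by
  obtain ⟨y⟩ := ‹Nonempty (L →ₐ[K] E)›
  exact fun T T' h => LinearMap.ext fun l => y.injective (LinearMap.congr_fun (congrFun h y) l)

/-- The family `y ↦ π⁻¹ y` attached to a permutation of the embeddings. -/
def permMap (π : Equiv.Perm (L →ₐ[K] E)) : EmbSpace K L E := fun y => (π⁻¹ y).toLinearMap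

@[simp]
theorem permMap_apply (π : Equiv.Perm (L →ₐ[K] E)) (y : L →ₐ[K] E) :
    permMap π y = (π⁻¹ y).toLinearMap := rfl

/-- The action of `Gal(E/K)` on the embeddings of `L` in `E`. -/
def galPerm : (E ≃ₐ[K] E) →* Equiv.Perm (L →ₐ[K] E) where
  toFun γ := AlgEquiv.refl.arrowCongr γ
  map_one' := rfl
  map_mul' _ _ := rfl

@[simp]
theorem galPerm_apply (γ : E ≃ₐ[K] E) (y : L →ₐ[K] E) (l : L) : galPerm γ y l = γ (y l) := rfl

variable (K L E) in
/-- The semilinear representation of `Gal(E/K)` on `EmbSpace` by `F ↦ γ ∘ F (γ⁻¹ ·)`. -/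
def embRep : SemilinearRep K E (EmbSpace K L E) where
  act γ :=
    { toFun F y := γ.toLinearMap ∘ₗ F ((galPerm γ)⁻¹ y)
      map_add' _ _ := by ext; simp
      map_smul' _ _ := by ext; simp }
  act_one _ := by ext; simp
  act_mul _ _ _ := by ext; simp

theorem embRep_act_apply (γ : E ≃ₐ[K] E) (F : EmbSpace K L E) (y : L →ₐ[K] E) (l : L) :
    (embRep K L E).act γ F y l = γ (F ((galPerm γ)⁻¹ y) l) := rfl

theorem embRep_act_transMap (γ : E ≃ₐ[K] E) (T : Module.End K L) :
    (embRep K L E).act γ (transMap K L E T) = transMap K L E T := by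
  ext y l
  exact γ.apply_symm_apply _

theorem embRep_act_permMap (γ : E ≃ₐ[K] E) (π : Equiv.Perm (L →ₐ[K] E)) :
    (embRep K L E).act γ (permMap π) = permMap (galPerm γ * π * (galPerm γ)⁻¹) := by
  ext y l
  simp [embRep_act_apply, mul_assoc]

/-- The `E`-span of the families attached to a space of endomorphisms of `L`. -/
def opSpan (A : Submodule K (Module.End K L)) : Submodule E (EmbSpace K L E) :=
  Submodule.span E (transMap K L E '' A)

theorem embRep_act_mem_opSpan {A : Submodule K (Module.End K L)} (γ : E ≃ₐ[K] E)
    {F : EmbSpace K L E} (hF : F ∈ opSpan A) : (embRep K L E).act γ F ∈ opSpan A := by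
  refine (Submodule.span_le (p := (opSpan A).comap ((embRep K L E).act γ))).2 ?_ hF
  rintro _ ⟨T, hT, rfl⟩
  rw [SetLike.mem_coe, Submodule.mem_comap, embRep_act_transMap]
  exact Submodule.subset_span ⟨T, hT, rfl⟩

section RegularActions

variable {N : Type*} [Group N] (ρ : N →* Equiv.Perm (L →ₐ[K] E))

/-- The `E`-linear extension of `n ↦ permMap (ρ n)` to the group algebra. -/
def permLin : MonoidAlgebra E N →ₗ[E] EmbSpace K L E :=
  Finsupp.linearCombination E (fun n => permMap (ρ n)) ∘ₗ (coeffLinearEquiv E).toLinearMap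

@[simp]
theorem permLin_single (n : N) (e : E) : permLin ρ (single n e) = e • permMap (ρ n) := by
  simp [permLin]

theorem permLin_mul_single (x : MonoidAlgebra E N) (n : N) (e : E) (y : L →ₐ[K] E) :
    permLin ρ (single n e * x) y = e • permLin ρ x ((ρ n)⁻¹ y) := by
  induction x using MonoidAlgebra.induction_linear with
  | zero => simp
  | add a b ha hb => simp only [mul_add, map_add, Pi.add_apply, ha, hb, smul_add]
  | single m r => simp [single_mul_single, mul_smul]

theorem range_permLin : LinearMap.range (permLin (E := E) ρ) =
    Submodule.span E (permMap '' (ρ.range : Set (Equiv.Perm (L →ₐ[K] E)))) := by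
  rw [permLin, LinearEquiv.range_comp, Finsupp.range_linearCombination, MonoidHom.coe_range,
    ← Set.range_comp]
  rfl

variable {ρ}

theorem permLin_apply_injective (hρ : ∀ x y, ∃! n, ρ n x = y) (y : L →ₐ[K] E) :
    Function.Injective (fun x : MonoidAlgebra E N => permLin ρ x y) := by
  have horbit : Function.Injective (fun n : N => (ρ n)⁻¹ y) := fun n m (h : _ = (ρ m)⁻¹ y) =>
    (hρ ((ρ n)⁻¹ y) y).unique (by simp) (by simp [h])
  have hindep := (linearIndependent_toLinearMap K L E).comp _ horbit
  have hpermLin : (fun x : MonoidAlgebra E N => permLin ρ x y) =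
      Finsupp.linearCombination E (AlgHom.toLinearMap ∘ fun n : N => (ρ n)⁻¹ y) ∘ coeff := by
    funext x
    induction x using MonoidAlgebra.induction_linear with
    | zero => simp
    | add a b ha hb => simp_all
    | single m r => simp
  rw [hpermLin]
  exact Function.Injective.comp hindep coeff_injective

theorem mem_range_of_permMap_mem [Nonempty (L →ₐ[K] E)] (hρ : ∀ x y, ∃! n, ρ n x = y)
    {π : Equiv.Perm (L →ₐ[K] E)} (h : permMap π ∈ LinearMap.range (permLin ρ)) :
    π ∈ ρ.range := by
  obtain ⟨w, hw⟩ := h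
  have w_eq_single (y) : ∃ n : N, w = single n 1 ∧ ρ n (π⁻¹ y) = y := by
    obtain ⟨n, hn, -⟩ := hρ (π⁻¹ y) y
    have hn' : (ρ n)⁻¹ y = π⁻¹ y := by rw [Equiv.Perm.inv_eq_iff_eq, hn]
    refine ⟨n, permLin_apply_injective hρ y ?_, hn⟩
    simp only [hw, permLin_single, one_smul, permMap_apply, hn']
  obtain ⟨y⟩ := ‹Nonempty (L →ₐ[K] E)›
  obtain ⟨n, hn, -⟩ := w_eq_single y
  refine ⟨n, Equiv.ext fun z => ?_⟩
  obtain ⟨m, hm, hmz⟩ := w_eq_single (π z)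
  rw [single_left_injective one_ne_zero (hn.symm.trans hm)]
  simpa using hmz

theorem coe_range_eq_setOf_permMap_mem [Nonempty (L →ₐ[K] E)] (hρ : ∀ x y, ∃! n, ρ n x = y) :
    (ρ.range : Set (Equiv.Perm (L →ₐ[K] E))) =
      {π | permMap π ∈ LinearMap.range (permLin (E := E) ρ)} := by
  ext π
  refine ⟨?_, fun h => mem_range_of_permMap_mem hρ h⟩
  rintro ⟨n, rfl⟩
  exact ⟨single n 1, by simp⟩

end RegularActions

variable [Algebra L E] [IsScalarTower K L E]

instance nonempty_embedding : Nonempty (L →ₐ[K] E) := ⟨IsScalarTower.toAlgHom K L E⟩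

theorem exists_galPerm_eq_of_normal [Normal K E] (y : L →ₐ[K] E) :
    ∃ γ : E ≃ₐ[K] E, galPerm γ (IsScalarTower.toAlgHom K L E) = y :=
  ⟨AlgEquiv.ofBijective (y.liftNormal E) (Algebra.IsAlgebraic.algHom_bijective _),
    AlgHom.ext (y.liftNormal_commutes E)⟩

theorem exists_galPerm_eq [Normal K E] (x y : L →ₐ[K] E) : ∃ γ : E ≃ₐ[K] E, galPerm γ x = y := by
  obtain ⟨γ, rfl⟩ := exists_galPerm_eq_of_normal x
  obtain ⟨δ, rfl⟩ := exists_galPerm_eq_of_normal y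
  exact ⟨δ * γ⁻¹, by simp [← Equiv.Perm.mul_apply, ← map_mul]⟩

variable [FiniteDimensional K E] [IsGalois K E]

theorem card_embeddings : Nat.card (L →ₐ[K] E) = finrank K L := by
  have : FiniteDimensional K L := FiniteDimensional.left K L E
  have : Algebra.IsSeparable K L := Algebra.isSeparable_tower_bot_of_isSeparable K L E
  rw [Nat.card_eq_fintype_card]
  refine AlgHom.card_of_splits K L E fun x => ?_
  rw [← minpoly.algebraMap_eq (algebraMap L E).injective x]
  exact Normal.splits inferInstance _

theorem mem_range_algebraMap_of_embRep_fixed {F : EmbSpace K L E}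
    (hF : F ∈ (embRep K L E).fixedPoints) (l : L) :
    F (IsScalarTower.toAlgHom K L E) l ∈ Set.range (algebraMap L E) := by
  have : IsGalois L E := IsGalois.tower_top_of_isGalois K L E
  have : FiniteDimensional L E := FiniteDimensional.right K L E
  refine (IsGalois.mem_range_algebraMap_iff_fixed _).2 fun γ => ?_
  have hstab : (galPerm (γ.restrictScalars K))⁻¹ (IsScalarTower.toAlgHom K L E) =
      IsScalarTower.toAlgHom K L E := by
    rw [Equiv.Perm.inv_eq_iff_eq]
    ext
    simp
  have hfixed := LinearMap.congr_fun (congrFun (hF (γ.restrictScalars K))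
    (IsScalarTower.toAlgHom K L E)) l
  rwa [embRep_act_apply, hstab] at hfixed

theorem range_transMap : LinearMap.range (transMap K L E) = (embRep K L E).fixedPoints := by
  refine le_antisymm ?_ fun F hF => ?_
  · rintro _ ⟨T, rfl⟩ γ
    exact embRep_act_transMap γ T
  let i := (IsScalarTower.toAlgHom K L E).toLinearMap
  let T : Module.End K L := (F (IsScalarTower.toAlgHom K L E)).codRestrictOfInjective i
    (algebraMap L E).injective (mem_range_algebraMap_of_embRep_fixed hF)
  have hT (l) : algebraMap L E (T l) = F (IsScalarTower.toAlgHom K L E) l :=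
    LinearMap.codRestrictOfInjective_comp_apply _ i _ _ l
  refine ⟨T, ?_⟩
  ext y l
  obtain ⟨γ, rfl⟩ := exists_galPerm_eq_of_normal y
  have hfixed := LinearMap.congr_fun (congrFun (hF γ)
    (galPerm γ (IsScalarTower.toAlgHom K L E))) l
  rw [embRep_act_apply, ← Equiv.Perm.mul_apply, inv_mul_cancel, Equiv.Perm.one_apply, ← hT]
    at hfixed
  exact hfixed

theorem isBaseChange_transMap : IsBaseChange E (transMap K L E) :=
  (embRep K L E).isBaseChange_of_range_eq transMap_injective range_transMap

theorem opSpan_injective : Function.Injective (opSpan (K := K) (L := L) (E := E)) := by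
  have le_of_eq {A B : Submodule K (Module.End K L)} (h : opSpan (E := E) A = opSpan B) :
      A ≤ B := fun T hT =>
    mem_of_map_mem_span (isBaseChange_transMap (K := K) (L := L) (E := E)) <|
      h.le (Submodule.subset_span ⟨T, hT, rfl⟩)
  exact fun A B h => le_antisymm (le_of_eq h) (le_of_eq h.symm)

end Embeddings

section ModuleAction

open Module

variable {K L H : Type*} [Field K] [Field L] [Algebra K L] [Ring H] [Algebra K H]
  (α : H →ₐ[K] Module.End K L)

/-- The map `L ⊗ H → End_K(L)`, `x ⊗ h ↦ (y ↦ x (h · y))`, of an action `α` of `H` on `L`. -/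
def galoisMap : L ⊗[K] H →ₗ[K] Module.End K L :=
  LinearMap.mul' K (Module.End K L) ∘ₗ TensorProduct.map (LinearMap.mul K L) α.toLinearMap

@[simp]
theorem galoisMap_tmul (x : L) (h : H) (y : L) : galoisMap α (x ⊗ₜ h) y = x * α h y := rfl

/-- The map `H ⊗ H → L`, `a ⊗ b ↦ (a · x) (b · y)`, of an action `α` of `H` on `L`. -/
def bilinAct (x y : L) : H ⊗[K] H →ₗ[K] L :=
  LinearMap.mul' K L ∘ₗ TensorProduct.map (LinearMap.applyₗ x ∘ₗ α.toLinearMap)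
    (LinearMap.applyₗ y ∘ₗ α.toLinearMap)

@[simp]
theorem bilinAct_tmul (x y : L) (a b : H) : bilinAct α x y (a ⊗ₜ b) = α a x * α b y := rfl

theorem galoisMap_rTensor (x y : L) (t : H ⊗[K] H) :
    galoisMap α ((LinearMap.applyₗ x ∘ₗ α.toLinearMap).rTensor H t) y = bilinAct α x y t := by
  induction t with
  | zero => simp
  | add a b ha hb => simp only [map_add, LinearMap.add_apply, ha, hb]
  | tmul a b => simp

variable {α}

theorem injective_of_injective_galoisMap (hα : Function.Injective (galoisMap α)) :
    Function.Injective α := by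
  intro a b h
  have htmul : (1 : L) ⊗ₜ[K] a = (1 : L) ⊗ₜ[K] b := hα (by ext; simp [h])
  exact Algebra.TensorProduct.includeRight_injective (A := L) (algebraMap K L).injective htmul

theorem eq_zero_of_bilinAct_eq_zero (hα : Function.Injective (galoisMap α)) {t : H ⊗[K] H}
    (ht : ∀ x y, bilinAct α x y t = 0) : t = 0 := by
  classical
  have hrTensor (x : L) : (LinearMap.applyₗ x ∘ₗ α.toLinearMap).rTensor H t = 0 :=
    hα (by ext y; simp [galoisMap_rTensor, ht])
  let b := Basis.ofVectorSpace K H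
  refine (TensorProduct.equivFinsuppOfBasisRight (M := H) b).map_eq_zero_iff.1 ?_
  ext i
  apply injective_of_injective_galoisMap hα
  ext x
  have hcoord := congrArg (fun s => TensorProduct.equivFinsuppOfBasisRight b s i) (hrTensor x)
  have hnat (s : H ⊗[K] H) : TensorProduct.equivFinsuppOfBasisRight b
      ((LinearMap.applyₗ x ∘ₗ α.toLinearMap).rTensor H s) i =
        α (TensorProduct.equivFinsuppOfBasisRight b s i) x := by
    induction s with
    | zero => simp
    | add s s' hs hs' => simp only [map_add, Finsupp.add_apply, hs, hs', LinearMap.add_apply]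
    | tmul a c => simp
  simpa [hnat] using hcoord

end ModuleAction

/-! ### The regular action attached to a Hopf-Galois structure -/

namespace HopfGaloisStructure

open Module MonoidAlgebra Coalgebra

variable {K L : Type u} [Field K] [Field L] [Algebra K L] (S : HopfGaloisStructure K L)

/-- The image of the Hopf algebra in the endomorphisms of `L`; it determines the Hopf-Galois
structure up to isomorphism. -/
def actRange : Submodule K (Module.End K L) := LinearMap.range S.act.toLinearMap

theorem galoisMap_bijective : Function.Bijective (galoisMap S.act) := S.galois

theorem act_injective : Function.Injective S.act :=
  injective_of_injective_galoisMap S.galoisMap_bijective.1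

theorem bilinAct_comul (h : S.H) (x y : L) :
    bilinAct S.act x y (comul h) = S.act h (x * y) :=
  (S.act_mul h x y).symm

variable {S} in
theorem equivalent_of_algEquiv {T : HopfGaloisStructure K L} (e : S.H ≃ₐ[K] T.H)
    (he : ∀ a, T.act (e a) = S.act a) : S.Equivalent T := by
  have hbilin (t : S.H ⊗[K] S.H) (x y : L) : bilinAct T.act x y
      (TensorProduct.map e.toLinearMap e.toLinearMap t) = bilinAct S.act x y t := by
    induction t with
    | zero => simp
    | add a b ha hb => simp only [map_add, ha, hb]
    | tmul a b => simp [he]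
  have hcounit (a : S.H) : counit (R := K) (e a) = counit (R := K) a := by
    have hS := S.act_algebraMap a 1
    have hT := T.act_algebraMap (e a) 1
    rw [he, hS, mul_one, mul_one] at hT
    exact (algebraMap K L).injective hT.symm
  have hcomul (a : S.H) : TensorProduct.map e.toLinearMap e.toLinearMap (comul (R := K) a) =
      comul (R := K) (e a) := by
    refine sub_eq_zero.1 (eq_zero_of_bilinAct_eq_zero T.galoisMap_bijective.1 fun x y => ?_)
    rw [map_sub, hbilin, bilinAct_comul, bilinAct_comul, he, sub_self]
  let φ : S.H →ₐc[K] T.H := BialgHom.ofAlgHom (e : S.H →ₐ[K] T.H)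
    (AlgHom.ext hcounit) (AlgHom.ext hcomul)
  exact ⟨BialgEquiv.ofBijective φ e.bijective, he⟩

theorem equivalent_iff_actRange_eq {S T : HopfGaloisStructure K L} :
    S.Equivalent T ↔ S.actRange = T.actRange := by
  constructor
  · rintro ⟨e, he⟩
    refine le_antisymm ?_ ?_
    · rintro _ ⟨a, rfl⟩
      exact ⟨e a, he a⟩
    · rintro _ ⟨a, rfl⟩
      obtain ⟨a, rfl⟩ := e.surjective a
      exact ⟨a, (he a).symm⟩
  · intro h
    have hrange : S.act.range = T.act.range := SetLike.ext fun x => SetLike.ext_iff.1 h x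
    let eS := AlgEquiv.ofInjective S.act S.act_injective
    let eT := AlgEquiv.ofInjective T.act T.act_injective
    refine equivalent_of_algEquiv
      (eS.trans ((Subalgebra.equivOfEq _ _ hrange).trans eT.symm)) fun a => ?_
    exact congrArg Subtype.val (eT.apply_symm_apply (Subalgebra.equivOfEq _ _ hrange (eS a)))

variable (E : Type*) [Field E] [Algebra K E]

/-- The `E`-linear extension of the action of `H`: an element of `E ⊗ H` gives a linear map
`L → E` for each embedding of `L` in `E`. -/
def baseAct : E ⊗[K] S.H →ₗ[E] EmbSpace K L E :=
  (transMap K L E ∘ₗ S.act.toLinearMap).liftBaseChange E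

@[simp]
theorem baseAct_tmul (e : E) (h : S.H) :
    S.baseAct E (e ⊗ₜ h) = e • transMap K L E (S.act h) := by
  simp [baseAct]

theorem range_baseAct : LinearMap.range (S.baseAct E) = opSpan S.actRange := by
  rw [baseAct, LinearMap.range_liftBaseChange, LinearMap.range_comp, Submodule.map_coe]
  rfl

variable {E}

theorem baseAct_mul_tmul (w : E ⊗[K] S.H) (e : E) (h : S.H) (y : L →ₐ[K] E) :
    S.baseAct E (w * (e ⊗ₜ h)) y = e • S.baseAct E w y ∘ₗ S.act h := by
  induction w with
  | zero => simp
  | add a b ha hb => simp only [add_mul, map_add, Pi.add_apply, ha, hb, LinearMap.add_comp,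
      smul_add]
  | tmul c d =>
    ext l
    simp [mul_left_comm, mul_assoc]

theorem baseAct_mul {w : E ⊗[K] S.H} {y z : L →ₐ[K] E}
    (h : S.baseAct E w y = z.toLinearMap) (w' : E ⊗[K] S.H) :
    S.baseAct E (w * w') y = S.baseAct E w' z := by
  induction w' with
  | zero => simp
  | add a b ha hb => simp only [mul_add, map_add, Pi.add_apply, ha, hb]
  | tmul c d => rw [baseAct_mul_tmul, h, baseAct_tmul]; rfl

theorem baseAct_one (y : L →ₐ[K] E) : S.baseAct E 1 y = y.toLinearMap := by
  ext l
  simp [Algebra.TensorProduct.one_def]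

/-- The linear form `w ↦ (w · y) l` on `E ⊗ H`. -/
def evalAct (y : L →ₐ[K] E) (l : L) : E ⊗[K] S.H →ₗ[E] E where
  toFun w := S.baseAct E w y l
  map_add' _ _ := by simp
  map_smul' _ _ := by simp

@[simp]
theorem evalAct_apply (y : L →ₐ[K] E) (l : L) (w : E ⊗[K] S.H) :
    S.evalAct y l w = S.baseAct E w y l := rfl

theorem baseAct_apply_mul (w : E ⊗[K] S.H) (y : L →ₐ[K] E) (l m : L) :
    S.baseAct E w y (l * m) = LinearMap.mul' E E
      (TensorProduct.map (S.evalAct y l) (S.evalAct y m) (comul (R := E) w)) := by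
  induction w with
  | zero => simp
  | add a b ha hb => simp only [map_add, Pi.add_apply, LinearMap.add_apply, ha, hb]
  | tmul e h =>
    rw [baseAct_tmul, Pi.smul_apply, LinearMap.smul_apply, transMap_apply, ← bilinAct_comul,
      TensorProduct.comul_tmul, CommSemiring.comul_apply]
    generalize comul (R := K) h = t
    induction t with
    | zero => simp
    | add a b ha hb => simp only [map_add, TensorProduct.tmul_add, smul_add, ha, hb]
    | tmul a b => simp [mul_left_comm]

theorem baseAct_apply_one (w : E ⊗[K] S.H) (y : L →ₐ[K] E) :
    S.baseAct E w y 1 = counit (R := E) w := by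
  induction w with
  | zero => simp
  | add a b ha hb => simp only [map_add, Pi.add_apply, LinearMap.add_apply, ha, hb]
  | tmul e h =>
    have hone := S.act_algebraMap h 1
    rw [map_one, mul_one] at hone
    simp [hone, Algebra.smul_def, mul_comm]

theorem exists_baseAct_eq_of_isGroupLikeElem {w : E ⊗[K] S.H} (hw : IsGroupLikeElem E w)
    (y : L →ₐ[K] E) : ∃ z : L →ₐ[K] E, S.baseAct E w y = z.toLinearMap := by
  refine ⟨AlgHom.ofLinearMap (S.baseAct E w y) ?_ fun l m => ?_, rfl⟩
  · rw [baseAct_apply_one, hw.counit_eq_one]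
  · rw [baseAct_apply_mul, hw.comul_eq_tmul_self, TensorProduct.map_tmul, LinearMap.mul'_apply,
      evalAct_apply, evalAct_apply]

theorem baseAct_rTensor (y : L →ₐ[K] E) (t : L ⊗[K] S.H) :
    S.baseAct E (y.toLinearMap.rTensor S.H t) y = y.toLinearMap ∘ₗ galoisMap S.act t := by
  induction t with
  | zero => simp
  | add a b ha hb => simp only [map_add, Pi.add_apply, LinearMap.comp_add, ha, hb]
  | tmul a h =>
    ext l
    simp

theorem baseAct_apply_surjective [FiniteDimensional K L] (y : L →ₐ[K] E) :
    Function.Surjective (fun w => S.baseAct E w y) := by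
  have hcomp (T : Module.End K L) : ∃ w, S.baseAct E w y = y.toLinearMap ∘ₗ T := by
    obtain ⟨t, rfl⟩ := S.galoisMap_bijective.2 T
    exact ⟨_, S.baseAct_rTensor y t⟩
  intro f
  let b := Module.finBasis K L
  choose w hw using fun i => hcomp ((b.coord i).smulRight (1 : L))
  refine ⟨∑ i, f (b i) • w i, b.ext fun j => ?_⟩
  simp only [map_sum, map_smul, Finset.sum_apply, Pi.smul_apply, hw]
  simp [LinearMap.sum_apply, Finsupp.single_apply]

theorem exists_perm_of_isGroupLikeElem {N : Type*} [Group N] (v : N →* E ⊗[K] S.H)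
    (hv : ∀ n, IsGroupLikeElem E (v n)) :
    ∃ ρ : N →* Equiv.Perm (L →ₐ[K] E), ∀ n, S.baseAct E (v n) = permMap (ρ n) := by
  choose f hf using fun n y => S.exists_baseAct_eq_of_isGroupLikeElem (hv n) y
  have f_one (y) : f 1 y = y :=
    AlgHom.toLinearMap_injective (by rw [← hf, map_one, baseAct_one])
  have f_mul (n m y) : f (n * m) y = f m (f n y) :=
    AlgHom.toLinearMap_injective (by rw [← hf, ← hf, map_mul, S.baseAct_mul (hf n y)])
  let ρ : N →* Equiv.Perm (L →ₐ[K] E) := MonoidHom.toHomPerm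
    { toFun n y := f n⁻¹ y
      map_one' := funext fun y => by rw [inv_one, f_one]; rfl
      map_mul' n m := funext fun y => by rw [mul_inv_rev, f_mul]; rfl }
  have hρ (n y) : (ρ n)⁻¹ y = f n y := by
    rw [← map_inv]
    exact congrArg (f · y) (inv_inv n)
  exact ⟨ρ, fun n => funext fun y => by rw [permMap_apply, hρ, hf]⟩

end HopfGaloisStructure

section Transitivity

open Module MonoidAlgebra

variable {K L E N : Type*} [Field K] [Field L] [Field E] [Algebra K L] [Algebra K E] [Group N]

theorem permLin_apply_mem_span_orbit (ρ : N →* Equiv.Perm (L →ₐ[K] E)) (x : MonoidAlgebra E N)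
    (y : L →ₐ[K] E) :
    permLin ρ x y ∈ Submodule.span E (AlgHom.toLinearMap '' Set.range fun n => ρ n y) := by
  induction x using MonoidAlgebra.induction_linear with
  | zero => simp
  | add a b ha hb =>
    rw [map_add]
    exact Submodule.add_mem _ ha hb
  | single m r =>
    rw [permLin_single]
    exact Submodule.smul_mem _ _ (Submodule.subset_span ⟨(ρ m)⁻¹ y, ⟨m⁻¹, by simp⟩, rfl⟩)

theorem exists_apply_eq_of_surjective_permLin {ρ : N →* Equiv.Perm (L →ₐ[K] E)} {y : L →ₐ[K] E}
    (hρ : Function.Surjective fun x : MonoidAlgebra E N => permLin ρ x y) (z : L →ₐ[K] E) :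
    ∃ n, ρ n y = z := by
  obtain ⟨x, hx⟩ := hρ z.toLinearMap
  by_contra hz
  refine (linearIndependent_toLinearMap K L E).notMem_span_image
    (s := Set.range fun n => ρ n y) hz ?_
  rw [← hx]
  exact permLin_apply_mem_span_orbit ρ x y

end Transitivity

namespace HopfGaloisStructure

open Module MonoidAlgebra

variable {K L : Type u} [Field K] [Field L] [Algebra K L] (S : HopfGaloisStructure K L)
  {E : Type*} [Field E] [Algebra K E]

theorem exists_permLin_eq_baseAct {N : Type*} [Group N]
    (φ : (E ⊗[K] S.H) ≃ₐc[E] MonoidAlgebra E N) :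
    ∃ ρ : N →* Equiv.Perm (L →ₐ[K] E), ∀ x, S.baseAct E (φ.symm x) = permLin ρ x := by
  obtain ⟨ρ, hρ⟩ := S.exists_perm_of_isGroupLikeElem
    ((φ.symm : MonoidAlgebra E N →* E ⊗[K] S.H).comp (MonoidAlgebra.of E N))
    fun n => IsGroupLikeElem.map φ.symm (isGroupLikeElem_of n)
  refine ⟨ρ, fun x => ?_⟩
  induction x using MonoidAlgebra.induction_linear with
  | zero => simp
  | add a b ha hb => rw [map_add, map_add, ha, hb, map_add]
  | single n e =>
    rw [permLin_single, ← hρ, ← mul_one e, ← smul_eq_mul, ← MonoidAlgebra.smul_single, map_smul,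
      map_smul, smul_eq_mul, mul_one]
    rfl

variable [Algebra L E] [IsScalarTower K L E] [FiniteDimensional K E] [IsGalois K E]

theorem exists_regular_action {N : Type*} [Group N] (hN : Nat.card N = finrank K L)
    (φ : (E ⊗[K] S.H) ≃ₐc[E] MonoidAlgebra E N) :
    ∃ ρ : N →* Equiv.Perm (L →ₐ[K] E), (∀ x y, ∃! n, ρ n x = y) ∧
      opSpan S.actRange = LinearMap.range (permLin (E := E) ρ) := by
  have : FiniteDimensional K L := FiniteDimensional.left K L E
  have : Finite N := Nat.finite_of_card_ne_zero (hN ▸ finrank_pos.ne')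
  obtain ⟨ρ, hρ⟩ := S.exists_permLin_eq_baseAct φ
  have hρ' (w : E ⊗[K] S.H) : permLin ρ (φ w) = S.baseAct E w := by
    rw [← hρ, BialgEquiv.symm_apply_apply]
  refine ⟨ρ, fun x y => ?_, ?_⟩
  · have hsurj : Function.Surjective (fun n => ρ n x) :=
      exists_apply_eq_of_surjective_permLin fun F => by
        obtain ⟨w, hw⟩ := S.baseAct_apply_surjective x F
        exact ⟨φ w, (congrFun (hρ' w) x).trans hw⟩
    exact ((Nat.bijective_iff_surjective_and_card _).2
      ⟨hsurj, by rw [hN, card_embeddings]⟩).existsUnique y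
  · rw [← range_baseAct]
    refine le_antisymm ?_ ?_
    · rintro _ ⟨w, rfl⟩
      exact ⟨φ w, hρ' w⟩
    · rintro _ ⟨x, rfl⟩
      exact ⟨φ.symm x, hρ x⟩

end HopfGaloisStructure

/-! ### The Hopf-Galois structure attached to a regular action -/

section Construction

open Module MonoidAlgebra Coalgebra

section PermLin

variable {K L E N : Type*} [Field K] [Field L] [Field E] [Algebra K L] [Algebra K E] [Group N]
  {ρ : N →* Equiv.Perm (L →ₐ[K] E)}

theorem embRep_act_permLin {κ : (E ≃ₐ[K] E) →* MulAut N}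
    (hκ : ∀ γ n, ρ (κ γ n) = galPerm γ * ρ n * (galPerm γ)⁻¹) (γ : E ≃ₐ[K] E)
    (x : MonoidAlgebra E N) :
    (embRep K L E).act γ (permLin ρ x) = permLin ρ (galAct κ γ x) := by
  induction x using MonoidAlgebra.induction_linear with
  | zero => simp
  | add a b ha hb => simp only [map_add, ha, hb]
  | single n r =>
    rw [galAct_single, permLin_single, permLin_single, map_smulₛₗ, embRep_act_permMap, hκ]
    rfl

variable (ρ)

theorem permLin_apply_mul (x : MonoidAlgebra E N) (y : L →ₐ[K] E) (l m : L) :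
    permLin ρ x y (l * m) =
      LinearMap.mul' E E (TensorProduct.map
        (LinearMap.applyₗ' E l ∘ₗ LinearMap.proj y ∘ₗ permLin (E := E) ρ)
        (LinearMap.applyₗ' E m ∘ₗ LinearMap.proj y ∘ₗ permLin (E := E) ρ)
        (comul (R := E) x)) := by
  induction x using MonoidAlgebra.induction_linear with
  | zero => simp
  | add a b ha hb => simp only [map_add, Pi.add_apply, LinearMap.add_apply, ha, hb]
  | single n r => simp [mul_left_comm]

theorem permLin_apply_algebraMap (x : MonoidAlgebra E N) (y : L →ₐ[K] E) (k : K) :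
    permLin ρ x y (algebraMap K L k) = counit (R := E) x * algebraMap K E k := by
  induction x using MonoidAlgebra.induction_linear with
  | zero => simp
  | add a b ha hb => simp only [map_add, Pi.add_apply, LinearMap.add_apply, ha, hb, add_mul]
  | single n r => simp

theorem permLin_one : permLin (E := E) ρ 1 = transMap K L E 1 := by
  rw [one_def, permLin_single]
  ext
  simp

end PermLin

section FixedAct

variable {K L E N : Type*} [Field K] [Field L] [Field E] [Algebra K L] [Algebra K E]
  [Algebra L E] [IsScalarTower K L E] [FiniteDimensional K E] [IsGalois K E] [Group N]
  {ρ : N →* Equiv.Perm (L →ₐ[K] E)}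

theorem card_eq_finrank_of_regular (hρ : ∀ x y, ∃! n, ρ n x = y) :
    Nat.card N = finrank K L := by
  let y : L →ₐ[K] E := IsScalarTower.toAlgHom K L E
  rw [← card_embeddings (K := K) (L := L) (E := E)]
  exact Nat.card_congr (Equiv.ofBijective (fun n => ρ n y)
    ((Function.bijective_iff_existsUnique _).2 (hρ y)))

variable {κ : (E ≃ₐ[K] E) →* MulAut N}
  (hκ : ∀ γ n, ρ (κ γ n) = galPerm γ * ρ n * (galPerm γ)⁻¹)

/-- The action on `L` of the Galois-fixed elements of `E[N]`, as a linear map. -/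
def fixedActLin : fixedAlg κ →ₗ[K] Module.End K L :=
  ((permLin ρ).restrictScalars K ∘ₗ (fixedAlg κ).val.toLinearMap).codRestrictOfInjective
    (transMap K L E) transMap_injective fun h => by
      rw [range_transMap]
      exact fun γ => (embRep_act_permLin hκ γ h.1).trans (congrArg (permLin ρ) (h.2 γ))

theorem transMap_fixedActLin (h : fixedAlg κ) :
    transMap K L E (fixedActLin hκ h) = permLin ρ h.1 :=
  LinearMap.congr_fun (LinearMap.codRestrictOfInjective_comp _ (transMap K L E) _ _) h

theorem apply_fixedActLin (h : fixedAlg κ) (y : L →ₐ[K] E) (l : L) :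
    y (fixedActLin hκ h l) = permLin ρ h.1 y l :=
  LinearMap.congr_fun (congrFun (transMap_fixedActLin hκ h) y) l

theorem permLin_mul_apply_fixed (x : MonoidAlgebra E N) (h : fixedAlg κ) (y : L →ₐ[K] E) (l : L) :
    permLin ρ (x * h.1) y l = permLin ρ x y (fixedActLin hκ h l) := by
  induction x using MonoidAlgebra.induction_linear with
  | zero => simp
  | add c d hc hd => simp only [add_mul, map_add, Pi.add_apply, LinearMap.add_apply, hc, hd]
  | single n r =>
    rw [permLin_mul_single, permLin_single, LinearMap.smul_apply, Pi.smul_apply,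
      LinearMap.smul_apply, permMap_apply, AlgHom.toLinearMap_apply, ← apply_fixedActLin hκ]

/-- The action on `L` of the Galois-fixed elements of `E[N]`, for a Galois-equivariant action of
`N` on the embeddings of `L` in `E`. -/
def fixedAct : fixedAlg κ →ₐ[K] Module.End K L :=
  AlgHom.ofLinearMap (fixedActLin hκ)
    (transMap_injective (E := E) ((transMap_fixedActLin hκ 1).trans (permLin_one ρ)))
    fun h h' => transMap_injective (E := E) <| funext fun y => LinearMap.ext fun l => by
      rw [transMap_fixedActLin, transMap_apply, Module.End.mul_apply, apply_fixedActLin,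
        ← permLin_mul_apply_fixed]
      rfl

theorem apply_fixedAct (h : fixedAlg κ) (y : L →ₐ[K] E) (l : L) :
    y (fixedAct hκ h l) = permLin ρ h.1 y l :=
  apply_fixedActLin hκ h y l

theorem apply_galoisMap_fixedAct (y : L →ₐ[K] E) (t : L ⊗[K] fixedAlg κ) (l : L) :
    y (galoisMap (fixedAct hκ) t l) = permLin ρ ((fixedAlg κ).val.toLinearMap.liftBaseChange E
      (y.toLinearMap.rTensor (fixedAlg κ) t)) y l := by
  induction t with
  | zero => simp
  | add c d hc hd => simp only [map_add, Pi.add_apply, LinearMap.add_apply, hc, hd]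
  | tmul c d => simp [apply_fixedAct]

theorem galoisMap_fixedAct_injective (hρ : ∀ x y, ∃! n, ρ n x = y) :
    Function.Injective (galoisMap (fixedAct hκ)) := by
  let y : L →ₐ[K] E := IsScalarTower.toAlgHom K L E
  intro s t hst
  have hpermLin : Function.Injective fun x : MonoidAlgebra E N => permLin ρ x y :=
    permLin_apply_injective hρ y
  have hlift : Function.Injective ((fixedAlg κ).val.toLinearMap.liftBaseChange E) :=
    (isBaseChange_fixedAlg κ).equiv.injective
  have hrTensor : Function.Injective (y.toLinearMap.rTensor (fixedAlg κ)) :=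
    Module.Flat.rTensor_preserves_injective_linearMap _ y.injective
  refine hrTensor (hlift (hpermLin (LinearMap.ext fun l => ?_)))
  simp only [← apply_galoisMap_fixedAct hκ, hst]

theorem galoisMap_fixedAct_bijective (hρ : ∀ x y, ∃! n, ρ n x = y) :
    Function.Bijective (galoisMap (fixedAct hκ)) := by
  have : FiniteDimensional K L := FiniteDimensional.left K L E
  have hfixed : finrank K (fixedAlg κ) = finrank K L :=
    (finrank_fixedAlg κ).trans (card_eq_finrank_of_regular hρ)
  have : FiniteDimensional K (fixedAlg κ) :=
    Module.finite_of_finrank_pos (hfixed ▸ Module.finrank_pos)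
  have hdim : finrank K (L ⊗[K] fixedAlg κ) = finrank K (Module.End K L) := by
    rw [finrank_tensorProduct, hfixed, finrank_linearMap]
  have hinj := galoisMap_fixedAct_injective hκ hρ
  exact ⟨hinj, (LinearMap.injective_iff_surjective_of_finrank_eq_finrank hdim).1 hinj⟩

theorem fixedAct_mul (h : fixedAlg κ) (l m : L) :
    fixedAct hκ h (l * m) = bilinAct (fixedAct hκ) l m ((isHopfForm_fixedAlg κ).comulMap h) := by
  let y : L →ₐ[K] E := IsScalarTower.toAlgHom K L E
  apply y.injective
  change y _ = y _
  rw [apply_fixedAct, permLin_apply_mul, show h.1 = (fixedAlg κ).val h from rfl,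
    ← (isHopfForm_fixedAlg κ).tensorMap_comulMap]
  generalize (isHopfForm_fixedAlg κ).comulMap h = t
  induction t with
  | zero => simp
  | add c d hc hd => simp only [map_add, hc, hd]
  | tmul c d => simp [apply_fixedAct]

theorem fixedAct_algebraMap (h : fixedAlg κ) (k : K) :
    fixedAct hκ h (algebraMap K L k) =
      algebraMap K L ((isHopfForm_fixedAlg κ).counitMap h * k) := by
  let y : L →ₐ[K] E := IsScalarTower.toAlgHom K L E
  apply y.injective
  change y _ = y _
  rw [apply_fixedAct, permLin_apply_algebraMap, AlgHom.commutes, map_mul,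
    (isHopfForm_fixedAlg κ).algebraMap_counitMap]
  rfl

theorem opSpan_range_fixedAct :
    opSpan (LinearMap.range (fixedAct hκ).toLinearMap) = LinearMap.range (permLin (E := E) ρ) := by
  rw [LinearMap.range_eq_map (permLin ρ), ← (galRep κ).span_fixedPoints, Submodule.map_span, opSpan]
  congr 1
  ext F
  constructor
  · rintro ⟨_, ⟨h, rfl⟩, rfl⟩
    exact ⟨h.1, h.2, (transMap_fixedActLin hκ h).symm⟩
  · rintro ⟨x, hx, rfl⟩
    exact ⟨_, ⟨⟨x, hx⟩, rfl⟩, transMap_fixedActLin hκ ⟨x, hx⟩⟩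

end FixedAct

theorem exists_hopfGaloisStructure_of_regular {K L E N : Type u} [Field K] [Field L] [Field E]
    [Algebra K L] [Algebra K E] [Algebra L E] [IsScalarTower K L E] [FiniteDimensional K E]
    [IsGalois K E] [Group N] {ρ : N →* Equiv.Perm (L →ₐ[K] E)} (hρ : ∀ x y, ∃! n, ρ n x = y)
    {κ : (E ≃ₐ[K] E) →* MulAut N}
    (hκ : ∀ γ n, ρ (κ γ n) = galPerm γ * ρ n * (galPerm γ)⁻¹) :
    ∃ S : HopfGaloisStructure K L, Nonempty ((E ⊗[K] S.H) ≃ₐc[E] MonoidAlgebra E N) ∧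
      opSpan S.actRange = LinearMap.range (permLin (E := E) ρ) := by
  have hform := isHopfForm_fixedAlg (K := K) (E := E) κ
  let _ := hform.hopfAlgebra
  have : IsCocomm K (fixedAlg κ) := hform.isCocomm
  let S : HopfGaloisStructure K L :=
    { H := fixedAlg κ
      act := fixedAct hκ
      act_mul := fixedAct_mul hκ
      act_algebraMap := fixedAct_algebraMap hκ
      galois := galoisMap_fixedAct_bijective hκ hρ }
  exact ⟨S, hform.nonempty_bialgEquiv, opSpan_range_fixedAct hκ⟩

end Construction

/-! ### The correspondence of Greither and Pareigis -/

/-- A group of permutations is regular if a unique element takes any point to any other. -/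
def IsRegularSubgroup {X : Type*} (N : Subgroup (Equiv.Perm X)) : Prop :=
  ∀ x y : X, ∃! n : N, n.1 x = y

theorem IsRegularSubgroup.apply_eq_self_iff {X : Type*} {N : Subgroup (Equiv.Perm X)}
    (hN : IsRegularSubgroup N) {n : N} {x : X} : n.1 x = x ↔ n = 1 :=
  ⟨fun hn => (hN x x).unique hn rfl, fun hn => hn ▸ rfl⟩

theorem IsRegularSubgroup.isPretransitive {X : Type*} {N : Subgroup (Equiv.Perm X)}
    (hN : IsRegularSubgroup N) : MulAction.IsPretransitive N X :=
  ⟨fun x y => (hN x y).exists⟩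

/-- The regular groups of permutations which are isomorphic to `N₀` and normalised by `P`. -/
def regularSet {X : Type*} (P : Subgroup (Equiv.Perm X)) (N₀ : Type*) [Group N₀] :
    Set (Subgroup (Equiv.Perm X)) :=
  {N | IsRegularSubgroup N ∧ Nonempty (N ≃* N₀) ∧ P ≤ Subgroup.normalizer (N : Set _)}

section Counting

open Module

variable (K L : Type u) [Field K] [Field L] [Algebra K L] [Algebra.IsSeparable K L]

instance isGalois_normalClosure : IsGalois K (NormalClosure K L) := by
  have : Algebra.IsAlgebraic K (AlgebraicClosure L) := Algebra.IsAlgebraic.trans K L _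
  have : IsAlgClosure K (AlgebraicClosure L) := ⟨inferInstance, inferInstance⟩
  have : Normal K (AlgebraicClosure L) := IsAlgClosure.normal K (AlgebraicClosure L)
  have hsep : Algebra.IsSeparable K (NormalClosure K L) := by
    rw [← le_separableClosure_iff]
    refine iSup_le fun f => ?_
    rw [le_separableClosure_iff]
    exact Algebra.IsSeparable.of_algHom K L (AlgEquiv.ofInjectiveField f).symm.toAlgHom
  exact ⟨⟩

variable {K L} [FiniteDimensional K L] {N₀ : Type*} [Group N₀]

theorem exists_mem_regularSet_of_hasType (hN₀ : Nat.card N₀ = finrank K L)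
    {S : HopfGaloisStructure K L} (hS : S.HasType N₀) :
    ∃ N ∈ regularSet (galPerm (K := K) (L := L) (E := NormalClosure K L)).range N₀,
      (N : Set (Equiv.Perm (L →ₐ[K] NormalClosure K L))) =
        {π | permMap π ∈ opSpan S.actRange} ∧
      opSpan S.actRange = Submodule.span (NormalClosure K L)
        (permMap '' {π | permMap π ∈ opSpan (E := NormalClosure K L) S.actRange}) := by
  obtain ⟨φ⟩ := hS
  obtain ⟨ρ, hρ, hspan⟩ := S.exists_regular_action hN₀ φ
  obtain ⟨y⟩ := nonempty_embedding (K := K) (L := L) (E := NormalClosure K L)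
  have hset := coe_range_eq_setOf_permMap_mem (E := NormalClosure K L) hρ
  rw [← hspan] at hset
  have hinj : Function.Injective ρ := fun n m h => (hρ y (ρ n y)).unique rfl (by rw [h])
  refine ⟨ρ.range, ⟨fun x y => ?_, ⟨(MonoidHom.ofInjective hinj).symm⟩, ?_⟩, hset, ?_⟩
  · obtain ⟨n, hn, huniq⟩ := hρ x y
    refine ⟨⟨ρ n, n, rfl⟩, hn, ?_⟩
    rintro ⟨_, m, rfl⟩ hm
    exact Subtype.ext (congrArg ρ (huniq m hm))
  · rw [Subgroup.le_normalizer_iff]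
    rintro _ ⟨γ, rfl⟩ n hn
    rw [← SetLike.mem_coe, hset] at hn ⊢
    rw [Set.mem_ofPred_eq, ← embRep_act_permMap]
    exact embRep_act_mem_opSpan γ hn
  · rw [← hset, ← range_permLin, hspan]

theorem exists_hasType_of_mem_regularSet
    {N : Subgroup (Equiv.Perm (L →ₐ[K] NormalClosure K L))}
    (hN : N ∈ regularSet (galPerm (K := K) (L := L) (E := NormalClosure K L)).range N₀) :
    ∃ S : HopfGaloisStructure K L, S.HasType N₀ ∧
      (N : Set (Equiv.Perm (L →ₐ[K] NormalClosure K L))) =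
        {π | permMap π ∈ opSpan S.actRange} := by
  obtain ⟨hreg, ⟨e⟩, hnorm⟩ := hN
  let κ := N.normalizerMonoidHom.comp
    (galPerm.codRestrict _ fun γ => hnorm ⟨γ, rfl⟩)
  obtain ⟨S, ⟨φ⟩, hspan⟩ := exists_hopfGaloisStructure_of_regular (ρ := N.subtype) hreg (κ := κ)
    fun γ n => rfl
  refine ⟨S, ⟨φ.trans (MonoidAlgebra.domCongrBialgEquiv _ _ e)⟩, ?_⟩
  rw [hspan, ← coe_range_eq_setOf_permMap_mem (ρ := N.subtype) hreg, Subgroup.range_subtype]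

theorem numStructures_eq_ncard_regularSet (hN₀ : Nat.card N₀ = finrank K L) :
    numStructures K L N₀ =
      (regularSet (galPerm (K := K) (L := L) (E := NormalClosure K L)).range N₀).ncard := by
  let permSet : Quotient (HopfGaloisStructure.setoid K L) →
      Set (Equiv.Perm (L →ₐ[K] NormalClosure K L)) :=
    Quotient.lift (fun S => {π | permMap π ∈ opSpan S.actRange}) fun S T h => by
      rw [HopfGaloisStructure.equivalent_iff_actRange_eq.1 h]
  rw [numStructures, ← Set.InjOn.ncard_image (f := permSet),
    ← Set.ncard_image_of_injective _ (SetLike.coe_injective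
      (A := Subgroup (Equiv.Perm (L →ₐ[K] NormalClosure K L))))]
  · congr 1
    ext s
    constructor
    · rintro ⟨_, ⟨S, rfl, hS⟩, rfl⟩
      obtain ⟨N, hN, hNS, -⟩ := exists_mem_regularSet_of_hasType hN₀ hS
      exact ⟨N, hN, hNS⟩
    · rintro ⟨N, hN, rfl⟩
      obtain ⟨S, hS, hNS⟩ := exists_hasType_of_mem_regularSet hN
      exact ⟨⟦S⟧, ⟨S, rfl, hS⟩, hNS.symm⟩
  · rintro _ ⟨S, rfl, hS⟩ _ ⟨T, rfl, hT⟩ hST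
    obtain ⟨-, -, -, hspanS⟩ := exists_mem_regularSet_of_hasType hN₀ hS
    obtain ⟨-, -, -, hspanT⟩ := exists_mem_regularSet_of_hasType hN₀ hT
    change {π | permMap π ∈ opSpan (E := NormalClosure K L) S.actRange} =
      {π | permMap π ∈ opSpan T.actRange} at hST
    rw [hST, ← hspanT] at hspanS
    exact Quotient.sound
      (HopfGaloisStructure.equivalent_iff_actRange_eq.2 (opSpan_injective hspanS))

theorem exists_hasType_iff_regularSet_nonempty (hN₀ : Nat.card N₀ = finrank K L) :
    (∃ S : HopfGaloisStructure K L, S.HasType N₀) ↔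
      (regularSet (galPerm (K := K) (L := L) (E := NormalClosure K L)).range N₀).Nonempty := by
  constructor
  · rintro ⟨S, hS⟩
    obtain ⟨N, hN, -⟩ := exists_mem_regularSet_of_hasType hN₀ hS
    exact ⟨N, hN⟩
  · rintro ⟨N, hN⟩
    obtain ⟨S, hS, -⟩ := exists_hasType_of_mem_regularSet hN
    exact ⟨S, hS⟩

end Counting

section Transfer

variable {X X' : Type*} (e : X ≃ X')

theorem map_permCongrHom_symm (N : Subgroup (Equiv.Perm X)) :
    (N.map e.permCongrHom.toMonoidHom).map e.symm.permCongrHom.toMonoidHom = N := by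
  rw [Subgroup.map_map]
  convert Subgroup.map_id N
  ext π x
  simp

theorem isRegularSubgroup_map {N : Subgroup (Equiv.Perm X)} (hN : IsRegularSubgroup N) :
    IsRegularSubgroup (N.map e.permCongrHom.toMonoidHom) := by
  intro x y
  obtain ⟨n, hn, huniq⟩ := hN (e.symm x) (e.symm y)
  refine ⟨⟨e.permCongrHom n.1, n.1, n.2, rfl⟩, ?_, ?_⟩
  · change e (n.1 (e.symm x)) = y
    rw [hn, e.apply_symm_apply]
  · rintro ⟨_, m, hm, rfl⟩ (hmx : e (m (e.symm x)) = y)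
    exact Subtype.ext (congrArg (fun n : N => e.permCongrHom n.1)
      (huniq ⟨m, hm⟩ (by simp [← hmx])))

variable {N₀ : Type*} [Group N₀] {P : Subgroup (Equiv.Perm X)}

theorem map_mem_regularSet {N : Subgroup (Equiv.Perm X)} (hN : N ∈ regularSet P N₀) :
    N.map e.permCongrHom.toMonoidHom ∈ regularSet (P.map e.permCongrHom.toMonoidHom) N₀ := by
  obtain ⟨hreg, ⟨φ⟩, hnorm⟩ := hN
  rw [Subgroup.le_normalizer_iff] at hnorm
  refine ⟨isRegularSubgroup_map e hreg, ⟨(N.equivMapOfInjective _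
    e.permCongrHom.injective).symm.trans φ⟩, Subgroup.le_normalizer_iff.2 ?_⟩
  rintro _ ⟨g, hg, rfl⟩ _ ⟨n, hn, rfl⟩
  exact ⟨g * n * g⁻¹, hnorm g hg n hn, by rw [map_mul, map_mul, map_inv]⟩

theorem regularSet_map : regularSet (P.map e.permCongrHom.toMonoidHom) N₀ =
    Subgroup.map e.permCongrHom.toMonoidHom '' regularSet P N₀ := by
  refine Set.Subset.antisymm (fun N hN => ?_) (Set.image_subset_iff.2 fun N => map_mem_regularSet e)
  refine ⟨N.map e.symm.permCongrHom.toMonoidHom, ?_, map_permCongrHom_symm e.symm N⟩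
  simpa only [map_permCongrHom_symm] using map_mem_regularSet e.symm hN

theorem ncard_regularSet_map :
    (regularSet (P.map e.permCongrHom.toMonoidHom) N₀).ncard = (regularSet P N₀).ncard := by
  rw [regularSet_map, Set.ncard_image_of_injective _
    (Subgroup.map_injective e.permCongrHom.injective)]

theorem regularSet_map_nonempty :
    (regularSet (P.map e.permCongrHom.toMonoidHom) N₀).Nonempty ↔ (regularSet P N₀).Nonempty := by
  rw [regularSet_map, Set.image_nonempty]

end Transfer

section TransitiveActions

variable {G X Y : Type*} [Group G] {α : G →* Equiv.Perm X} {β : G →* Equiv.Perm Y} {x : X} {y : Y}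

theorem apply_eq_apply_iff_of_stabilizer (hαβ : ∀ g, α g x = x ↔ β g y = y) (g h : G) :
    α g x = α h x ↔ β g y = β h y := by
  have := hαβ (h⁻¹ * g)
  simpa only [map_mul, map_inv, Equiv.Perm.mul_apply, Equiv.Perm.inv_eq_iff_eq] using this

theorem exists_equivariant_equiv_of_stabilizer (hα : ∀ z, ∃ g, α g x = z)
    (hβ : ∀ z, ∃ g, β g y = z) (hαβ : ∀ g, α g x = x ↔ β g y = y) :
    ∃ e : X ≃ Y, ∀ g z, e (α g z) = β g (e z) := by
  have hiff := apply_eq_apply_iff_of_stabilizer hαβ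
  choose c hc using hα
  have hf (g : G) : β (c (α g x)) y = β g y := (hiff _ _).1 (hc _)
  have hbij : Function.Bijective fun z => β (c z) y := by
    refine ⟨fun z w h => ?_, fun w => ?_⟩
    · simpa only [hc] using (hiff _ _).2 h
    · obtain ⟨g, rfl⟩ := hβ w
      exact ⟨α g x, hf g⟩
  refine ⟨Equiv.ofBijective _ hbij, fun g z => ?_⟩
  change β (c (α g z)) y = β g (β (c z) y)
  conv_lhs => rw [← hc z]
  rw [← Equiv.Perm.mul_apply, ← Equiv.Perm.mul_apply, ← map_mul, ← map_mul, hf]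

theorem map_range_permCongrHom {e : X ≃ Y} (he : ∀ g z, e (α g z) = β g (e z)) :
    α.range.map e.permCongrHom.toMonoidHom = β.range := by
  rw [MonoidHom.map_range]
  congr 1
  ext g z
  change e (α g (e.symm z)) = β g z
  rw [he, e.apply_symm_apply]

end TransitiveActions

section Realising

open Module

variable {K L : Type u} [Field K] [Field L] [Algebra K L]

theorem mem_stabGal_iff {γ : NormalClosure K L ≃ₐ[K] NormalClosure K L} :
    γ ∈ stabGal K L ↔
      galPerm γ (IsScalarTower.toAlgHom K L (NormalClosure K L)) =
        IsScalarTower.toAlgHom K L (NormalClosure K L) := by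
  rw [AlgHom.ext_iff]
  rfl

variable [Algebra.IsSeparable K L] {n : ℕ} {G : TransPermGroup n}

theorem exists_equiv_embeddings (hG : Realises K L G.1 (Fin n)) :
    ∃ e : Fin n ≃ (L →ₐ[K] NormalClosure K L),
      G.1.map e.permCongrHom.toMonoidHom =
        (galPerm (K := K) (L := L) (E := NormalClosure K L)).range := by
  obtain ⟨θ, x, hθ⟩ := hG
  have htrans := G.2
  let ι : L →ₐ[K] NormalClosure K L := IsScalarTower.toAlgHom K L (NormalClosure K L)
  have hgal (y : L →ₐ[K] NormalClosure K L) : ∃ g : G.1, galPerm (θ g) ι = y := by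
    obtain ⟨γ, hγ⟩ := exists_galPerm_eq ι y
    exact ⟨θ.symm γ, by rw [θ.apply_symm_apply, hγ]⟩
  have hstab (g : G.1) : g • x = x ↔ galPerm (θ g) ι = ι := by
    rw [← mem_stabGal_iff, ← hθ, ← MulAction.mem_stabilizer_iff]
    exact (Subgroup.mem_map_iff_mem θ.injective).symm
  obtain ⟨e, he⟩ := exists_equivariant_equiv_of_stabilizer (α := G.1.subtype)
    (β := galPerm.comp θ.toMonoidHom) (MulAction.exists_smul_eq G.1 x) hgal hstab
  refine ⟨e, ?_⟩
  have hrange := map_range_permCongrHom he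
  rwa [Subgroup.range_subtype, MonoidHom.range_comp, MonoidHom.range_eq_top.2 θ.surjective,
    ← MonoidHom.range_eq_map] at hrange

variable [FiniteDimensional K L]

theorem finrank_eq_of_realises (hG : Realises K L G.1 (Fin n)) : finrank K L = n := by
  obtain ⟨e, -⟩ := exists_equiv_embeddings hG
  rw [← card_embeddings (K := K) (L := L) (E := NormalClosure K L), ← Nat.card_congr e,
    Nat.card_eq_fintype_card, Fintype.card_fin]

variable {N₀ : Type*} [Group N₀]

theorem numStructures_of_realises (hG : Realises K L G.1 (Fin n)) (hN₀ : Nat.card N₀ = n) :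
    numStructures K L N₀ = (regularSet G.1 N₀).ncard := by
  obtain ⟨e, he⟩ := exists_equiv_embeddings hG
  rw [numStructures_eq_ncard_regularSet (by rw [hN₀, finrank_eq_of_realises hG]), ← he,
    ncard_regularSet_map]

theorem exists_hasType_iff_of_realises (hG : Realises K L G.1 (Fin n))
    (hN₀ : Nat.card N₀ = n) :
    (∃ S : HopfGaloisStructure K L, S.HasType N₀) ↔ (regularSet G.1 N₀).Nonempty := by
  obtain ⟨e, he⟩ := exists_equiv_embeddings hG
  rw [exists_hasType_iff_regularSet_nonempty (by rw [hN₀, finrank_eq_of_realises hG]), ← he,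
    regularSet_map_nonempty]

end Realising

/-! ### Realising transitive permutation groups -/

section PermRatFunc

variable (σ R : Type*) [CommRing R] [IsDomain R]

/-- The action of the permutations of `σ` on the field of rational functions over `R` in variables
indexed by `σ`. -/
def permRatFunc : Equiv.Perm σ →* RingAut (FractionRing (MvPolynomial σ R)) :=
  (IsFractionRing.ringEquivOfRingEquivHom (MvPolynomial σ R) _).comp
  { toFun := fun π => (MvPolynomial.renameEquiv R π).toRingEquiv
    map_one' := RingEquiv.ext fun f => MvPolynomial.rename_id_apply f
    map_mul' := fun π τ => RingEquiv.ext fun f => (MvPolynomial.rename_rename τ π f).symm }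

theorem permRatFunc_injective : Function.Injective (permRatFunc σ R) := by
  intro π τ h
  ext1 i
  have happly (π : Equiv.Perm σ) : permRatFunc σ R π (algebraMap (MvPolynomial σ R) _
      (MvPolynomial.X i)) = algebraMap (MvPolynomial σ R) _ (MvPolynomial.X (π i)) := by
    simp [permRatFunc]
  have hπτ := happly π
  rw [h, happly τ] at hπτ
  exact (MvPolynomial.X_injective (IsFractionRing.injective _ _ hπτ)).symm

end PermRatFunc

section FixedField

variable {K L E : Type u} [Field K] [Field L] [Field E] [Algebra K L] [Algebra K E] [Algebra L E]

theorem autCongr_mem_stabGal_iff {ψ : E ≃ₐ[K] NormalClosure K L}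
    (hψ : ∀ l : L, ψ (algebraMap L E l) = algebraMap L (NormalClosure K L) l) (γ : E ≃ₐ[K] E) :
    ψ.autCongr γ ∈ stabGal K L ↔ ∀ l : L, γ (algebraMap L E l) = algebraMap L E l := by
  refine forall_congr' fun l => ?_
  rw [← hψ, AlgEquiv.autCongr_apply, ← ψ.injective.eq_iff (a := γ _)]
  simp

variable [IsScalarTower K L E] {G X : Type*} [Group G] [MulAction G X]

theorem galPerm_injective_of_stabilizer [MulAction.IsPretransitive G X] [FaithfulSMul G X]
    (θ : G ≃* (E ≃ₐ[K] E)) (x : X)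
    (hθ : ∀ g, g • x = x ↔ ∀ l : L, θ g (algebraMap L E l) = algebraMap L E l) :
    Function.Injective (galPerm (K := K) (L := L) (E := E)) := by
  rw [injective_iff_map_eq_one]
  intro γ hγ
  obtain ⟨g, rfl⟩ := θ.surjective γ
  suffices hg : g = 1 by rw [hg, map_one]
  refine FaithfulSMul.eq_of_smul_eq_smul (α := X) fun z => ?_
  obtain ⟨h, rfl⟩ := MulAction.exists_smul_eq G x z
  have hfix : (h⁻¹ * g * h) • x = x := by
    refine (hθ _).2 fun l => ?_
    have hgh : θ g (θ h (algebraMap L E l)) = θ h (algebraMap L E l) :=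
      DFunLike.congr_fun (Equiv.congr_fun hγ (galPerm (θ h) (IsScalarTower.toAlgHom K L E))) l
    rw [map_mul, map_mul, AlgEquiv.mul_apply, AlgEquiv.mul_apply, hgh, ← AlgEquiv.mul_apply,
      ← map_mul, inv_mul_cancel, map_one, AlgEquiv.one_apply]
  rw [mul_smul, mul_smul, inv_smul_eq_iff] at hfix
  rw [hfix, one_smul]

variable [FiniteDimensional K E] [IsGalois K E]

theorem isNormalClosure_of_galPerm_injective
    (hcore : Function.Injective (galPerm (K := K) (L := L) (E := E))) : IsNormalClosure K L E := by
  have : FiniteDimensional K L := FiniteDimensional.left K L E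
  rw [Algebra.IsAlgebraic.isNormalClosure_iff]
  refine ⟨fun x => ?_, ?_⟩
  · rw [← minpoly.algebraMap_eq (algebraMap L E).injective x]
    exact Normal.splits inferInstance _
  · rw [← IsGalois.fixedField_fixingSubgroup (IntermediateField.normalClosure K L E),
      ← IntermediateField.fixedField_bot]
    congr 1
    rw [eq_bot_iff]
    intro γ hγ
    rw [IntermediateField.mem_fixingSubgroup_iff] at hγ
    refine Subgroup.mem_bot.2 (hcore ?_)
    rw [map_one]
    ext y l
    exact hγ (y l) (y.fieldRange_le_normalClosure ⟨l, rfl⟩)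

theorem exists_algEquiv_normalClosure
    (hcore : Function.Injective (galPerm (K := K) (L := L) (E := E))) :
    ∃ ψ : E ≃ₐ[K] NormalClosure K L,
      ∀ l : L, ψ (algebraMap L E l) = algebraMap L (NormalClosure K L) l := by
  have : FiniteDimensional K L := FiniteDimensional.left K L E
  have : Algebra.IsSeparable K L := Algebra.isSeparable_tower_bot_of_isSeparable K L E
  have hE : IsNormalClosure K L E := isNormalClosure_of_galPerm_injective hcore
  have hN : IsNormalClosure K L (NormalClosure K L) :=
    Algebra.IsAlgebraic.isNormalClosure_normalClosure fun x => IsAlgClosed.splits _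
  let ψ : E ≃ₐ[K] NormalClosure K L := IsNormalClosure.equiv (K := L) (h := hE) (h' := hN)
  obtain ⟨δ, hδ⟩ := exists_galPerm_eq ((ψ : E →ₐ[K] NormalClosure K L).comp
    (IsScalarTower.toAlgHom K L E)) (IsScalarTower.toAlgHom K L (NormalClosure K L))
  exact ⟨ψ.trans δ, fun l => DFunLike.congr_fun hδ l⟩

theorem realises_of_mulEquiv [MulAction.IsPretransitive G X] [FaithfulSMul G X]
    (θ : G ≃* (E ≃ₐ[K] E)) (x : X)
    (hθ : ∀ g, g • x = x ↔ ∀ l : L, θ g (algebraMap L E l) = algebraMap L E l) :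
    Realises K L G X := by
  obtain ⟨ψ, hψ⟩ := exists_algEquiv_normalClosure (galPerm_injective_of_stabilizer θ x hθ)
  refine ⟨θ.trans ψ.autCongr, x, ?_⟩
  ext δ
  obtain ⟨g, rfl⟩ := (θ.trans ψ.autCongr).surjective δ
  refine (Subgroup.mem_map_iff_mem (θ.trans ψ.autCongr).injective).trans ?_
  rw [MulAction.mem_stabilizer_iff, hθ]
  exact (autCongr_mem_stabGal_iff hψ (θ g)).symm

theorem realises_fixedField [MulAction.IsPretransitive G X] [FaithfulSMul G X]
    (θ : G ≃* (E ≃ₐ[K] E)) (x : X) :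
    Realises K (IntermediateField.fixedField ((MulAction.stabilizer G x).map θ.toMonoidHom))
      G X := by
  refine realises_of_mulEquiv θ x fun g => ?_
  rw [← MulAction.mem_stabilizer_iff, ← Subgroup.mem_map_iff_mem
    (f := θ.toMonoidHom) θ.injective]
  conv_lhs => rw [← IntermediateField.fixingSubgroup_fixedField
    ((MulAction.stabilizer G x).map θ.toMonoidHom), IntermediateField.mem_fixingSubgroup_iff]
  exact ⟨fun h l => h l.1 l.2, fun h y hy => h ⟨y, hy⟩⟩

end FixedField

section Realisation

variable {n : ℕ} (G : TransPermGroup n)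

theorem exists_realises [NeZero n] :
    ∃ (K L : Type u) (_ : Field K) (_ : Field L) (_ : Algebra K L),
      FiniteDimensional K L ∧ Algebra.IsSeparable K L ∧ Realises K L G.1 (Fin n) := by
  have := G.2
  let E := FractionRing (MvPolynomial (ULift.{u} (Fin n)) (ULift.{u} ℚ))
  let ι : Equiv.Perm (Fin n) ≃* Equiv.Perm (ULift.{u} (Fin n)) := Equiv.ulift.symm.permCongrHom
  let φ : G.1 →* RingAut E :=
    (permRatFunc (ULift.{u} (Fin n)) (ULift.{u} ℚ)).comp (ι.toMonoidHom.comp G.1.subtype)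
  have hφ : Function.Injective φ :=
    (permRatFunc_injective _ _).comp (ι.injective.comp G.1.subtype_injective)
  let _ : MulSemiringAction G.1 E := MulSemiringAction.compHom E φ
  have : FaithfulSMul G.1 E := ⟨fun h => hφ (RingEquiv.ext h)⟩
  have hGal : IsGalois (FixedPoints.subfield G.1 E) E := ⟨⟩
  let θ := FixedPoints.toAlgAutMulEquiv G.1 E
  exact ⟨FixedPoints.subfield G.1 E, IntermediateField.fixedField
    ((MulAction.stabilizer G.1 (0 : Fin n)).map θ.toMonoidHom), inferInstance, inferInstance,
    inferInstance, inferInstance, inferInstance, realises_fixedField θ 0⟩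

variable {G}

theorem realisedByType_iff [NeZero n] {N₀ : Type*} [Group N₀] (hN₀ : Nat.card N₀ = n) :
    TransPermGroup.RealisedByType.{u} G N₀ ↔ (regularSet G.1 N₀).Nonempty := by
  constructor
  · rintro ⟨K, L, _, _, _, _, _, hR, hS⟩
    exact (exists_hasType_iff_of_realises hR hN₀).1 hS
  · intro h
    obtain ⟨K, L, _, _, _, hfin, hsep, hR⟩ := exists_realises.{u} G
    exact ⟨K, L, _, _, _, hfin, hsep, hR, (exists_hasType_iff_of_realises hR hN₀).2 h⟩

theorem isComplement'_map {G H : Type*} [Group G] [Group H] (e : G ≃* H) {C S : Subgroup G}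
    (h : Subgroup.IsComplement' C S) :
    Subgroup.IsComplement' (C.map e.toMonoidHom) (S.map e.toMonoidHom) := by
  refine Subgroup.isComplement'_of_disjoint_and_mul_eq_univ
    (Subgroup.disjoint_map e.injective h.disjoint) ?_
  rw [Subgroup.coe_map, Subgroup.coe_map, ← Set.image_mul, h.mul_eq, Set.image_univ]
  exact e.surjective.range_eq

theorem isComplement'_subgroupOf_stabilizer {X : Type*} {C G : Subgroup (Equiv.Perm X)}
    (hC : IsRegularSubgroup C) (hle : C ≤ G) (x : X) :
    Subgroup.IsComplement' (C.subgroupOf G) (MulAction.stabilizer G x) := by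
  refine Subgroup.isComplement'_stabilizer x (fun c hc => ?_) fun g => ?_
  · have hone : (⟨c.1.1, c.2⟩ : C) = 1 := hC.apply_eq_self_iff.1 hc
    exact Subtype.ext (Subtype.ext (congrArg (fun d : C => d.1) hone))
  · obtain ⟨c, hc, -⟩ := hC (g.1 x) x
    exact ⟨⟨⟨c.1, hle c.2⟩, c.2⟩, hc⟩

variable {K L : Type u} [Field K] [Field L] [Algebra K L]

theorem almostClassicallyGalois_of_realises (h : Realises K L G.1 (Fin n))
    {C : Subgroup (Equiv.Perm (Fin n))} (hC : IsRegularSubgroup C) (hle : C ≤ G.1)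
    (hnorm : G.1 ≤ Subgroup.normalizer (C : Set _)) : AlmostClassicallyGalois K L := by
  obtain ⟨θ, x, hθ⟩ := h
  have hnormal : (C.subgroupOf G.1).Normal :=
    (Subgroup.normal_subgroupOf_iff_le_normalizer hle).2 hnorm
  refine ⟨(C.subgroupOf G.1).map θ.toMonoidHom, hnormal.map _ θ.surjective, ?_⟩
  rw [← hθ]
  exact isComplement'_map θ (isComplement'_subgroupOf_stabilizer hC hle x)

variable [FiniteDimensional K L] [Algebra.IsSeparable K L]

theorem isGalois_of_stabGal_eq_bot (h : stabGal K L = ⊥) : IsGalois K L := by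
  have : IsGalois L (NormalClosure K L) := IsGalois.tower_top_of_isGalois K L _
  have : FiniteDimensional L (NormalClosure K L) := FiniteDimensional.right K L _
  have hsurj (e : NormalClosure K L) : e ∈ Set.range (algebraMap L (NormalClosure K L)) := by
    rw [IsGalois.mem_range_algebraMap_iff_fixed]
    intro γ
    have hγ : γ.restrictScalars K ∈ stabGal K L := fun l => γ.commutes l
    rw [h, Subgroup.mem_bot] at hγ
    exact DFunLike.congr_fun hγ e
  exact IsGalois.of_algEquiv (AlgEquiv.ofBijective
    (IsScalarTower.toAlgHom K L (NormalClosure K L))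
    ⟨(algebraMap L (NormalClosure K L)).injective, hsurj⟩).symm

theorem isGalois_of_realises (h : Realises K L G.1 (Fin n)) (hG : G.IsRegular) :
    IsGalois K L := by
  obtain ⟨θ, x, hθ⟩ := h
  refine isGalois_of_stabGal_eq_bot ?_
  have hstab : MulAction.stabilizer G.1 x = ⊥ :=
    (Subgroup.eq_bot_iff_forall _).2 fun g hg => (hG x x).unique hg (one_smul _ _)
  rw [← hθ, hstab, Subgroup.map_bot]

end Realisation

/-! ### Translations -/

section Translations

/-- The group of translations of `V`, as permutations of `V`. -/
def translGroup (V : Type*) [AddCommGroup V] : Subgroup (Equiv.Perm V) where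
  carrier := Set.range Equiv.addLeft
  mul_mem' := by
    rintro _ _ ⟨v, rfl⟩ ⟨w, rfl⟩
    exact ⟨v + w, Equiv.ext fun x => add_assoc v w x⟩
  one_mem' := ⟨0, Equiv.ext zero_add⟩
  inv_mem' := by
    rintro _ ⟨v, rfl⟩
    exact ⟨-v, Equiv.ext fun _ => rfl⟩

variable {V : Type*} [AddCommGroup V]

theorem addLeft_mem_translGroup (v : V) : Equiv.addLeft v ∈ translGroup V := ⟨v, rfl⟩

theorem isRegularSubgroup_translGroup : IsRegularSubgroup (translGroup V) := by
  intro x y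
  refine ⟨⟨_, addLeft_mem_translGroup (y - x)⟩, sub_add_cancel y x, ?_⟩
  rintro ⟨_, v, rfl⟩ (h : v + x = y)
  exact Subtype.ext (congrArg Equiv.addLeft (eq_sub_of_add_eq h))

variable (V) in
/-- The translations of `V` form a copy of `V`. -/
def translEquiv : Multiplicative V ≃* translGroup V where
  toFun v := ⟨_, addLeft_mem_translGroup v.toAdd⟩
  invFun g := Multiplicative.ofAdd (g.1 0)
  left_inv v := congrArg Multiplicative.ofAdd (add_zero v.toAdd)
  right_inv := by
    rintro ⟨_, v, rfl⟩
    exact Subtype.ext (congrArg Equiv.addLeft (add_zero v))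
  map_mul' v w := Subtype.ext (Equiv.ext fun x => add_assoc v.toAdd w.toAdd x)

theorem exists_equiv_map_eq_translGroup {X : Type*} [Nonempty X] {N : Subgroup (Equiv.Perm X)}
    (hN : IsRegularSubgroup N) (e : N ≃* Multiplicative V) :
    ∃ f : X ≃ V, N.map f.permCongrHom.toMonoidHom = translGroup V := by
  obtain ⟨x⟩ := ‹Nonempty X›
  let φ : N ≃* translGroup V := e.trans (translEquiv V)
  obtain ⟨f, hf⟩ := exists_equivariant_equiv_of_stabilizer (α := N.subtype)
    (β := (translGroup V).subtype.comp φ.toMonoidHom) (x := x) (y := (0 : V))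
    (fun y => (hN x y).exists)
    (fun v => ⟨φ.symm ⟨_, addLeft_mem_translGroup v⟩, by simp⟩)
    (fun n => hN.apply_eq_self_iff.trans <| φ.map_eq_one_iff.symm.trans
      isRegularSubgroup_translGroup.apply_eq_self_iff.symm)
  refine ⟨f, ?_⟩
  have hrange := map_range_permCongrHom hf
  rwa [Subgroup.range_subtype, MonoidHom.range_comp, MonoidHom.range_eq_top.2 φ.surjective,
    ← MonoidHom.range_eq_map, Subgroup.range_subtype] at hrange

theorem exists_addMonoidHom_of_mem_normalizer {g : Equiv.Perm V}
    (hg : g ∈ Subgroup.normalizer (translGroup V : Set (Equiv.Perm V))) :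
    ∃ φ : V →+ V, ∀ v, g v = φ v + g 0 := by
  have hadd (w : V) : ∃ w' : V, ∀ v, g (w + v) = w' + g v := by
    obtain ⟨w', hw'⟩ := (Subgroup.mem_normalizer_iff.1 hg _).1 (addLeft_mem_translGroup w)
    refine ⟨w', fun v => ?_⟩
    have hgv := Equiv.congr_fun hw' (g v)
    simpa using hgv.symm
  choose φ hφ using hadd
  have hφ_eq (w : V) : φ w = g w - g 0 := by
    rw [eq_sub_iff_add_eq, ← hφ, add_zero]
  refine ⟨AddMonoidHom.mk' φ fun v w => ?_, fun v => eq_add_of_sub_eq (hφ_eq v).symm⟩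
  rw [hφ_eq (v + w), hφ, hφ_eq w, add_sub_assoc]

theorem exists_units_of_mem_normalizer {R : Type*} [CommRing R]
    (hR : Function.Surjective (Int.cast : ℤ → R)) {g : Equiv.Perm R}
    (hg : g ∈ Subgroup.normalizer (translGroup R : Set (Equiv.Perm R))) :
    ∃ u : Rˣ, ∀ v, g v = u * v + g 0 := by
  obtain ⟨φ, hφ⟩ := exists_addMonoidHom_of_mem_normalizer hg
  have hlin (v : R) : φ v = φ 1 * v := by
    obtain ⟨k, rfl⟩ := hR v
    rw [← zsmul_one, map_zsmul, mul_smul_comm, mul_one]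
  obtain ⟨w, hw⟩ := g.surjective (1 + g 0)
  rw [hφ, hlin, add_left_inj] at hw
  exact ⟨Units.mkOfMulEqOne _ _ hw, fun v => by rw [hφ, hlin]; rfl⟩

end Translations

/-! ### Affine permutations of a product -/

section Affine

variable {R S : Type*} [CommRing R] [CommRing S]

/-- The permutation `(x, y) ↦ (a x + b, c y + d)`. -/
def aff (a : Rˣ) (b : R) (c : Sˣ) (d : S) : Equiv.Perm (R × S) where
  toFun v := (a * v.1 + b, c * v.2 + d)
  invFun v := (a⁻¹.1 * (v.1 - b), c⁻¹.1 * (v.2 - d))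
  left_inv v := by simp
  right_inv v := by simp

@[simp]
theorem aff_apply (a : Rˣ) (b : R) (c : Sˣ) (d : S) (v : R × S) :
    aff a b c d v = (a * v.1 + b, c * v.2 + d) := rfl

theorem aff_mul (a a' : Rˣ) (b b' : R) (c c' : Sˣ) (d d' : S) :
    aff a b c d * aff a' b' c' d' = aff (a * a') (a * b' + b) (c * c') (c * d' + d) := by
  ext v
  · simp; ring
  · simp; ring

@[simp]
theorem aff_one : aff (1 : Rˣ) 0 (1 : Sˣ) 0 = 1 := by
  ext v <;> simp

theorem aff_inv (a : Rˣ) (b : R) (c : Sˣ) (d : S) :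
    (aff a b c d)⁻¹ = aff a⁻¹ (-(a⁻¹.1 * b)) c⁻¹ (-(c⁻¹.1 * d)) := by
  rw [inv_eq_iff_mul_eq_one, aff_mul]
  simp

theorem aff_inj {a a' : Rˣ} {b b' : R} {c c' : Sˣ} {d d' : S} :
    aff a b c d = aff a' b' c' d' ↔ a = a' ∧ b = b' ∧ c = c' ∧ d = d' := by
  constructor
  · intro h
    have hzero := Equiv.congr_fun h (0, 0)
    have hone := Equiv.congr_fun h (1, 1)
    simp only [aff_apply, mul_zero, zero_add, mul_one, Prod.mk.injEq] at hzero hone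
    obtain ⟨rfl, rfl⟩ := hzero
    simp only [add_left_inj] at hone
    exact ⟨Units.ext hone.1, rfl, Units.ext hone.2, rfl⟩
  · rintro ⟨rfl, rfl, rfl, rfl⟩
    rfl

theorem aff_pow_exists (a : Rˣ) (b : R) (c : Sˣ) (d : S) (k : ℕ) :
    ∃ b' d', aff a b c d ^ k = aff (a ^ k) b' (c ^ k) d' := by
  induction k with
  | zero => exact ⟨0, 0, by simp⟩
  | succ k ih =>
    obtain ⟨b', d', h⟩ := ih
    exact ⟨_, _, by rw [pow_succ, h, aff_mul, pow_succ, pow_succ]⟩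

theorem transl_pow (b : R) (d : S) (k : ℕ) :
    aff (1 : Rˣ) b (1 : Sˣ) d ^ k = aff 1 (k * b) 1 (k * d) := by
  induction k with
  | zero => simp
  | succ k ih =>
    rw [pow_succ, ih, aff_mul, aff_inj]
    refine ⟨by simp, ?_, by simp, ?_⟩ <;> push_cast <;> ring

theorem scale_pow (a : Rˣ) (d : S) (k : ℕ) :
    aff a 0 (1 : Sˣ) d ^ k = aff (a ^ k) 0 1 (k * d) := by
  induction k with
  | zero => simp
  | succ k ih =>
    rw [pow_succ, ih, aff_mul, aff_inj]
    refine ⟨by rw [pow_succ], by simp, by simp, ?_⟩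
    push_cast
    ring

theorem aff_one_eq_addLeft (b : R) (d : S) : aff 1 b 1 d = Equiv.addLeft (b, d) := by
  ext v <;> simp [add_comm]

theorem mem_translGroup_iff {g : Equiv.Perm (R × S)} :
    g ∈ translGroup (R × S) ↔ ∃ b d, g = aff 1 b 1 d := by
  simp only [aff_one_eq_addLeft]
  exact ⟨fun ⟨v, hv⟩ => ⟨v.1, v.2, hv.symm⟩, fun ⟨b, d, h⟩ => ⟨(b, d), h.symm⟩⟩

theorem aff_mem_translGroup_iff {a : Rˣ} {b : R} {c : Sˣ} {d : S} :
    aff a b c d ∈ translGroup (R × S) ↔ a = 1 ∧ c = 1 := by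
  simp only [mem_translGroup_iff, aff_inj]
  exact ⟨fun ⟨_, _, ha, _, hc, _⟩ => ⟨ha, hc⟩, fun ⟨ha, hc⟩ => ⟨b, d, ha, rfl, hc, rfl⟩⟩

/-- The group of all affine permutations with linear part in `A`. -/
def holGroup (A : Subgroup (Rˣ × Sˣ)) : Subgroup (Equiv.Perm (R × S)) where
  carrier := {g | ∃ a b c d, (a, c) ∈ A ∧ g = aff a b c d}
  mul_mem' := by
    rintro _ _ ⟨a, b, c, d, h, rfl⟩ ⟨a', b', c', d', h', rfl⟩
    exact ⟨_, _, _, _, A.mul_mem h h', by rw [aff_mul]⟩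
  one_mem' := ⟨1, 0, 1, 0, A.one_mem, by simp⟩
  inv_mem' := by
    rintro _ ⟨a, b, c, d, h, rfl⟩
    exact ⟨_, _, _, _, A.inv_mem h, by rw [aff_inv]⟩

theorem aff_mem_holGroup {A : Subgroup (Rˣ × Sˣ)} {a : Rˣ} {b : R} {c : Sˣ} {d : S} :
    aff a b c d ∈ holGroup A ↔ (a, c) ∈ A := by
  constructor
  · rintro ⟨a', b', c', d', h, h'⟩
    obtain ⟨rfl, -, rfl, -⟩ := aff_inj.1 h'
    exact h
  · exact fun h => ⟨_, _, _, _, h, rfl⟩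

theorem holGroup_bot : holGroup (⊥ : Subgroup (Rˣ × Sˣ)) = translGroup (R × S) := by
  ext g
  simp only [mem_translGroup_iff]
  constructor
  · rintro ⟨a, b, c, d, h, rfl⟩
    obtain ⟨rfl, rfl⟩ := Prod.mk.inj (Subgroup.mem_bot.1 h)
    exact ⟨b, d, rfl⟩
  · rintro ⟨b, d, rfl⟩
    exact aff_mem_holGroup.2 (Subgroup.one_mem _)

theorem holGroup_mono {A B : Subgroup (Rˣ × Sˣ)} (h : A ≤ B) : holGroup A ≤ holGroup B := by
  rintro _ ⟨a, b, c, d, ha, rfl⟩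
  exact aff_mem_holGroup.2 (h ha)

theorem translGroup_le_holGroup (A : Subgroup (Rˣ × Sˣ)) :
    translGroup (R × S) ≤ holGroup A :=
  holGroup_bot (R := R) (S := S) ▸ holGroup_mono bot_le

theorem eq_bot_of_isRegularSubgroup_holGroup {A : Subgroup (Rˣ × Sˣ)}
    (h : IsRegularSubgroup (holGroup A)) : A = ⊥ := by
  refine (Subgroup.eq_bot_iff_forall _).2 fun ⟨a, c⟩ hac => ?_
  have hone : (⟨aff a 0 c 0, aff_mem_holGroup.2 hac⟩ : holGroup A) = 1 :=
    (h.apply_eq_self_iff (x := 0)).1 (by simp)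
  obtain ⟨rfl, -, rfl, -⟩ := aff_inj.1 ((congrArg Subtype.val hone).trans aff_one.symm)
  rfl

theorem holGroup_injective : Function.Injective (holGroup : Subgroup (Rˣ × Sˣ) → _) :=
  fun A B h => by
    ext ⟨a, c⟩
    rw [← aff_mem_holGroup (b := 0) (d := 0), h, aff_mem_holGroup]

theorem holGroup_le_normalizer_holGroup (A B : Subgroup (Rˣ × Sˣ)) :
    holGroup A ≤ Subgroup.normalizer (holGroup B : Set (Equiv.Perm (R × S))) := by
  rw [Subgroup.le_normalizer_iff]
  rintro _ ⟨a, b, c, d, -, rfl⟩ _ ⟨a', b', c', d', h, rfl⟩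
  rw [aff_inv, aff_mul, aff_mul, aff_mem_holGroup, mul_inv_cancel_comm, mul_inv_cancel_comm]
  exact h

theorem holGroup_le_normalizer_translGroup (A : Subgroup (Rˣ × Sˣ)) :
    holGroup A ≤ Subgroup.normalizer (translGroup (R × S) : Set (Equiv.Perm (R × S))) :=
  holGroup_bot (R := R) (S := S) ▸ holGroup_le_normalizer_holGroup A ⊥

theorem exists_eq_holGroup_of_translGroup_le {G : Subgroup (Equiv.Perm (R × S))}
    (hG : G ≤ holGroup ⊤) (h : translGroup (R × S) ≤ G) : ∃ A, G = holGroup A := by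
  have hlinear (a : Rˣ) (b : R) (c : Sˣ) (d : S) : aff a b c d ∈ G ↔ aff a 0 c 0 ∈ G := by
    have hmul : aff a b c d = aff 1 b 1 d * aff a 0 c 0 := by simp [aff_mul]
    rw [hmul, G.mul_mem_cancel_left (h (aff_mem_translGroup_iff.2 ⟨rfl, rfl⟩))]
  refine ⟨{ carrier := {x | aff x.1 0 x.2 0 ∈ G}
            mul_mem' := fun {x y} hx hy => ?_
            one_mem' := by simp
            inv_mem' := fun {x} hx => ?_ }, ?_⟩
  · simpa [aff_mul] using G.mul_mem hx hy
  · simpa [aff_inv] using G.inv_mem hx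
  · ext g
    constructor
    · intro hg
      obtain ⟨a, b, c, d, -, rfl⟩ := hG hg
      exact ⟨a, b, c, d, (hlinear _ _ _ _).1 hg, rfl⟩
    · rintro ⟨a, b, c, d, hac, rfl⟩
      exact (hlinear _ _ _ _).2 hac

end Affine

section CoprimeModuli

variable {p q : ℕ}

theorem intCast_prod_surjective (h : p.Coprime q) :
    Function.Surjective (Int.cast : ℤ → ZMod p × ZMod q) := by
  intro v
  obtain ⟨k, hk⟩ := ZMod.intCast_surjective ((ZMod.chineseRemainder h).symm v)
  exact ⟨k, by rw [← map_intCast (ZMod.chineseRemainder h), hk, RingEquiv.apply_symm_apply]⟩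

theorem normalizer_translGroup (h : p.Coprime q) :
    Subgroup.normalizer (translGroup (ZMod p × ZMod q) : Set (Equiv.Perm (ZMod p × ZMod q))) =
      holGroup ⊤ := by
  refine le_antisymm (fun g hg => ?_) (holGroup_le_normalizer_translGroup ⊤)
  obtain ⟨u, hu⟩ := exists_units_of_mem_normalizer (intCast_prod_surjective h) hg
  obtain ⟨⟨a, c⟩, rfl⟩ := MulEquiv.prodUnits.symm.surjective u
  exact ⟨a, (g 0).1, c, (g 0).2, trivial, Equiv.ext hu⟩

/-- The Chinese remainder theorem for the groups underlying the rings `ZMod n`. -/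
def prodMulEquivCyc (h : p.Coprime q) : Multiplicative (ZMod p × ZMod q) ≃* Cyc (p * q) :=
  (ZMod.chineseRemainder h).symm.toAddEquiv.toMultiplicative

end CoprimeModuli

/-! ### Transitive groups of affine permutations -/

section Transitive

variable {X : Type*}

theorem isPretransitive_of_le {G H : Subgroup (Equiv.Perm X)} [MulAction.IsPretransitive G X]
    (hle : G ≤ H) : MulAction.IsPretransitive H X where
  exists_smul_eq x y := by
    obtain ⟨g, hg⟩ := MulAction.exists_smul_eq G x y
    exact ⟨⟨g.1, hle g.2⟩, hg⟩

theorem card_dvd_of_isPretransitive (G : Type*) [Group G] [MulAction G X] [Nonempty X]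
    [MulAction.IsPretransitive G X] : Nat.card X ∣ Nat.card G := by
  obtain ⟨x⟩ := ‹Nonempty X›
  rw [← MulAction.index_stabilizer_of_transitive G x]
  exact Subgroup.index_dvd_card _

theorem eq_of_le_of_isRegularSubgroup [Nonempty X] {N M : Subgroup (Equiv.Perm X)}
    [MulAction.IsPretransitive N X] (hM : IsRegularSubgroup M) (hle : N ≤ M) : N = M := by
  obtain ⟨x⟩ := ‹Nonempty X›
  refine le_antisymm hle fun m hm => ?_
  obtain ⟨⟨n, hn⟩, hnx⟩ := MulAction.exists_smul_eq N x (m x)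
  obtain rfl : n = m := congrArg Subtype.val <|
    (hM x (m x)).unique (y₁ := ⟨n, hle hn⟩) (y₂ := ⟨m, hm⟩) hnx rfl
  exact hn

end Transitive

section TransitiveAffine

theorem exists_aff_snd_ne_zero {R S : Type*} [CommRing R] [CommRing S] [Finite S] [Nontrivial S]
    {G : Subgroup (Equiv.Perm (R × S))} [MulAction.IsPretransitive G (R × S)]
    (hG : G ≤ holGroup ⊤) : ∃ (a : Rˣ) (b : R) (d : S), d ≠ 0 ∧ aff a b 1 d ∈ G := by
  have hex (y : S) : ∃ (a : Rˣ) (b : R) (c : Sˣ), aff a b c y ∈ G := by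
    obtain ⟨⟨g, hg⟩, hgy⟩ := MulAction.exists_smul_eq G ((0, 0) : R × S) (0, y)
    obtain ⟨a, b, c, d, -, rfl⟩ := hG hg
    simp only [Subgroup.mk_smul, Equiv.Perm.smul_def, aff_apply, mul_zero, zero_add,
      Prod.mk.injEq] at hgy
    exact ⟨a, b, c, hgy.2 ▸ hg⟩
  choose a b c hmem using hex
  -- There are fewer units than elements, so two elements of `S` share their multiplier `c`.
  have hc : ¬ Function.Injective c := fun hinj => by
    obtain ⟨y, hy⟩ := Finite.surjective_of_injective (Units.val_injective.comp hinj) 0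
    exact (c y).ne_zero hy
  obtain ⟨y, z, hyz, hne⟩ := Function.not_injective_iff.1 hc
  have hquot := G.mul_mem (hmem y) (G.inv_mem (hmem z))
  rw [aff_inv, aff_mul, hyz, mul_inv_cancel, mul_neg (c z).1, Units.mul_inv_cancel_left,
    ← sub_eq_neg_add] at hquot
  exact ⟨_, _, _, sub_ne_zero.2 hne, hquot⟩

variable {p q : ℕ} [Fact p.Prime] [Fact q.Prime]

theorem coprime_of_lt (hqp : q < p) : p.Coprime q :=
  (Nat.coprime_primes Fact.out Fact.out).2 hqp.ne'

theorem coprime_sub_one_of_lt (hqp : q < p) : p.Coprime (q - 1) :=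
  Nat.coprime_of_lt_prime (Nat.sub_ne_zero_of_lt (Fact.out : q.Prime).one_lt)
    ((Nat.sub_le q 1).trans_lt hqp) Fact.out

theorem unit_eq_one_of_pow_eq_one {n : ℕ} (hn : n.Coprime (q - 1)) {c : (ZMod q)ˣ}
    (hc : c ^ n = 1) : c = 1 :=
  (pow_eq_one_iff_of_coprime hn).1 ⟨hc, ZMod.units_pow_card_sub_one_eq_one q c⟩

theorem aff_of_pow_eq_one (hqp : q < p) {a : (ZMod p)ˣ} {b : ZMod p} {c : (ZMod q)ˣ} {d : ZMod q}
    (h : aff a b c d ^ p = 1) : a = 1 ∧ c = 1 ∧ d = 0 := by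
  obtain ⟨b', d', hpow⟩ := aff_pow_exists a b c d p
  rw [h, ← aff_one, aff_inj] at hpow
  obtain rfl : a = 1 := unit_eq_one_of_pow_eq_one
    ((Nat.coprime_self_sub_right (Fact.out : p.Prime).one_le).2 p.coprime_one_right) hpow.1.symm
  obtain rfl : c = 1 := unit_eq_one_of_pow_eq_one (coprime_sub_one_of_lt hqp) hpow.2.2.1.symm
  rw [transl_pow, ← aff_one, aff_inj] at h
  have hunit : IsUnit (p : ZMod q) := (ZMod.isUnit_iff_coprime p q).2 (coprime_of_lt hqp)
  exact ⟨rfl, rfl, hunit.mul_right_eq_zero.1 h.2.2.2⟩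

theorem aff_fst_mem (hqp : q < p) {G : Subgroup (Equiv.Perm (ZMod p × ZMod q))}
    [MulAction.IsPretransitive G (ZMod p × ZMod q)] (hG : G ≤ holGroup ⊤) (b : ZMod p) :
    aff 1 b 1 0 ∈ G := by
  have hdvd : p ∣ Nat.card G := by
    refine dvd_trans ?_ (card_dvd_of_isPretransitive (X := ZMod p × ZMod q) G)
    rw [Nat.card_prod, Nat.card_zmod]
    exact dvd_mul_right _ _
  obtain ⟨⟨g, hg⟩, hord⟩ := exists_prime_orderOf_dvd_card' p hdvd
  obtain ⟨a, b', c, d, -, rfl⟩ := hG hg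
  rw [Subgroup.orderOf_mk] at hord
  obtain ⟨rfl, rfl, rfl⟩ := aff_of_pow_eq_one hqp (hord ▸ pow_orderOf_eq_one _)
  have hb' : b' ≠ 0 := by
    rintro rfl
    rw [aff_one, orderOf_one] at hord
    exact (Fact.out : p.Prime).one_lt.ne hord
  have hpow := G.pow_mem hg (b * b'⁻¹).val
  rwa [transl_pow, ZMod.natCast_val, ZMod.cast_id, inv_mul_cancel_right₀ hb', mul_zero] at hpow

theorem translGroup_le_of_forall_mem {R : Type*} [CommRing R]
    {G : Subgroup (Equiv.Perm (R × ZMod q))} {d : ZMod q} (hd : d ≠ 0)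
    (hfst : ∀ b, aff 1 b 1 0 ∈ G) (hsnd : aff 1 0 1 d ∈ G) : translGroup (R × ZMod q) ≤ G := by
  intro g hg
  obtain ⟨b, d', rfl⟩ := mem_translGroup_iff.1 hg
  have hmul := G.mul_mem (hfst b) (G.pow_mem hsnd (d' * d⁻¹).val)
  rw [transl_pow, mul_zero, ZMod.natCast_val, ZMod.cast_id, inv_mul_cancel_right₀ hd,
    aff_mul] at hmul
  simpa using hmul

theorem eq_translGroup_of_le (hqp : q < p) {N : Subgroup (Equiv.Perm (ZMod p × ZMod q))}
    (hle : N ≤ holGroup ⊤) (hN : IsRegularSubgroup N) (e : N ≃* Cyc (p * q)) :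
    N = translGroup (ZMod p × ZMod q) := by
  have := hN.isPretransitive
  refine eq_of_le_of_isRegularSubgroup isRegularSubgroup_translGroup fun g hg => ?_
  obtain ⟨a, b, c, d, -, rfl⟩ := hle hg
  have ha : a = 1 := by
    have : IsMulCommutative N := ⟨⟨fun x y => e.injective <|
      (map_mul e x y).trans <| (mul_comm _ _).trans (map_mul e y x).symm⟩⟩
    have hcomm : aff a b c d * aff 1 1 1 0 = aff 1 1 1 0 * aff a b c d :=
      setLike_mul_comm hg (aff_fst_mem hqp hle 1)
    simp only [aff_mul, aff_inj, mul_one, Units.val_one, one_mul] at hcomm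
    exact Units.ext (add_right_cancel (hcomm.2.1.trans (add_comm b 1)))
  have hpow : aff a b c d ^ (p * q) = 1 := by
    have hcard : Nat.card N = p * q := (Nat.card_congr e.toEquiv).trans (Nat.card_zmod (p * q))
    exact congrArg Subtype.val (hcard ▸ pow_card_eq_one' (x := (⟨_, hg⟩ : N)))
  obtain ⟨b', d', hpow'⟩ := aff_pow_exists a b c d (p * q)
  rw [hpow, ← aff_one, aff_inj] at hpow'
  have hc : c = 1 := unit_eq_one_of_pow_eq_one
    (Nat.Coprime.mul_left (coprime_sub_one_of_lt hqp)
      ((Nat.coprime_self_sub_right (Fact.out : q.Prime).one_le).2 q.coprime_one_right))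
    hpow'.2.2.1.symm
  exact aff_mem_translGroup_iff.2 ⟨ha, hc⟩

theorem exists_aff_snd_mem (hq : 3 ≤ q) (hpq : p = 2 * q + 1)
    {G : Subgroup (Equiv.Perm (ZMod p × ZMod q))} [MulAction.IsPretransitive G (ZMod p × ZMod q)]
    (hG : G ≤ holGroup ⊤) : ∃ u : (ZMod p)ˣ, u ^ q = 1 ∧ aff u 0 1 1 ∈ G := by
  obtain ⟨a, b, d, hd, hmem⟩ := exists_aff_snd_ne_zero hG
  have hmem₀ : aff a 0 1 d ∈ G := by
    simpa [aff_mul] using G.mul_mem (aff_fst_mem (by omega) hG (-b)) hmem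
  have htwo : (2 : ZMod q) ≠ 0 := by
    have : Fact (2 < q) := ⟨hq⟩
    exact ZMod.neg_one_ne_one.symm ∘ fun h => by linear_combination h
  -- Replacing the element by an even power makes its first multiplier a square.
  set k := ((2 * d)⁻¹).val
  have hpow := G.pow_mem hmem₀ (2 * k)
  rw [scale_pow, Nat.cast_mul, ZMod.natCast_val, ZMod.cast_id, Nat.cast_ofNat, mul_right_comm,
    mul_inv_cancel₀ (mul_ne_zero htwo hd)] at hpow
  refine ⟨_, ?_, hpow⟩
  have hexp : 2 * k * q = (p - 1) * k := by
    rw [hpq, Nat.add_sub_cancel]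
    ring
  rw [← pow_mul, hexp, pow_mul, ZMod.units_pow_card_sub_one_eq_one, one_pow]

end TransitiveAffine

/-! ### Affine groups twisted by a character -/

section ExcGroup

variable {R S : Type*} [CommRing R] [CommRing S]

/-- The group of all permutations `(x, y) ↦ (a χ(d) x + b, y + d)` with `a ∈ A`. For `S = ZMod q`
and nontrivial `χ` these groups are the transitive affine groups which need not contain the
translations. -/
def excGroup (χ : Multiplicative S →* Rˣ) (A : Subgroup Rˣ) : Subgroup (Equiv.Perm (R × S)) where
  carrier := {g | ∃ a b d, a ∈ A ∧ g = aff (a * χ (.ofAdd d)) b 1 d}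
  mul_mem' := by
    rintro _ _ ⟨a, b, d, h, rfl⟩ ⟨a', b', d', h', rfl⟩
    refine ⟨a * a', (a * χ (.ofAdd d) : Rˣ) * b' + b, d' + d, A.mul_mem h h', ?_⟩
    rw [aff_mul, aff_inj]
    refine ⟨?_, rfl, by simp, by simp⟩
    rw [ofAdd_add, map_mul, mul_mul_mul_comm, mul_comm (χ (.ofAdd d'))]
  one_mem' := ⟨1, 0, 0, A.one_mem, by simp⟩
  inv_mem' := by
    rintro _ ⟨a, b, d, h, rfl⟩
    refine ⟨a⁻¹, -(((a * χ (.ofAdd d))⁻¹ : Rˣ) * b), -d, A.inv_mem h, ?_⟩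
    rw [aff_inv, aff_inj]
    refine ⟨?_, rfl, by simp, by simp⟩
    rw [ofAdd_neg, map_inv, mul_inv]

variable {χ χ' : Multiplicative S →* Rˣ} {A B : Subgroup Rˣ}

theorem aff_mem_excGroup {a : Rˣ} {b : R} {c : Sˣ} {d : S} :
    aff a b c d ∈ excGroup χ A ↔ c = 1 ∧ a * (χ (.ofAdd d))⁻¹ ∈ A := by
  constructor
  · rintro ⟨a', b', d', h, h'⟩
    obtain ⟨rfl, -, rfl, rfl⟩ := aff_inj.1 h'
    exact ⟨rfl, by rwa [mul_inv_cancel_right]⟩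
  · rintro ⟨rfl, h⟩
    exact ⟨_, b, d, h, by rw [inv_mul_cancel_right]⟩

theorem excGroup_le_holGroup (χ : Multiplicative S →* Rˣ) (A : Subgroup Rˣ) :
    excGroup χ A ≤ holGroup ⊤ := by
  rintro _ ⟨a, b, d, -, rfl⟩
  exact aff_mem_holGroup.2 trivial

theorem excGroup_mono (χ : Multiplicative S →* Rˣ) (h : A ≤ B) :
    excGroup χ A ≤ excGroup χ B := by
  rintro _ ⟨a, b, d, ha, rfl⟩
  exact ⟨a, b, d, h ha, rfl⟩

theorem isRegularSubgroup_excGroup_bot (χ : Multiplicative S →* Rˣ) :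
    IsRegularSubgroup (excGroup χ ⊥) := by
  intro x y
  refine ⟨⟨aff (χ (.ofAdd (y.2 - x.2))) (y.1 - χ (.ofAdd (y.2 - x.2)) * x.1) 1 (y.2 - x.2),
    aff_mem_excGroup.2 ⟨rfl, by simp⟩⟩, by simp, ?_⟩
  rintro ⟨_, a, b, d, ha, rfl⟩ (h : aff _ _ _ _ x = y)
  obtain rfl := Subgroup.mem_bot.1 ha
  refine Subtype.ext (aff_inj.2 ?_)
  simp [← h]

theorem eq_bot_of_isRegularSubgroup_excGroup (h : IsRegularSubgroup (excGroup χ A)) : A = ⊥ := by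
  refine (Subgroup.eq_bot_iff_forall _).2 fun a ha => ?_
  have hone : (⟨aff a 0 1 0, aff_mem_excGroup.2 ⟨rfl, by simpa using ha⟩⟩ : excGroup χ A) = 1 :=
    (h.apply_eq_self_iff (x := 0)).1 (by simp)
  exact (aff_inj.1 ((congrArg Subtype.val hone).trans aff_one.symm)).1

theorem excGroup_le_normalizer_excGroup (χ : Multiplicative S →* Rˣ) (A B : Subgroup Rˣ) :
    excGroup χ A ≤ Subgroup.normalizer (excGroup χ B : Set (Equiv.Perm (R × S))) := by
  rw [Subgroup.le_normalizer_iff]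
  rintro _ ⟨a, b, d, -, rfl⟩ _ ⟨a', b', d', ha', rfl⟩
  rw [aff_inv, aff_mul, aff_mul]
  exact ⟨a', _, d', ha', aff_inj.2 ⟨mul_inv_cancel_comm _ _, rfl, by simp, by simp⟩⟩

theorem translGroup_le_excGroup_iff : translGroup (R × S) ≤ excGroup χ A ↔ χ.range ≤ A := by
  constructor
  · rintro h _ ⟨d, rfl⟩
    have hd := (aff_mem_excGroup.1 (h (mem_translGroup_iff.2 ⟨0, d.toAdd, rfl⟩))).2
    rwa [one_mul, A.inv_mem_iff] at hd
  · intro h g hg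
    obtain ⟨b, d, rfl⟩ := mem_translGroup_iff.1 hg
    exact aff_mem_excGroup.2 ⟨rfl, by simpa using h ⟨_, rfl⟩⟩

theorem map_excGroup {c : Sˣ} (hc : ∀ d, χ' (.ofAdd (c * d)) = χ (.ofAdd d)) (A : Subgroup Rˣ) :
    (excGroup χ A).map (aff 1 0 c 0).permCongrHom.toMonoidHom = excGroup χ' A := by
  have hconj (a : Rˣ) (b : R) (d : S) :
      (aff 1 0 c 0).permCongrHom (aff a b 1 d) = aff a b 1 (c * d) := by
    change aff 1 0 c 0 * aff a b 1 d * (aff 1 0 c 0)⁻¹ = _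
    rw [aff_inv, aff_mul, aff_mul, aff_inj]
    simp
  ext g
  constructor
  · rintro ⟨_, ⟨a, b, d, ha, rfl⟩, rfl⟩
    exact ⟨a, b, c * d, ha, by rw [hc]; exact hconj _ _ _⟩
  · rintro ⟨a, b, d, ha, rfl⟩
    refine ⟨_, ⟨a, b, c⁻¹.1 * d, ha, rfl⟩, (hconj _ _ _).trans ?_⟩
    rw [← hc, Units.mul_inv_cancel_left]

theorem exists_eq_excGroup_of_forall_mem {G : Subgroup (Equiv.Perm (R × S))} (hG : G ≤ holGroup ⊤)
    (hone : ∀ {a b c d}, aff a b c d ∈ G → c = 1) (hfst : ∀ b, aff 1 b 1 0 ∈ G)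
    (hχ : ∀ d, aff (χ (.ofAdd d)) 0 1 d ∈ G) : ∃ A, G = excGroup χ A := by
  have hlinear (a : Rˣ) (b : R) (d : S) :
      aff (a * χ (.ofAdd d)) b 1 d ∈ G ↔ aff a 0 1 0 ∈ G := by
    have hmul : aff (a * χ (.ofAdd d)) b 1 d =
        aff 1 b 1 0 * (aff a 0 1 0 * aff (χ (.ofAdd d)) 0 1 d) := by simp [aff_mul]
    rw [hmul, G.mul_mem_cancel_left (hfst b), G.mul_mem_cancel_right (hχ d)]
  refine ⟨{ carrier := {a | aff a 0 1 0 ∈ G}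
            mul_mem' := fun {x y} hx hy => ?_
            one_mem' := by simp
            inv_mem' := fun {x} hx => ?_ }, ?_⟩
  · simpa [aff_mul] using G.mul_mem hx hy
  · simpa [aff_inv] using G.inv_mem hx
  · ext g
    constructor
    · intro hg
      obtain ⟨a, b, c, d, -, rfl⟩ := hG hg
      obtain rfl := hone hg
      exact aff_mem_excGroup.2 ⟨rfl, (hlinear _ b d).1 (by rwa [inv_mul_cancel_right])⟩
    · rintro ⟨a, b, d, ha, rfl⟩
      exact (hlinear _ _ _).2 ha

end ExcGroup

section Characters

theorem card_cyc (n : ℕ) : Nat.card (Cyc n) = n := Nat.card_zmod n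

variable {M : Type*} [Group M] {n : ℕ}

theorem char_apply_eq_pow [NeZero n] (χ : Multiplicative (ZMod n) →* M) (d : ZMod n) :
    χ (.ofAdd d) = χ (.ofAdd 1) ^ d.val := by
  rw [← map_pow, ← ofAdd_nsmul]
  simp

theorem char_injective [Fact n.Prime] {χ : Multiplicative (ZMod n) →* M} (hχ : χ ≠ 1) :
    Function.Injective χ := by
  have : IsSimpleGroup (Multiplicative (ZMod n)) :=
    isSimpleGroup_of_prime_card (p := n) (Nat.card_zmod n)
  rw [← MonoidHom.ker_eq_bot_iff]
  exact (IsSimpleGroup.eq_bot_or_eq_top_of_normal χ.ker inferInstance).resolve_right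
    fun h => hχ (MonoidHom.ker_eq_top_iff.1 h)

theorem char_pow_eq_one (χ : Multiplicative (ZMod n) →* M) (x : Multiplicative (ZMod n)) :
    χ x ^ n = 1 := by
  have hx : x ^ Nat.card (Cyc n) = 1 := pow_card_eq_one'
  rw [card_cyc] at hx
  rw [← map_pow, hx, map_one]

theorem exists_char_apply_one_eq {u : M} (hu : u ^ n = 1) :
    ∃ χ : Multiplicative (ZMod n) →* M, χ (.ofAdd 1) = u := by
  let f : ZMod n →+ Additive M :=
    ZMod.lift n ⟨zmultiplesHom _ (Additive.ofMul u), by simp [← ofMul_pow, hu]⟩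
  refine ⟨AddMonoidHom.toMultiplicativeLeft f, ?_⟩
  have hf : f ((1 : ℤ) : ZMod n) = Additive.ofMul u := by
    rw [ZMod.lift_coe]
    simp
  rw [Int.cast_one] at hf
  exact congrArg Additive.toMul hf

variable {R : Type*} [CommRing R] {q : ℕ} [Fact q.Prime]

theorem not_translGroup_le_excGroup (hq : 3 ≤ q) {χ : Multiplicative (ZMod q) →* Rˣ} (hχ : χ ≠ 1)
    {A : Subgroup Rˣ} (hA : ∀ a ∈ A, a ^ 2 = 1) :
    ¬ translGroup (R × ZMod q) ≤ excGroup χ A := fun h => by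
  have htwo : Nat.Coprime 2 q := (Nat.coprime_primes Nat.prime_two Fact.out).2 (by omega)
  exact hχ <| MonoidHom.ext fun x => (pow_eq_one_iff_of_coprime htwo).1
    ⟨hA _ (translGroup_le_excGroup_iff.1 h ⟨x, rfl⟩), char_pow_eq_one χ x⟩

variable [IsDomain R]

theorem exists_pow_eq_of_pow_eq_one {u v : Rˣ} (hu : u ^ q = 1) (hu₁ : u ≠ 1) (hv : v ^ q = 1) :
    ∃ k : ℕ, u ^ k = v := by
  have hprim : IsPrimitiveRoot (u : R) q :=
    IsPrimitiveRoot.coe_units_iff.2 (orderOf_eq_prime hu hu₁ ▸ IsPrimitiveRoot.orderOf u)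
  obtain ⟨i, -, hi⟩ := hprim.eq_pow_of_pow_eq_one (ξ := (v : R))
    (by rw [← Units.val_pow_eq_pow_val, hv, Units.val_one])
  exact ⟨i, Units.ext (by exact_mod_cast hi)⟩

theorem exists_char_mul_eq {χ χ' : Multiplicative (ZMod q) →* Rˣ} (hχ : χ ≠ 1) (hχ' : χ' ≠ 1) :
    ∃ c : (ZMod q)ˣ, ∀ d, χ' (.ofAdd (c * d)) = χ (.ofAdd d) := by
  have hgen : Multiplicative.ofAdd (1 : ZMod q) ≠ 1 := one_ne_zero (α := ZMod q)
  obtain ⟨k, hk⟩ := exists_pow_eq_of_pow_eq_one (char_pow_eq_one χ' _)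
    ((map_ne_one_iff χ' (char_injective hχ')).2 hgen) (char_pow_eq_one χ (.ofAdd 1))
  have hk₀ : (k : ZMod q) ≠ 0 := fun h₀ => by
    obtain ⟨m, rfl⟩ := (ZMod.natCast_eq_zero_iff k q).1 h₀
    rw [pow_mul, char_pow_eq_one, one_pow] at hk
    exact (map_ne_one_iff χ (char_injective hχ)).2 hgen hk.symm
  refine ⟨Units.mk0 _ hk₀, fun d => ?_⟩
  have hmul : (k : ZMod q) * d = (k * d.val) • (1 : ZMod q) := by simp
  rw [Units.val_mk0, hmul, ofAdd_nsmul, map_pow, pow_mul, hk, ← char_apply_eq_pow]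

theorem exists_map_excGroup_eq {χ χ' : Multiplicative (ZMod q) →* Rˣ} (hχ : χ ≠ 1)
    (hχ' : χ' ≠ 1) (A : Subgroup Rˣ) :
    ∃ f : R × ZMod q ≃ R × ZMod q,
      (excGroup χ A).map f.permCongrHom.toMonoidHom = excGroup χ' A := by
  obtain ⟨c, hc⟩ := exists_char_mul_eq hχ hχ'
  exact ⟨_, map_excGroup hc A⟩

end Characters

/-! ### Transitive affine groups which do not contain the translations -/

section Exceptional

variable {p q : ℕ} [Fact q.Prime]

theorem eq_one_of_aff_mem {R : Type*} [CommRing R] {G : Subgroup (Equiv.Perm (R × ZMod q))}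
    (hnot : ¬ translGroup (R × ZMod q) ≤ G) (hfst : ∀ b, aff 1 b 1 0 ∈ G) {u : Rˣ}
    (hu : aff u 0 1 1 ∈ G) {a : Rˣ} {b : R} {c : (ZMod q)ˣ} {d : ZMod q}
    (h : aff a b c d ∈ G) : c = 1 := by
  by_contra hc
  -- Up to a translation in the first coordinate, the commutator is the translation by `(0, c - 1)`.
  obtain ⟨b', hb'⟩ : ∃ b', aff 1 b' 1 (c.1 - 1) ∈ G := by
    have hcomm := G.mul_mem (G.mul_mem h hu) (G.mul_mem (G.inv_mem h) (G.inv_mem hu))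
    simp only [aff_inv, aff_mul] at hcomm
    refine ⟨_, (congrArg (· ∈ G) (aff_inj.2 ⟨?_, rfl, by simp, ?_⟩)).mp hcomm⟩
    · rw [mul_mul_mul_comm, mul_inv_cancel, mul_inv_cancel, one_mul]
    · rw [mul_one c, inv_one, Units.val_one]
      linear_combination (-1 - d) * c.mul_inv
  refine hnot (translGroup_le_of_forall_mem (sub_ne_zero.2 fun h₁ => hc (Units.ext h₁)) hfst ?_)
  simpa [aff_mul] using G.mul_mem (hfst (-b')) hb'

theorem pow_two_eq_one_of_not_translGroup_le [Fact p.Prime] (hpq : p = 2 * q + 1)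
    {χ : Multiplicative (ZMod q) →* (ZMod p)ˣ} {A : Subgroup (ZMod p)ˣ}
    (hnot : ¬ translGroup (ZMod p × ZMod q) ≤ excGroup χ A) {a : (ZMod p)ˣ} (ha : a ∈ A) :
    a ^ 2 = 1 := by
  by_contra ha₂
  have haq : (a ^ 2) ^ q = 1 := by
    rw [← pow_mul, show 2 * q = p - 1 by omega, ZMod.units_pow_card_sub_one_eq_one]
  refine hnot (translGroup_le_excGroup_iff.2 ?_)
  rintro _ ⟨x, rfl⟩
  obtain ⟨k, hk⟩ := exists_pow_eq_of_pow_eq_one haq ha₂ (char_pow_eq_one χ x)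
  exact hk ▸ A.pow_mem (A.pow_mem ha 2) k

theorem exists_eq_excGroup [Fact p.Prime] (hq : 3 ≤ q) (hpq : p = 2 * q + 1)
    {G : Subgroup (Equiv.Perm (ZMod p × ZMod q))} [MulAction.IsPretransitive G (ZMod p × ZMod q)]
    (hG : G ≤ holGroup ⊤) (hnot : ¬ translGroup (ZMod p × ZMod q) ≤ G) :
    ∃ (χ : Multiplicative (ZMod q) →* (ZMod p)ˣ) (A : Subgroup (ZMod p)ˣ), χ ≠ 1 ∧
      (∀ a ∈ A, a ^ 2 = 1) ∧ G = excGroup χ A := by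
  obtain ⟨u, hu, hmem⟩ := exists_aff_snd_mem hq hpq hG
  obtain ⟨χ, rfl⟩ := exists_char_apply_one_eq hu
  have hfst (b : ZMod p) : aff 1 b 1 0 ∈ G := aff_fst_mem (by omega) hG b
  have hχ (d : ZMod q) : aff (χ (.ofAdd d)) 0 1 d ∈ G := by
    have hpow := G.pow_mem hmem d.val
    rwa [scale_pow, ← char_apply_eq_pow, mul_one, ZMod.natCast_val, ZMod.cast_id] at hpow
  obtain ⟨A, rfl⟩ := exists_eq_excGroup_of_forall_mem hG (eq_one_of_aff_mem hnot hfst hmem) hfst hχ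
  refine ⟨χ, A, ?_, fun a => pow_two_eq_one_of_not_translGroup_le hpq hnot, rfl⟩
  rintro rfl
  exact hnot (translGroup_le_excGroup_iff.2 (by simp))

end Exceptional

/-! ### Shears -/

section Shear

variable {R S : Type*} [CommRing R] [CommRing S] {χ : Multiplicative S →* Rˣ} {A : Subgroup Rˣ}

/-- The permutation `(x, y) ↦ (x + h χ(y), y)`. -/
def shear (χ : Multiplicative S →* Rˣ) (h : R) : Equiv.Perm (R × S) where
  toFun v := (v.1 + h * χ (.ofAdd v.2), v.2)
  invFun v := (v.1 - h * χ (.ofAdd v.2), v.2)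
  left_inv v := by simp
  right_inv v := by simp

theorem shear_conj_aff_apply (χ : Multiplicative S →* Rˣ) (h : R) (a : Rˣ) (b : R) (d : S)
    (v : R × S) : (shear χ h).permCongrHom (aff a b 1 d) v =
      (a * v.1 + b + h * (χ (.ofAdd d) - a) * χ (.ofAdd v.2), v.2 + d) := by
  change shear χ h (aff a b 1 d ((shear χ h).symm v)) = _
  simp only [shear, Equiv.coe_fn_mk, Equiv.coe_fn_symm_mk, aff_apply, Units.val_one, one_mul,
    ofAdd_add, map_mul, Units.val_mul]
  exact Prod.ext (by ring) rfl

theorem excGroup_bot_map_shear (χ : Multiplicative S →* Rˣ) (h : R) :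
    (excGroup χ ⊥).map (shear χ h).permCongrHom.toMonoidHom = excGroup χ ⊥ := by
  have hfix : ∀ g ∈ excGroup χ ⊥, (shear χ h).permCongrHom g = g := by
    rintro _ ⟨a, b, d, ha, rfl⟩
    obtain rfl := Subgroup.mem_bot.1 ha
    ext1 v
    rw [shear_conj_aff_apply]
    simp
  ext g
  constructor
  · rintro ⟨g, hg, rfl⟩
    exact (hfix g hg).symm ▸ hg
  · exact fun hg => ⟨g, hg, hfix g hg⟩

theorem apply_eq_of_forall_commute {κ : Equiv.Perm (R × S)}
    (hκ : ∀ g ∈ excGroup χ A, Commute κ g) (v : R × S) :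
    κ v = (χ (.ofAdd v.2) * (κ 0).1 + v.1, v.2 + (κ 0).2) := by
  have hmem : aff (χ (.ofAdd v.2)) v.1 1 v.2 ∈ excGroup χ A := aff_mem_excGroup.2 ⟨rfl, by simp⟩
  simpa [add_comm (κ 0).2] using Equiv.congr_fun (hκ _ hmem) 0

theorem apply_zero_fst_eq_zero [IsDomain R] {κ : Equiv.Perm (R × S)}
    (hκ : ∀ g ∈ excGroup χ A, Commute κ g) (hA : A ≠ ⊥) : (κ 0).1 = 0 := by
  obtain ⟨⟨a, ha⟩, hne⟩ := Subgroup.ne_bot_iff_exists_ne_one.1 hA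
  have hmem : aff a 0 1 0 ∈ excGroup χ A := aff_mem_excGroup.2 ⟨rfl, by simpa using ha⟩
  have hfix : (κ 0).1 = a * (κ 0).1 := by
    simpa [← Prod.zero_eq_mk] using congrArg Prod.fst (Equiv.congr_fun (hκ _ hmem) 0)
  by_contra h₀
  exact hne (Subtype.ext (Units.ext ((right_eq_mul₀ h₀).1 hfix)))

theorem eq_one_of_forall_commute {κ : Equiv.Perm (R × S)}
    (hκ : ∀ g ∈ excGroup χ A, Commute κ g) (hsnd : (κ 0).2 = 0) {n : ℕ} (hn : IsUnit (n : R))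
    (hpow : κ ^ n = 1) : κ = 1 := by
  have hκv := apply_eq_of_forall_commute hκ
  have hiter (k : ℕ) : (κ ^ k) 0 = (k * (κ 0).1, 0) := by
    induction k with
    | zero => simp [Prod.ext_iff]
    | succ k ih =>
      rw [pow_succ', Equiv.Perm.mul_apply, ih, hκv, hsnd]
      refine Prod.ext ?_ (add_zero 0)
      simp
      ring
  have hfst : (κ 0).1 = 0 := hn.mul_right_eq_zero.1 <| by
    simpa [hpow] using (congrArg Prod.fst (hiter n)).symm
  ext1 v
  rw [hκv, hfst, hsnd]
  simp

theorem shear_conj_eq_of_forall_commute {κ : Equiv.Perm (R × S)}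
    (hκ : ∀ g ∈ excGroup χ A, Commute κ g) {h : R}
    (hh : h * (χ (.ofAdd (κ 0).2) - 1) = (κ 0).1) :
    (shear χ h).permCongrHom (aff 1 0 1 (κ 0).2) = κ := by
  ext1 v
  rw [shear_conj_aff_apply, apply_eq_of_forall_commute hκ v, Units.val_one, hh]
  exact Prod.ext (by ring) rfl

variable {q : ℕ} [Fact q.Prime] {χ : Multiplicative (ZMod q) →* Rˣ}

theorem char_sub_one_ne_zero (hχ : χ ≠ 1) {d : ZMod q} (hd : d ≠ 0) :
    (χ (.ofAdd d) : R) - 1 ≠ 0 := by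
  rw [sub_ne_zero, Ne, Units.val_eq_one, ← Ne, map_ne_one_iff χ (char_injective hχ)]
  exact hd

theorem map_shear_injective [IsDomain R] (hχ : χ ≠ 1) : Function.Injective fun h : R =>
    (translGroup (R × ZMod q)).map (shear χ h).permCongrHom.toMonoidHom := by
  intro h h' (hh : Subgroup.map _ _ = Subgroup.map _ _)
  have hmem : (shear χ h).permCongrHom (aff 1 0 1 1) ∈
      (translGroup (R × ZMod q)).map (shear χ h').permCongrHom.toMonoidHom :=
    hh.le ⟨_, mem_translGroup_iff.2 ⟨0, 1, rfl⟩, rfl⟩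
  obtain ⟨g, hg, hbd : (shear χ h').permCongrHom g = _⟩ := hmem
  obtain ⟨b, d, rfl⟩ := mem_translGroup_iff.1 hg
  have hzero := Equiv.congr_fun hbd (0, 0)
  have hone := Equiv.congr_fun hbd (0, 1)
  simp only [shear_conj_aff_apply, Units.val_one, mul_zero, zero_add, add_zero, ofAdd_zero,
    map_one, mul_one, Prod.mk.injEq] at hzero hone
  obtain ⟨hzero, rfl⟩ := hzero
  have hprod : (h - h') * ((χ (.ofAdd 1) : R) - 1) ^ 2 = 0 := by
    linear_combination hzero - hone.1
  exact sub_eq_zero.1 ((mul_eq_zero.1 hprod).resolve_right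
    (pow_ne_zero 2 (char_sub_one_ne_zero hχ one_ne_zero)))

end Shear

/-! ### Regular cyclic groups normalised by an affine group -/

section RegularCyclic

variable {p q : ℕ}

theorem translGroup_mem_regularSet (h : p.Coprime q)
    {G : Subgroup (Equiv.Perm (ZMod p × ZMod q))} (hG : G ≤ holGroup ⊤) :
    translGroup (ZMod p × ZMod q) ∈ regularSet G (Cyc (p * q)) :=
  ⟨isRegularSubgroup_translGroup, ⟨(translEquiv _).symm.trans (prodMulEquivCyc h)⟩,
    hG.trans (holGroup_le_normalizer_translGroup ⊤)⟩

theorem exists_equiv_map_le_holGroup (h : p.Coprime q) {X : Type*} [Nonempty X]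
    {G N : Subgroup (Equiv.Perm X)} (hN : N ∈ regularSet G (Cyc (p * q))) :
    ∃ f : X ≃ ZMod p × ZMod q,
      N.map f.permCongrHom.toMonoidHom = translGroup (ZMod p × ZMod q) ∧
        G.map f.permCongrHom.toMonoidHom ≤ holGroup ⊤ := by
  obtain ⟨hreg, ⟨e⟩, -⟩ := id hN
  obtain ⟨f, hf⟩ := exists_equiv_map_eq_translGroup hreg (e.trans (prodMulEquivCyc h).symm)
  refine ⟨f, hf, ?_⟩
  have hnorm := (map_mem_regularSet f hN).2.2
  rwa [hf, normalizer_translGroup h] at hnorm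

variable [Fact p.Prime] [Fact q.Prime]

theorem eq_of_mem_regularSet_of_le (hqp : q < p) {X : Type*} [Nonempty X]
    {G N N' : Subgroup (Equiv.Perm X)} (hN : N ∈ regularSet G (Cyc (p * q))) (hle : N ≤ G)
    (hN' : N' ∈ regularSet G (Cyc (p * q))) : N' = N := by
  obtain ⟨f, hf, hG⟩ := exists_equiv_map_le_holGroup (coprime_of_lt hqp) hN'
  obtain ⟨hreg, ⟨e⟩, -⟩ := map_mem_regularSet f hN
  refine Subgroup.map_injective f.permCongrHom.injective (hf.trans ?_)
  exact (eq_translGroup_of_le hqp ((Subgroup.map_mono hle).trans hG) hreg e).symm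

theorem regularSet_holGroup (hqp : q < p) (A : Subgroup ((ZMod p)ˣ × (ZMod q)ˣ)) :
    regularSet (holGroup A) (Cyc (p * q)) = {translGroup (ZMod p × ZMod q)} := by
  have hmem := translGroup_mem_regularSet (coprime_of_lt hqp) (holGroup_mono (le_top (a := A)))
  exact Set.eq_singleton_iff_unique_mem.2 ⟨hmem, fun N hN =>
    eq_of_mem_regularSet_of_le hqp hmem (translGroup_le_holGroup A) hN⟩

variable {χ : Multiplicative (ZMod q) →* (ZMod p)ˣ} {A : Subgroup (ZMod p)ˣ}
  {N : Subgroup (Equiv.Perm (ZMod p × ZMod q))}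

theorem exists_equiv_map_excGroup_eq (hq : 3 ≤ q) (hpq : p = 2 * q + 1) (hχ : χ ≠ 1)
    (hA : ∀ a ∈ A, a ^ 2 = 1) (hN : N ∈ regularSet (excGroup χ A) (Cyc (p * q))) :
    ∃ (f : ZMod p × ZMod q ≃ ZMod p × ZMod q) (χ' : Multiplicative (ZMod q) →* (ZMod p)ˣ)
      (A' : Subgroup (ZMod p)ˣ),
      N.map f.permCongrHom.toMonoidHom = translGroup (ZMod p × ZMod q) ∧
        (excGroup χ A).map f.permCongrHom.toMonoidHom = excGroup χ' A' := by
  obtain ⟨f, hf, hG⟩ := exists_equiv_map_le_holGroup (coprime_of_lt (by omega)) hN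
  have hnot : ¬ translGroup (ZMod p × ZMod q) ≤
      (excGroup χ A).map f.permCongrHom.toMonoidHom := by
    rw [← hf, Subgroup.map_le_map_iff_of_injective f.permCongrHom.injective]
    intro hle
    obtain ⟨hreg, ⟨e⟩, -⟩ := hN
    obtain rfl := eq_translGroup_of_le (by omega) (hle.trans (excGroup_le_holGroup χ A)) hreg e
    exact not_translGroup_le_excGroup hq hχ hA hle
  have := (isRegularSubgroup_map f (isRegularSubgroup_excGroup_bot χ)).isPretransitive
  have := isPretransitive_of_le
    (Subgroup.map_mono (f := f.permCongrHom.toMonoidHom) (excGroup_mono χ (bot_le (a := A))))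
  obtain ⟨χ', A', -, -, heq⟩ := exists_eq_excGroup hq hpq hG hnot
  exact ⟨f, χ', A', hf, heq⟩

theorem exists_commute_of_mem_regularSet (hq : 3 ≤ q) (hpq : p = 2 * q + 1) (hχ : χ ≠ 1)
    (hA : ∀ a ∈ A, a ^ 2 = 1) (hN : N ∈ regularSet (excGroup χ A) (Cyc (p * q))) :
    (∀ b, aff 1 b 1 0 ∈ N) ∧
      ∃ κ ∈ N, κ ≠ 1 ∧ κ ^ q = 1 ∧ ∀ g ∈ excGroup χ A, Commute κ g := by
  obtain ⟨f, χ', A', hf, heq⟩ := exists_equiv_map_excGroup_eq hq hpq hχ hA hN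
  have hmem (g) : f.permCongrHom g ∈ translGroup (ZMod p × ZMod q) ↔ g ∈ N := by
    rw [← hf]
    exact Subgroup.mem_map_iff_mem f.permCongrHom.injective
  have hexc (g) (hg : g ∈ excGroup χ A) : ∃ a b d, f.permCongrHom g = aff a b 1 d := by
    obtain ⟨a, b, d, -, hg'⟩ := heq.le ⟨g, hg, rfl⟩
    exact ⟨_, _, _, hg'⟩
  constructor
  · intro b
    obtain ⟨a', b', d', hb⟩ := hexc (aff 1 b 1 0) (aff_mem_excGroup.2 ⟨rfl, by simp⟩)
    have hpow : aff a' b' 1 d' ^ p = 1 := by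
      rw [← hb, ← map_pow, transl_pow]
      simp
    rw [← hmem, hb, (aff_of_pow_eq_one (by omega) hpow).1]
    exact aff_mem_translGroup_iff.2 ⟨rfl, rfl⟩
  · obtain ⟨κ, hκ⟩ := f.permCongrHom.surjective (aff 1 0 1 1)
    refine ⟨κ, (hmem κ).1 (hκ ▸ aff_mem_translGroup_iff.2 ⟨rfl, rfl⟩), ?_, ?_, fun g hg => ?_⟩
    · rintro rfl
      rw [map_one, ← aff_one, aff_inj] at hκ
      exact zero_ne_one hκ.2.2.2
    · rw [← map_eq_one_iff f.permCongrHom f.permCongrHom.injective, map_pow, hκ, transl_pow]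
      simp
    · obtain ⟨a, b, d, hg'⟩ := hexc g hg
      apply f.permCongrHom.injective
      rw [map_mul, map_mul, hκ, hg', aff_mul, aff_mul, aff_inj]
      simp [add_comm]

theorem exists_eq_map_shear (hq : 3 ≤ q) (hpq : p = 2 * q + 1) (hχ : χ ≠ 1)
    (hA : ∀ a ∈ A, a ^ 2 = 1) (hN : N ∈ regularSet (excGroup χ A) (Cyc (p * q))) :
    ∃ h : ZMod p, N = (translGroup (ZMod p × ZMod q)).map (shear χ h).permCongrHom.toMonoidHom ∧
      (A ≠ ⊥ → h = 0) := by
  obtain ⟨hfst, κ, hκN, hκ, hκq, hcomm⟩ := exists_commute_of_mem_regularSet hq hpq hχ hA hN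
  have hsnd : (κ 0).2 ≠ 0 := fun h₀ => hκ <| eq_one_of_forall_commute hcomm h₀
    ((ZMod.isUnit_iff_coprime q p).2 (coprime_of_lt (by omega)).symm) hκq
  set h := (κ 0).1 * ((χ (.ofAdd (κ 0).2) : ZMod p) - 1)⁻¹ with hh
  refine ⟨h, ?_, fun hA => by rw [hh, apply_zero_fst_eq_zero hcomm hA, zero_mul]⟩
  symm
  have := (isRegularSubgroup_map (shear χ h)
    (isRegularSubgroup_translGroup (V := ZMod p × ZMod q))).isPretransitive
  refine eq_of_le_of_isRegularSubgroup hN.1 (Subgroup.map_le_iff_le_comap.2 ?_)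
  refine translGroup_le_of_forall_mem hsnd (fun b => ?_) ?_
  · have hfix : (shear χ h).permCongrHom (aff 1 b 1 0) = aff 1 b 1 0 := by
      ext1 v
      rw [shear_conj_aff_apply]
      simp
    exact Subgroup.mem_comap.2 (hfix.symm ▸ hfst b)
  · have hconj := shear_conj_eq_of_forall_commute hcomm
      (inv_mul_cancel_right₀ (char_sub_one_ne_zero hχ hsnd) _)
    exact Subgroup.mem_comap.2 (hconj.symm ▸ hκN)

theorem ncard_regularSet_excGroup_bot (hq : 3 ≤ q) (hpq : p = 2 * q + 1) (hχ : χ ≠ 1) :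
    (regularSet (excGroup χ ⊥) (Cyc (p * q))).ncard = p := by
  have hrange : regularSet (excGroup χ ⊥) (Cyc (p * q)) = Set.range fun h : ZMod p =>
      (translGroup (ZMod p × ZMod q)).map (shear χ h).permCongrHom.toMonoidHom := by
    ext N
    constructor
    · intro hN
      obtain ⟨h, rfl, -⟩ := exists_eq_map_shear hq hpq hχ (by simp) hN
      exact ⟨h, rfl⟩
    · rintro ⟨h, rfl⟩
      have hmem := map_mem_regularSet (shear χ h)
        (translGroup_mem_regularSet (coprime_of_lt (by omega)) (excGroup_le_holGroup χ ⊥))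
      rwa [excGroup_bot_map_shear] at hmem
  rw [hrange, ← Set.image_univ, Set.ncard_image_of_injective _ (map_shear_injective hχ),
    Set.ncard_univ, Nat.card_zmod]

theorem ncard_regularSet_excGroup (hq : 3 ≤ q) (hpq : p = 2 * q + 1) (hχ : χ ≠ 1)
    (hA : ∀ a ∈ A, a ^ 2 = 1) (hne : A ≠ ⊥) :
    (regularSet (excGroup χ A) (Cyc (p * q))).ncard = 1 := by
  have hmem := translGroup_mem_regularSet (coprime_of_lt (q := q) (by omega))
    (excGroup_le_holGroup χ A)
  have huniq : ∀ N ∈ regularSet (excGroup χ A) (Cyc (p * q)),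
      N = (translGroup (ZMod p × ZMod q)).map (shear χ 0).permCongrHom.toMonoidHom := by
    intro N hN
    obtain ⟨h, hNh, hzero⟩ := exists_eq_map_shear hq hpq hχ hA hN
    rwa [hzero hne] at hNh
  exact Set.ncard_eq_one.2 ⟨_, Set.eq_singleton_iff_unique_mem.2 ⟨hmem, fun N hN =>
    (huniq N hN).trans (huniq _ hmem).symm⟩⟩

end RegularCyclic

/-! ### Regular groups with a normal complement -/

section NormalComplement

variable {G : Type*} [Group G] (P T : Subgroup G)

/-- The action of `P × T` on `G` by `(a, b) • x = a * x * b⁻¹`, which is regular if `T` is a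
complement of the normal subgroup `P`. -/
def mulInvPerm : P × T →* Equiv.Perm G where
  toFun c := Equiv.mulLeft c.1.1 * Equiv.mulRight c.2.1⁻¹
  map_one' := by ext; simp
  map_mul' c d := by ext; simp [mul_assoc]

variable {P T}

theorem mulInvPerm_apply (c : P × T) (x : G) : mulInvPerm P T c x = c.1 * x * (c.2 : G)⁻¹ := by
  simp [mulInvPerm, mul_assoc]

theorem existsUnique_mulInvPerm_apply_eq [P.Normal] (h : P.IsComplement' T) (x y : G) :
    ∃! c, mulInvPerm P T c x = y := by
  simp only [mulInvPerm_apply]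
  obtain ⟨⟨⟨a, ha⟩, ⟨b, hb⟩⟩, hab : a * b = x⁻¹ * y⟩ := h.surjective (x⁻¹ * y)
  refine ⟨(⟨x * a * x⁻¹, ‹P.Normal›.conj_mem a ha x⟩, ⟨b⁻¹, inv_mem hb⟩), ?_, ?_⟩
  · simp [mul_assoc, hab]
  · rintro ⟨⟨a', ha'⟩, ⟨b', hb'⟩⟩ (hy : a' * x * b'⁻¹ = y)
    have hinj := h.injective (a₁ := (⟨a, ha⟩, ⟨b, hb⟩))
      (a₂ := (⟨x⁻¹ * a' * x, ‹P.Normal›.conj_mem' a' ha' x⟩, ⟨b'⁻¹, inv_mem hb'⟩))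
      (by simp only [hab, ← hy, mul_assoc])
    simp only [Prod.mk.injEq, Subtype.mk.injEq] at hinj
    obtain ⟨rfl, rfl⟩ := hinj
    simp [mul_assoc]

theorem mulInvPerm_range_mem_regularSet [P.Normal] (h : P.IsComplement' T) :
    (mulInvPerm P T).range ∈ regularSet (MulAction.toPermHom G G).range (P × T) := by
  have hinj : Function.Injective (mulInvPerm P T) := fun c d hcd =>
    (existsUnique_mulInvPerm_apply_eq h 1 (mulInvPerm P T d 1)).unique (by rw [hcd]) rfl
  refine ⟨fun x y => ?_, ⟨(MonoidHom.ofInjective hinj).symm⟩, Subgroup.le_normalizer_iff.2 ?_⟩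
  · obtain ⟨c, hc, huniq⟩ := existsUnique_mulInvPerm_apply_eq h x y
    refine ⟨⟨_, c, rfl⟩, hc, ?_⟩
    rintro ⟨_, d, rfl⟩ hd
    rw [huniq d hd]
  · rintro _ ⟨g, rfl⟩ _ ⟨⟨a, b⟩, rfl⟩
    refine ⟨(⟨g * a * g⁻¹, ‹P.Normal›.conj_mem a a.2 g⟩, b), ?_⟩
    ext x
    change mulInvPerm P T _ x = g * mulInvPerm P T (a, b) (g⁻¹ * x)
    simp [mulInvPerm_apply, mul_assoc]

theorem exists_map_eq_toPermHom_range {X : Type*} [Nonempty X] {G : Subgroup (Equiv.Perm X)}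
    (hG : IsRegularSubgroup G) :
    ∃ e : X ≃ G, G.map e.permCongrHom.toMonoidHom = (MulAction.toPermHom G G).range := by
  obtain ⟨x⟩ := ‹Nonempty X›
  obtain ⟨e, he⟩ := exists_equivariant_equiv_of_stabilizer (α := G.subtype)
    (β := MulAction.toPermHom G G) (x := x) (y := 1) (fun y => (hG x y).exists)
    (fun g => ⟨g, mul_one g⟩) (fun g => hG.apply_eq_self_iff.trans (by simp))
  have hrange := map_range_permCongrHom he
  rw [Subgroup.range_subtype] at hrange
  exact ⟨e, hrange⟩

theorem IsRegularSubgroup.card_eq {X : Type*} [Nonempty X] {G : Subgroup (Equiv.Perm X)}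
    (hG : IsRegularSubgroup G) : Nat.card G = Nat.card X := by
  obtain ⟨e, -⟩ := exists_map_eq_toPermHom_range hG
  exact (Nat.card_congr e).symm

theorem regularSet_nonempty_of_isComplement' {X : Type*} [Nonempty X] {G : Subgroup (Equiv.Perm X)}
    (hG : IsRegularSubgroup G) {P T : Subgroup G} [P.Normal] (h : P.IsComplement' T) :
    (regularSet G (P × T)).Nonempty := by
  obtain ⟨e, he⟩ := exists_map_eq_toPermHom_range hG
  rw [← regularSet_map_nonempty e, he]
  exact ⟨_, mulInvPerm_range_mem_regularSet h⟩

end NormalComplement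

section RegularDegree

variable {p q : ℕ} [Fact p.Prime] [Fact q.Prime]

theorem minFac_mul_of_lt (hqp : q < p) : (p * q).minFac = q := by
  have hp : p.Prime := Fact.out
  have hq : q.Prime := Fact.out
  have hprime : (p * q).minFac.Prime := Nat.minFac_prime
    (Nat.one_lt_mul_iff.2 ⟨hp.pos, hq.pos, Or.inl hp.one_lt⟩).ne'
  have hle : (p * q).minFac ≤ q := Nat.minFac_le_of_dvd hq.two_le (dvd_mul_left _ _)
  rcases hprime.dvd_mul.1 (Nat.minFac_dvd (p * q)) with h | h
  · exact absurd ((Nat.prime_dvd_prime_iff_eq hprime hp).1 h) (hle.trans_lt hqp).ne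
  · exact (Nat.prime_dvd_prime_iff_eq hprime hq).1 h

theorem exists_normal_isComplement' (hqp : q < p) {G : Type*} [Group G]
    (hG : Nat.card G = p * q) : ∃ P T : Subgroup G,
      P.Normal ∧ P.IsComplement' T ∧ Nat.card P = p ∧ Nat.card T = q := by
  have : Finite G := Nat.finite_of_card_ne_zero (hG ▸ NeZero.ne (p * q))
  obtain ⟨σ, hσ⟩ := exists_prime_orderOf_dvd_card' (G := G) p (hG ▸ dvd_mul_right _ _)
  obtain ⟨τ, hτ⟩ := exists_prime_orderOf_dvd_card' (G := G) q (hG ▸ dvd_mul_left _ _)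
  rw [← Nat.card_zpowers] at hσ hτ
  refine ⟨.zpowers σ, .zpowers τ, ?_, ?_, hσ, hτ⟩
  · have hidx := (Subgroup.zpowers σ).card_mul_index
    rw [hσ, hG] at hidx
    refine Subgroup.normal_of_index_eq_minFac_card ?_
    rw [hG, minFac_mul_of_lt hqp, Nat.eq_of_mul_eq_mul_left (NeZero.pos p) hidx]
  · refine Subgroup.isComplement'_of_coprime (by rw [hσ, hτ, hG]) ?_
    rw [hσ, hτ]
    exact coprime_of_lt hqp

theorem nonempty_prod_mulEquiv_cyc (hqp : q < p) {P T : Type*} [Group P] [Group T]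
    (hP : Nat.card P = p) (hT : Nat.card T = q) : Nonempty (P × T ≃* Cyc (p * q)) :=
  ⟨((mulEquivOfPrimeCardEq hP (card_cyc p)).prodCongr (mulEquivOfPrimeCardEq hT (card_cyc q))).trans
    ((MulEquiv.prodMultiplicative _ _).symm.trans (prodMulEquivCyc (coprime_of_lt hqp)))⟩

theorem regularSet_nonempty_of_isRegularSubgroup (hqp : q < p) {X : Type*}
    (hX : Nat.card X = p * q) {G : Subgroup (Equiv.Perm X)} (hG : IsRegularSubgroup G) :
    (regularSet G (Cyc (p * q))).Nonempty := by
  have : Nonempty X := (Nat.card_pos_iff.1 (hX ▸ NeZero.pos (p * q))).1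
  obtain ⟨P, T, _, hPT, hP, hT⟩ := exists_normal_isComplement' hqp (hG.card_eq.trans hX)
  obtain ⟨N, hreg, ⟨e⟩, hnorm⟩ := regularSet_nonempty_of_isComplement' hG hPT
  obtain ⟨e'⟩ := nonempty_prod_mulEquiv_cyc hqp hP hT
  exact ⟨N, hreg, ⟨e.trans e'⟩, hnorm⟩

end RegularDegree

/-! ### Isomorphism types of transitive groups -/

section Transport

variable {X Y Z : Type*} (e : X ≃ Y)

theorem map_permCongrHom_trans (f : Y ≃ Z) (G : Subgroup (Equiv.Perm X)) :
    G.map (e.trans f).permCongrHom.toMonoidHom =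
      (G.map e.permCongrHom.toMonoidHom).map f.permCongrHom.toMonoidHom := by
  rw [Subgroup.map_map]
  rfl

theorem map_permCongrHom_eq_self_iff {f : Equiv.Perm X} {G : Subgroup (Equiv.Perm X)} :
    G.map f.permCongrHom.toMonoidHom = G ↔ f ∈ Subgroup.normalizer (G : Set (Equiv.Perm X)) :=
  Subgroup.mem_normalizer_iff_map_conj_eq.symm

theorem isRegularSubgroup_map_iff {G : Subgroup (Equiv.Perm X)} :
    IsRegularSubgroup (G.map e.permCongrHom.toMonoidHom) ↔ IsRegularSubgroup G :=
  ⟨fun h => map_permCongrHom_symm e G ▸ isRegularSubgroup_map e.symm h, isRegularSubgroup_map e⟩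

theorem isPretransitive_map (G : Subgroup (Equiv.Perm X)) [MulAction.IsPretransitive G X] :
    MulAction.IsPretransitive (G.map e.permCongrHom.toMonoidHom) Y where
  exists_smul_eq x y := by
    obtain ⟨g, hg⟩ := MulAction.exists_smul_eq G (e.symm x) (e.symm y)
    exact ⟨⟨_, g.1, g.2, rfl⟩, (congrArg e hg).trans (e.apply_symm_apply y)⟩

variable {n : ℕ}

/-- The transitive group on `n` letters given by a transitive group on a set of `n` elements. -/
def TransPermGroup.ofSubgroup (e : X ≃ Fin n) (G : Subgroup (Equiv.Perm X))
    [MulAction.IsPretransitive G X] : TransPermGroup n :=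
  ⟨G.map e.permCongrHom.toMonoidHom, isPretransitive_map e G⟩

theorem TransPermGroup.isom_iff {G H : TransPermGroup n} :
    G.Isom H ↔ ∃ f : Fin n ≃ Fin n, G.1.map f.permCongrHom.toMonoidHom = H.1 := by
  constructor
  · rintro ⟨θ, f, h⟩
    have hrange := map_range_permCongrHom (α := G.1.subtype)
      (β := H.1.subtype.comp θ.toMonoidHom) h
    rw [Subgroup.range_subtype, MonoidHom.range_comp, MonoidHom.range_eq_top.2 θ.surjective,
      ← MonoidHom.range_eq_map, Subgroup.range_subtype] at hrange
    exact ⟨f, hrange⟩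
  · rintro ⟨f, hf⟩
    refine ⟨(G.1.equivMapOfInjective f.permCongrHom.toMonoidHom
      f.permCongrHom.injective).trans (MulEquiv.subgroupCongr hf), f, fun g x => ?_⟩
    change f (g.1 x) = f (g.1 (f.symm (f x)))
    rw [f.symm_apply_apply]

end Transport

section SignGroup

variable {R : Type*} [CommRing R]

/-- The groups of units which consist of signs: `{1}` for `false` and `{1, -1}` for `true`. -/
def signGroup (R : Type*) [CommRing R] (b : Bool) : Subgroup Rˣ :=
  if b then Subgroup.zpowers (-1) else ⊥

theorem pow_two_eq_one_of_mem_signGroup {b : Bool} {a : Rˣ} (ha : a ∈ signGroup R b) :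
    a ^ 2 = 1 := by
  cases b
  · rw [Subgroup.mem_bot.1 ha, one_pow]
  · obtain ⟨k, rfl⟩ := Subgroup.mem_zpowers_iff.1 ha
    rw [← zpow_natCast, zpow_comm]
    simp

theorem signGroup_eq_bot_iff (h : (-1 : Rˣ) ≠ 1) {b : Bool} : signGroup R b = ⊥ ↔ b = false := by
  cases b <;> simp [signGroup, h]

theorem exists_eq_signGroup [IsDomain R] {A : Subgroup Rˣ} (hA : ∀ a ∈ A, a ^ 2 = 1) :
    ∃ b, A = signGroup R b := by
  have hsign (a : Rˣ) (ha : a ∈ A) : a = 1 ∨ a = -1 := by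
    have hval := congrArg Units.val (hA a ha)
    rw [Units.val_pow_eq_pow_val, Units.val_one, sq_eq_one_iff] at hval
    exact hval.imp (fun h => Units.ext h) (fun h => Units.ext h)
  by_cases hneg : -1 ∈ A
  · refine ⟨true, le_antisymm (fun a ha => ?_) ((Subgroup.zpowers_le).2 hneg)⟩
    rcases hsign a ha with rfl | rfl
    · exact one_mem _
    · exact Subgroup.mem_zpowers _
  · exact ⟨false, (Subgroup.eq_bot_iff_forall _).2 fun a ha =>
      (hsign a ha).resolve_right fun h => hneg (h ▸ ha)⟩

end SignGroup

/-! ### The list of transitive groups -/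

section Model

variable {R S : Type*} [CommRing R] [CommRing S] (χ : Multiplicative S →* Rˣ)

/-- A list of transitive affine groups. For a nontrivial character `χ` of `ZMod q` with values in
`ZMod p` it represents the isomorphism types of the transitive groups which normalise a regular
cyclic group. -/
def modelGroup : Subgroup (Rˣ × Sˣ) ⊕ Bool → Subgroup (Equiv.Perm (R × S)) :=
  Sum.elim holGroup fun b => excGroup χ (signGroup R b)

theorem modelGroup_le_holGroup (m : Subgroup (Rˣ × Sˣ) ⊕ Bool) : modelGroup χ m ≤ holGroup ⊤ := by
  rcases m with A | b
  · exact holGroup_mono le_top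
  · exact excGroup_le_holGroup χ _

theorem exists_isRegularSubgroup_le_modelGroup (m : Subgroup (Rˣ × Sˣ) ⊕ Bool) :
    ∃ C ≤ modelGroup χ m, IsRegularSubgroup C ∧
      modelGroup χ m ≤ Subgroup.normalizer (C : Set (Equiv.Perm (R × S))) := by
  rcases m with A | b
  · exact ⟨_, translGroup_le_holGroup A, isRegularSubgroup_translGroup,
      holGroup_le_normalizer_translGroup A⟩
  · exact ⟨_, excGroup_mono χ bot_le, isRegularSubgroup_excGroup_bot χ,
      excGroup_le_normalizer_excGroup χ _ ⊥⟩

instance isPretransitive_modelGroup (m : Subgroup (Rˣ × Sˣ) ⊕ Bool) :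
    MulAction.IsPretransitive (modelGroup χ m) (R × S) := by
  obtain ⟨C, hle, hC, -⟩ := exists_isRegularSubgroup_le_modelGroup χ m
  have := hC.isPretransitive
  exact isPretransitive_of_le hle

variable {χ}

theorem isRegularSubgroup_holGroup_iff {A : Subgroup (Rˣ × Sˣ)} :
    IsRegularSubgroup (holGroup A) ↔ A = ⊥ :=
  ⟨eq_bot_of_isRegularSubgroup_holGroup, fun h => by
    rw [h, holGroup_bot]
    exact isRegularSubgroup_translGroup⟩

theorem isRegularSubgroup_excGroup_iff {A : Subgroup Rˣ} :
    IsRegularSubgroup (excGroup χ A) ↔ A = ⊥ :=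
  ⟨eq_bot_of_isRegularSubgroup_excGroup, fun h => h ▸ isRegularSubgroup_excGroup_bot χ⟩

theorem isRegularSubgroup_modelGroup_iff (h : (-1 : Rˣ) ≠ 1) {m : Subgroup (Rˣ × Sˣ) ⊕ Bool} :
    IsRegularSubgroup (modelGroup χ m) ↔ m = .inl ⊥ ∨ m = .inr false := by
  rcases m with A | b
  · exact isRegularSubgroup_holGroup_iff.trans (by simp)
  · exact isRegularSubgroup_excGroup_iff.trans ((signGroup_eq_bot_iff h).trans (by simp))

end Model

section Classification

variable {p q : ℕ} [Fact p.Prime] [Fact q.Prime] {χ : Multiplicative (ZMod q) →* (ZMod p)ˣ}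

theorem exists_char_ne_one (hpq : p = 2 * q + 1) :
    ∃ χ : Multiplicative (ZMod q) →* (ZMod p)ˣ, χ ≠ 1 := by
  have hdvd : q ∣ Nat.card (ZMod p)ˣ := by
    rw [Nat.card_eq_fintype_card, ZMod.card_units, hpq, Nat.add_sub_cancel]
    exact dvd_mul_left _ _
  obtain ⟨u, hu⟩ := exists_prime_orderOf_dvd_card' q hdvd
  obtain ⟨χ, rfl⟩ := exists_char_apply_one_eq (orderOf_dvd_iff_pow_eq_one.1 hu.dvd)
  refine ⟨χ, ?_⟩
  rintro rfl
  exact (Fact.out : q.Prime).one_lt.ne (by simpa using hu)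

theorem neg_one_ne_one_units (hp : 2 < p) : (-1 : (ZMod p)ˣ) ≠ 1 := fun h =>
  have : Fact (2 < p) := ⟨hp⟩
  ZMod.neg_one_ne_one (congrArg Units.val h)

theorem exists_map_eq_modelGroup_of_le (hq : 3 ≤ q) (hpq : p = 2 * q + 1) (hχ : χ ≠ 1)
    {G : Subgroup (Equiv.Perm (ZMod p × ZMod q))} [MulAction.IsPretransitive G (ZMod p × ZMod q)]
    (hle : G ≤ holGroup ⊤) :
    ∃ (f : ZMod p × ZMod q ≃ ZMod p × ZMod q) (m : _),
      G.map f.permCongrHom.toMonoidHom = modelGroup χ m := by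
  by_cases h : translGroup (ZMod p × ZMod q) ≤ G
  · obtain ⟨A, rfl⟩ := exists_eq_holGroup_of_translGroup_le hle h
    exact ⟨Equiv.refl _, .inl A, Subgroup.map_id _⟩
  · obtain ⟨χ', A, hχ', hA, rfl⟩ := exists_eq_excGroup hq hpq hle h
    obtain ⟨b, rfl⟩ := exists_eq_signGroup hA
    obtain ⟨f, hf⟩ := exists_map_excGroup_eq hχ' hχ (signGroup (ZMod p) b)
    exact ⟨f, .inr b, hf⟩

theorem exists_map_eq_modelGroup (hq : 3 ≤ q) (hpq : p = 2 * q + 1) (hχ : χ ≠ 1) {X : Type*}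
    [Nonempty X] {G : Subgroup (Equiv.Perm X)} [MulAction.IsPretransitive G X]
    (hne : (regularSet G (Cyc (p * q))).Nonempty) :
    ∃ (f : X ≃ ZMod p × ZMod q) (m : _), G.map f.permCongrHom.toMonoidHom = modelGroup χ m := by
  obtain ⟨N, hN⟩ := hne
  obtain ⟨f, -, hle⟩ := exists_equiv_map_le_holGroup (coprime_of_lt (by omega)) hN
  have := isPretransitive_map f G
  obtain ⟨f', m, h⟩ := exists_map_eq_modelGroup_of_le hq hpq hχ hle
  exact ⟨f.trans f', m, by rw [map_permCongrHom_trans, h]⟩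

theorem holGroup_eq_of_map_eq (hqp : q < p) {A A' : Subgroup ((ZMod p)ˣ × (ZMod q)ˣ)}
    {f : ZMod p × ZMod q ≃ ZMod p × ZMod q}
    (h : (holGroup A).map f.permCongrHom.toMonoidHom = holGroup A') : A = A' := by
  have htransl : (translGroup (ZMod p × ZMod q)).map f.permCongrHom.toMonoidHom =
      translGroup (ZMod p × ZMod q) := by
    have hmem := map_mem_regularSet f ((regularSet_holGroup hqp A).ge rfl)
    rwa [h, regularSet_holGroup hqp] at hmem
  have hf : f ∈ holGroup ⊤ := by
    rwa [← normalizer_translGroup (coprime_of_lt hqp), ← map_permCongrHom_eq_self_iff]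
  refine holGroup_injective (Eq.trans ?_ h)
  exact (map_permCongrHom_eq_self_iff.2 (holGroup_le_normalizer_holGroup ⊤ A hf)).symm

theorem map_holGroup_ne_excGroup (hq : 3 ≤ q) (hqp : q < p) (hχ : χ ≠ 1)
    {A : Subgroup ((ZMod p)ˣ × (ZMod q)ˣ)} {B : Subgroup (ZMod p)ˣ} (hB : ∀ a ∈ B, a ^ 2 = 1)
    (f : ZMod p × ZMod q ≃ ZMod p × ZMod q) :
    (holGroup A).map f.permCongrHom.toMonoidHom ≠ excGroup χ B := by
  intro h
  have hle : (translGroup (ZMod p × ZMod q)).map f.permCongrHom.toMonoidHom ≤ excGroup χ B :=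
    h ▸ Subgroup.map_mono (translGroup_le_holGroup A)
  obtain ⟨hreg, ⟨e⟩, -⟩ := map_mem_regularSet f
    (translGroup_mem_regularSet (coprime_of_lt hqp) (holGroup_mono (le_top (a := A))))
  rw [eq_translGroup_of_le hqp (hle.trans (excGroup_le_holGroup χ B)) hreg e] at hle
  exact not_translGroup_le_excGroup hq hχ hB hle

theorem modelGroup_eq_of_map_eq (hq : 3 ≤ q) (hqp : q < p) (hχ : χ ≠ 1)
    {m m' : Subgroup ((ZMod p)ˣ × (ZMod q)ˣ) ⊕ Bool} {f : ZMod p × ZMod q ≃ ZMod p × ZMod q}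
    (h : (modelGroup χ m).map f.permCongrHom.toMonoidHom = modelGroup χ m') : m = m' := by
  rcases m with A | b <;> rcases m' with A' | b'
  · rw [holGroup_eq_of_map_eq hqp h]
  · exact absurd h (map_holGroup_ne_excGroup hq hqp hχ (fun _ => pow_two_eq_one_of_mem_signGroup) f)
  · refine absurd ?_ (map_holGroup_ne_excGroup (A := A') hq hqp hχ
      (fun _ => pow_two_eq_one_of_mem_signGroup (b := b)) f.symm)
    exact (congrArg _ h.symm).trans (map_permCongrHom_symm f _)
  · have hreg := isRegularSubgroup_map_iff f (G := modelGroup χ (.inr b))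
    have hneg := neg_one_ne_one_units (p := p) (by omega)
    rw [h, isRegularSubgroup_modelGroup_iff hneg, isRegularSubgroup_modelGroup_iff hneg] at hreg
    cases b <;> cases b' <;> simp_all

end Classification

/-! ### Counting subgroups -/

section CyclicGroup

variable {G : Type*} [CommGroup G] [Finite G] [IsCyclic G]

theorem eq_ker_powMonoidHom_of_isCyclic (H : Subgroup G) :
    H = (powMonoidHom (Nat.card H) : G →* G).ker := by
  refine Subgroup.eq_of_le_of_card_ge (fun g hg => ?_) ?_
  · exact congrArg Subtype.val (pow_card_eq_one' (x := (⟨g, hg⟩ : H)))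
  · rw [IsCyclic.card_powMonoidHom_ker, Nat.gcd_eq_right H.card_subgroup_dvd_card]

theorem sum_subgroup_of_isCyclic {M : Type*} [AddCommMonoid M] [Fintype (Subgroup G)]
    (f : ℕ → M) : ∑ H : Subgroup G, f (Nat.card H) = ∑ d ∈ (Nat.card G).divisors, f d := by
  refine Finset.sum_bij' (fun H _ => Nat.card H) (fun d _ => (powMonoidHom d : G →* G).ker)
    (fun H _ => Nat.mem_divisors.2 ⟨H.card_subgroup_dvd_card, Nat.card_pos.ne'⟩)
    (fun _ _ => Finset.mem_univ _) (fun H _ => (eq_ker_powMonoidHom_of_isCyclic H).symm)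
    (fun d hd => ?_) (fun _ _ => rfl)
  rw [IsCyclic.card_powMonoidHom_ker, Nat.gcd_eq_right (Nat.dvd_of_mem_divisors hd)]

theorem card_subgroup_of_isCyclic : Nat.card (Subgroup G) = (Nat.card G).divisors.card := by
  have := Fintype.ofFinite (Subgroup G)
  rw [Nat.card_eq_fintype_card, ← Finset.card_univ, Finset.card_eq_sum_ones,
    Finset.card_eq_sum_ones, sum_subgroup_of_isCyclic fun _ => 1]

theorem card_monoidHom_of_isCyclic (P : Type*) [Group P] [IsCyclic P] :
    Nat.card (P →* G) = (Nat.card G).gcd (Nat.card P) := by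
  obtain ⟨g, hg⟩ := IsCyclic.exists_generator (α := P)
  rw [← IsCyclic.card_powMonoidHom_ker G (Nat.card P)]
  refine Nat.card_eq_of_bijective
    (fun φ => ⟨φ g, MonoidHom.mem_ker.2 ?_⟩) ⟨fun φ ψ h => ?_, fun ⟨w, hw⟩ => ?_⟩
  · rw [powMonoidHom_apply, ← map_pow, pow_card_eq_one', map_one]
  · exact (MonoidHom.eq_iff_eq_on_generator hg φ ψ).2 (congrArg Subtype.val h)
  · have hdvd : orderOf w ∣ orderOf g := by
      rw [orderOf_eq_card_of_forall_mem_zpowers hg]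
      exact orderOf_dvd_of_pow_eq_one hw
    exact ⟨monoidHomOfForallMemZpowers hg hdvd,
      Subtype.ext (monoidHomOfForallMemZpowers_apply_gen hg hdvd)⟩

end CyclicGroup

section Product

variable {Z B : Type*} [Group Z] [Group B]

theorem goursatFst_prod (P : Subgroup Z) (Q : Subgroup B) : (P.prod Q).goursatFst = P := by
  ext z
  simp [Subgroup.mem_prod]

theorem goursatSnd_prod (P : Subgroup Z) (Q : Subgroup B) : (P.prod Q).goursatSnd = Q := by
  ext b
  simp [Subgroup.mem_prod]

theorem mk_one_mem_of_coprime {H : Subgroup (Z × B)} {z : Z} {b : B} (hzb : (z, b) ∈ H)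
    (h : (orderOf b).Coprime (orderOf z)) : (z, 1) ∈ H := by
  obtain ⟨m, hm⟩ := exists_pow_eq_self_of_coprime h
  have := H.pow_mem (H.pow_mem hzb (orderOf b)) m
  rwa [Prod.pow_mk, Prod.pow_mk, hm, pow_orderOf_eq_one, one_pow] at this

theorem goursatFst_prod_goursatSnd_of_coprime (h : (Nat.card Z).Coprime (Nat.card B))
    (H : Subgroup (Z × B)) : H.goursatFst.prod H.goursatSnd = H := by
  refine le_antisymm H.goursatFst_prod_goursatSnd_le fun ⟨z, b⟩ hzb => ?_
  have hz : (z, 1) ∈ H := mk_one_mem_of_coprime hzb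
    ((h.coprime_dvd_left (orderOf_dvd_natCard z)).coprime_dvd_right (orderOf_dvd_natCard b)).symm
  refine ⟨Subgroup.mem_goursatFst.2 hz, Subgroup.mem_goursatSnd.2 ?_⟩
  simpa using H.mul_mem (H.inv_mem hz) hzb

theorem card_subgroup_prod_of_coprime (h : (Nat.card Z).Coprime (Nat.card B)) :
    Nat.card (Subgroup (Z × B)) = Nat.card (Subgroup Z) * Nat.card (Subgroup B) := by
  rw [← Nat.card_prod]
  exact Nat.card_congr
    { toFun := fun H => (H.goursatFst, H.goursatSnd)
      invFun := fun PQ => PQ.1.prod PQ.2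
      left_inv := goursatFst_prod_goursatSnd_of_coprime h
      right_inv := fun PQ => Prod.ext (goursatFst_prod _ _) (goursatSnd_prod _ _) }

theorem ncard_goursatFst_eq_top :
    {H : Subgroup (Z × B) | H.goursatFst = ⊤}.ncard = Nat.card (Subgroup B) :=
  Nat.card_congr
    { toFun := fun H => H.1.goursatSnd
      invFun := fun Q => ⟨(⊤ : Subgroup Z).prod Q, goursatFst_prod _ _⟩
      left_inv := by
        refine fun ⟨H, hH⟩ => Subtype.ext (SetLike.ext fun ⟨z, b⟩ => ?_)
        have hz : (z, 1) ∈ H := Subgroup.mem_goursatFst.1 (hH ▸ Subgroup.mem_top z)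
        rw [← H.mul_mem_cancel_left (H.inv_mem hz)]
        simp [Subgroup.mem_prod]
      right_inv := goursatSnd_prod ⊤ }

theorem map_snd_range_prod_subtype (P : Subgroup B) (φ : P →* Z) :
    (φ.prod P.subtype).range.map (MonoidHom.snd Z B) = P := by
  rw [MonoidHom.map_range, MonoidHom.snd_comp_prod, Subgroup.range_subtype]

theorem goursatFst_range_prod_subtype (P : Subgroup B) (φ : P →* Z) :
    (φ.prod P.subtype).range.goursatFst = ⊥ := by
  refine (Subgroup.eq_bot_iff_forall _).2 fun z hz => ?_
  obtain ⟨x, hx⟩ := Subgroup.mem_goursatFst.1 hz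
  obtain ⟨hφ, hx⟩ := Prod.mk.inj hx
  rw [← hφ, show x = 1 from Subtype.ext hx, map_one]

theorem range_prod_subtype_injective (P : Subgroup B) :
    Function.Injective fun φ : P →* Z => (φ.prod P.subtype).range := by
  intro φ ψ h
  ext x
  obtain ⟨y, hy⟩ := h.le ⟨x, rfl⟩
  obtain ⟨hψ, hyx⟩ := Prod.mk.inj hy
  rw [← hψ, show y = x from Subtype.ext hyx]

theorem exists_range_prod_subtype_eq {H : Subgroup (Z × B)} (hH : H.goursatFst = ⊥) :
    ∃ (P : Subgroup B) (φ : P →* Z), (φ.prod P.subtype).range = H := by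
  have hinj : Function.Injective ((MonoidHom.snd Z B).comp H.subtype) := by
    refine (injective_iff_map_eq_one _).2 fun ⟨⟨z, b⟩, hzb⟩ hb => ?_
    obtain rfl : b = 1 := hb
    have hz : z ∈ H.goursatFst := Subgroup.mem_goursatFst.2 hzb
    rw [hH] at hz
    exact Subtype.ext (Prod.ext hz rfl)
  let e := MonoidHom.ofInjective hinj
  refine ⟨_, ((MonoidHom.fst Z B).comp H.subtype).comp e.symm.toMonoidHom, ?_⟩
  have : (((MonoidHom.fst Z B).comp H.subtype).comp e.symm.toMonoidHom).prod
      (Subgroup.subtype _) = H.subtype.comp e.symm.toMonoidHom :=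
    MonoidHom.ext fun x => Prod.ext rfl (congrArg Subtype.val (e.apply_symm_apply x)).symm
  rw [this, MonoidHom.range_comp, MonoidHom.range_eq_top.2 e.symm.surjective,
    ← MonoidHom.range_eq_map, Subgroup.range_subtype]

theorem ncard_goursatFst_eq_bot :
    {H : Subgroup (Z × B) | H.goursatFst = ⊥}.ncard = Nat.card (Σ P : Subgroup B, (P →* Z)) := by
  symm
  refine Nat.card_eq_of_bijective
    (fun x => ⟨_, goursatFst_range_prod_subtype x.1 x.2⟩) ⟨?_, fun ⟨H, hH⟩ => ?_⟩
  · rintro ⟨P, φ⟩ ⟨P', φ'⟩ h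
    have hrange : (φ.prod P.subtype).range = (φ'.prod P'.subtype).range :=
      congrArg Subtype.val h
    obtain rfl : P = P' := by
      rw [← map_snd_range_prod_subtype P φ, hrange, map_snd_range_prod_subtype]
    rw [range_prod_subtype_injective P hrange]
  · obtain ⟨P, φ, rfl⟩ := exists_range_prod_subtype_eq hH
    exact ⟨⟨P, φ⟩, rfl⟩

theorem card_subgroup_prod_of_prime_card [Finite B] (hZ : (Nat.card Z).Prime) :
    Nat.card (Subgroup (Z × B)) =
      Nat.card (Subgroup B) + Nat.card (Σ P : Subgroup B, (P →* Z)) := by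
  have : Finite Z := Nat.finite_of_card_ne_zero hZ.ne_zero
  have : Fact (Nat.card Z).Prime := ⟨hZ⟩
  have : Nontrivial Z := Finite.one_lt_card_iff_nontrivial.1 hZ.one_lt
  have hunion : (Set.univ : Set (Subgroup (Z × B))) =
      {H | H.goursatFst = ⊤} ∪ {H | H.goursatFst = ⊥} :=
    (Set.eq_univ_of_forall fun H => H.goursatFst.eq_bot_or_eq_top_of_prime_card.symm).symm
  have hdisj : Disjoint {H : Subgroup (Z × B) | H.goursatFst = ⊤} {H | H.goursatFst = ⊥} :=
    Set.disjoint_left.2 fun H (h : H.goursatFst = ⊤) h' => top_ne_bot (h.symm.trans h')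
  rw [← Set.ncard_univ, hunion, Set.ncard_union_eq hdisj, ncard_goursatFst_eq_top,
    ncard_goursatFst_eq_bot]

theorem card_subgroup_prod_of_prime_card_of_isCyclic {Z B : Type*} [CommGroup Z] [CommGroup B]
    [Finite B] [IsCyclic B] (hZ : (Nat.card Z).Prime) :
    Nat.card (Subgroup (Z × B)) =
      ∑ d ∈ (Nat.card B).divisors, (1 + (Nat.card Z).gcd d) := by
  have : Finite Z := Nat.finite_of_card_ne_zero hZ.ne_zero
  have : Fact (Nat.card Z).Prime := ⟨hZ⟩
  have : IsCyclic Z := isCyclic_of_prime_card rfl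
  have := Fintype.ofFinite (Subgroup B)
  have (P : Subgroup B) : Finite (P →* Z) := Finite.of_injective _ DFunLike.coe_injective
  rw [card_subgroup_prod_of_prime_card hZ, Nat.card_sigma, card_subgroup_of_isCyclic,
    Finset.sum_add_distrib, ← Finset.card_eq_sum_ones,
    ← sum_subgroup_of_isCyclic fun d => (Nat.card Z).gcd d]
  simp only [card_monoidHom_of_isCyclic]

end Product

section Units

variable {r s : ℕ}

theorem card_divisors_two_pow_mul (hs : Odd s) :
    (2 ^ r * s).divisors.card = (r + 1) * s.divisors.card := by
  rw [(Nat.Coprime.pow_left r (Nat.coprime_two_left.2 hs)).card_divisors_mul,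
    Nat.divisors_prime_pow Nat.prime_two, Finset.card_map, Finset.card_range]

theorem filter_odd_divisors_two_pow_mul (hs : Odd s) :
    (2 ^ r * s).divisors.filter Odd = s.divisors := by
  ext d
  rw [Finset.mem_filter, Nat.mem_divisors, Nat.mem_divisors]
  constructor
  · rintro ⟨⟨hd, -⟩, hodd⟩
    exact ⟨(Nat.Coprime.pow_right r (Nat.coprime_two_right.2 hodd)).dvd_of_dvd_mul_left hd,
      hs.pos.ne'⟩
  · rintro ⟨hd, hs0⟩
    exact ⟨⟨hd.mul_left _, mul_ne_zero (by positivity) hs0⟩, hs.of_dvd_nat hd⟩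

theorem sum_one_add_gcd_two_divisors (hs : Odd s) :
    ∑ d ∈ (2 ^ r * s).divisors, (1 + Nat.gcd 2 d) = (3 * r + 2) * s.divisors.card := by
  have hgcd (d : ℕ) : 1 + Nat.gcd 2 d + (if Odd d then 1 else 0) = 3 := by
    rcases Nat.even_or_odd d with h | h
    · rw [Nat.gcd_eq_left h.two_dvd, if_neg (Nat.not_odd_iff_even.2 h), Nat.add_zero, Nat.one_add]
    · rw [Nat.coprime_two_left.2 h, if_pos h]
  have hsum : ∑ d ∈ (2 ^ r * s).divisors, (1 + Nat.gcd 2 d) + s.divisors.card =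
      3 * ((r + 1) * s.divisors.card) := by
    rw [← filter_odd_divisors_two_pow_mul (r := r) hs, Finset.card_filter,
      ← Finset.sum_add_distrib, Finset.sum_congr rfl fun d _ => hgcd d, Finset.sum_const,
      ← Finset.card_filter, filter_odd_divisors_two_pow_mul hs, card_divisors_two_pow_mul hs,
      smul_eq_mul, mul_comm]
  linarith

theorem card_subgroup_units {p q : ℕ} [Fact p.Prime] [Fact q.Prime] (hq : 3 ≤ q)
    (hpq : p = 2 * q + 1) (hs : Odd s) (hrs : q - 1 = 2 ^ r * s) :
    Nat.card (Subgroup ((ZMod p)ˣ × (ZMod q)ˣ)) = (6 * r + 4) * s.divisors.card := by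
  have hq' : q.Prime := Fact.out
  have hcop : q.Coprime 2 := (Nat.coprime_primes hq' Nat.prime_two).2 (by lia)
  have hcard : Nat.card (ZMod q)ˣ = q - 1 := by rw [Nat.card_eq_fintype_card, ZMod.card_units]
  have hcard' : Nat.card (ZMod p)ˣ = Nat.card (Cyc (q * 2)) := by
    rw [card_cyc, Nat.card_eq_fintype_card, ZMod.card_units]
    lia
  let e : (ZMod p)ˣ × (ZMod q)ˣ ≃* Cyc q × (Cyc 2 × (ZMod q)ˣ) :=
    (((mulEquivOfCyclicCardEq hcard').trans ((prodMulEquivCyc hcop).symm.trans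
      (MulEquiv.prodMultiplicative _ _))).prodCongr (MulEquiv.refl _)).trans MulEquiv.prodAssoc
  have hcop' : (Nat.card (Cyc q)).Coprime (Nat.card (Cyc 2 × (ZMod q)ˣ)) := by
    rw [Nat.card_prod, card_cyc, card_cyc, hcard]
    exact hcop.mul_right ((Nat.coprime_self_sub_right hq'.one_le).2 (Nat.coprime_one_right q))
  rw [Nat.card_congr e.mapSubgroup.toEquiv, card_subgroup_prod_of_coprime hcop',
    card_subgroup_of_isCyclic, card_cyc, hq'.divisors, Finset.card_pair hq'.one_lt.ne,
    card_subgroup_prod_of_prime_card_of_isCyclic (by rw [card_cyc]; exact Nat.prime_two),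
    card_cyc, hcard, hrs, sum_one_add_gcd_two_divisors hs]
  ring

end Units

/-! ### Permutation groups of degree `p q` -/

section ModelGroup

theorem isMulCommutative_map_iff {X Y : Type*} (e : X ≃ Y) {G : Subgroup (Equiv.Perm X)} :
    IsMulCommutative (G.map e.permCongrHom.toMonoidHom) ↔ IsMulCommutative G := by
  refine ⟨fun h => ?_, fun h => G.map_isMulCommutative _⟩
  rw [← map_permCongrHom_symm e G]
  exact Subgroup.map_isMulCommutative _ _

theorem not_isMulCommutative_excGroup_bot {R S : Type*} [CommRing R] [CommRing S]
    {χ : Multiplicative S →* Rˣ} (hχ : χ ≠ 1) : ¬ IsMulCommutative (excGroup χ ⊥) := by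
  intro h
  refine hχ (MonoidHom.ext fun d => ?_)
  have hcomm := congrArg Subtype.val (isMulCommutative_iff.1 h
    ⟨aff (χ d) 0 1 d.toAdd, aff_mem_excGroup.2 ⟨rfl, by simp⟩⟩
    ⟨aff 1 1 1 0, aff_mem_excGroup.2 ⟨rfl, by simp⟩⟩)
  exact Units.ext (by simpa [aff_mul, aff_inj] using hcomm)

theorem isCyclic_modelGroup_inl_bot {p q : ℕ} (h : p.Coprime q)
    (χ : Multiplicative (ZMod q) →* (ZMod p)ˣ) : IsCyclic (modelGroup χ (.inl ⊥)) := by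
  rw [show modelGroup χ (.inl ⊥) = translGroup (ZMod p × ZMod q) from holGroup_bot]
  exact ((translEquiv (ZMod p × ZMod q)).symm.trans (prodMulEquivCyc h)).isCyclic.2 inferInstance

end ModelGroup

section Degree

variable {p q : ℕ} [Fact p.Prime] [Fact q.Prime]

variable (p q) in
/-- An enumeration of `ZMod p × ZMod q`. -/
def zmodProdEquivFin : ZMod p × ZMod q ≃ Fin (p * q) :=
  Fintype.equivFinOfCardEq (by rw [Fintype.card_prod, ZMod.card, ZMod.card])

/-- The transitive group on `p * q` letters given by `modelGroup χ m`. -/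
def modelPermGroup (χ : Multiplicative (ZMod q) →* (ZMod p)ˣ)
    (m : Subgroup ((ZMod p)ˣ × (ZMod q)ˣ) ⊕ Bool) : TransPermGroup (p * q) :=
  TransPermGroup.ofSubgroup (zmodProdEquivFin p q) (modelGroup χ m)

variable {χ : Multiplicative (ZMod q) →* (ZMod p)ˣ} {m : Subgroup ((ZMod p)ˣ × (ZMod q)ˣ) ⊕ Bool}

theorem isRegular_modelPermGroup_iff (hp : 2 < p) :
    (modelPermGroup χ m).IsRegular ↔ m = .inl ⊥ ∨ m = .inr false :=
  (isRegularSubgroup_map_iff _).trans (isRegularSubgroup_modelGroup_iff (neg_one_ne_one_units hp))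

theorem exists_isRegular_isCyclic (hpq : p = 2 * q + 1) :
    ∃ G : TransPermGroup (p * q), G.IsRegular ∧ IsCyclic G.1 := by
  have := (Fact.out : q.Prime).two_le
  exact ⟨modelPermGroup 1 (.inl ⊥), (isRegular_modelPermGroup_iff (by lia)).2 (.inl rfl),
    (Subgroup.equivMapOfInjective _ _ (MulEquiv.injective _)).isCyclic.1
      (isCyclic_modelGroup_inl_bot (coprime_of_lt (by lia)) 1)⟩

theorem exists_isRegular_not_isMulCommutative (hpq : p = 2 * q + 1) :
    ∃ G : TransPermGroup (p * q), G.IsRegular ∧ ¬ IsMulCommutative G.1 := by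
  obtain ⟨χ, hχ⟩ := exists_char_ne_one hpq
  have := (Fact.out : q.Prime).two_le
  exact ⟨modelPermGroup χ (.inr false), (isRegular_modelPermGroup_iff (by lia)).2 (.inr rfl),
    fun h => not_isMulCommutative_excGroup_bot hχ ((isMulCommutative_map_iff _).1 h)⟩

theorem mk_modelPermGroup_eq_iff {G : TransPermGroup (p * q)} :
    (⟦modelPermGroup χ m⟧ : Quotient (TransPermGroup.setoid (p * q))) = ⟦G⟧ ↔
      ∃ f : Fin (p * q) ≃ ZMod p × ZMod q,
        G.1.map f.permCongrHom.toMonoidHom = modelGroup χ m := by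
  rw [eq_comm, Quotient.eq]
  refine TransPermGroup.isom_iff.trans ⟨fun ⟨f, hf⟩ => ?_, fun ⟨f, hf⟩ => ?_⟩
  · refine ⟨f.trans (zmodProdEquivFin p q).symm, ?_⟩
    rw [map_permCongrHom_trans, hf]
    exact map_permCongrHom_symm _ _
  · exact ⟨f.trans (zmodProdEquivFin p q), by rw [map_permCongrHom_trans, hf]; rfl⟩

theorem mk_modelPermGroup_injective (hq : 3 ≤ q) (hqp : q < p) (hχ : χ ≠ 1) :
    Function.Injective fun m =>
      (⟦modelPermGroup χ m⟧ : Quotient (TransPermGroup.setoid (p * q))) := by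
  intro m m' h
  obtain ⟨f, hf⟩ := mk_modelPermGroup_eq_iff.1 h
  refine (modelGroup_eq_of_map_eq hq hqp hχ (f := (zmodProdEquivFin p q).trans f) ?_).symm
  rwa [map_permCongrHom_trans]

theorem regularSet_modelPermGroup_nonempty (h : p.Coprime q) :
    (regularSet (modelPermGroup χ m).1 (Cyc (p * q))).Nonempty :=
  ⟨_, map_mem_regularSet _ (translGroup_mem_regularSet h (modelGroup_le_holGroup χ m))⟩

theorem realised_classes_eq_range (hq : 3 ≤ q) (hpq : p = 2 * q + 1) (hχ : χ ≠ 1) :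
    {c : Quotient (TransPermGroup.setoid (p * q)) | ∃ G : TransPermGroup (p * q), ⟦G⟧ = c ∧
      TransPermGroup.RealisedByType.{u} G (Cyc (p * q))} =
      Set.range fun m => ⟦modelPermGroup χ m⟧ := by
  ext c
  constructor
  · rintro ⟨⟨G, hG⟩, rfl, hreal⟩
    obtain ⟨f, m, h⟩ := exists_map_eq_modelGroup hq hpq hχ
      ((realisedByType_iff (card_cyc _)).1 hreal)
    exact ⟨m, mk_modelPermGroup_eq_iff.2 ⟨f, h⟩⟩
  · rintro ⟨m, rfl⟩
    exact ⟨_, rfl, (realisedByType_iff (card_cyc _)).2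
      (regularSet_modelPermGroup_nonempty (coprime_of_lt (by lia)))⟩

theorem ncard_realised_classes (hq : 3 ≤ q) (hpq : p = 2 * q + 1) :
    {c : Quotient (TransPermGroup.setoid (p * q)) | ∃ G : TransPermGroup (p * q), ⟦G⟧ = c ∧
      TransPermGroup.RealisedByType.{u} G (Cyc (p * q))}.ncard =
        Nat.card (Subgroup ((ZMod p)ˣ × (ZMod q)ˣ)) + 2 := by
  obtain ⟨χ, hχ⟩ := exists_char_ne_one hpq
  rw [realised_classes_eq_range hq hpq hχ, ← Set.image_univ,
    Set.ncard_image_of_injective _ (mk_modelPermGroup_injective hq (by lia) hχ), Set.ncard_univ,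
    Nat.card_sum, Nat.card_eq_fintype_card (α := Bool), Fintype.card_bool]

theorem TransPermGroup.IsRegular.regularSet_nonempty (hqp : q < p) {G : TransPermGroup (p * q)}
    (hG : G.IsRegular) : (regularSet G.1 (Cyc (p * q))).Nonempty :=
  regularSet_nonempty_of_isRegularSubgroup hqp (Nat.card_fin _) hG

theorem regular_classes_eq_image (hq : 3 ≤ q) (hpq : p = 2 * q + 1) (hχ : χ ≠ 1) :
    {c : Quotient (TransPermGroup.setoid (p * q)) | ∃ G : TransPermGroup (p * q), ⟦G⟧ = c ∧
      G.IsRegular} = (fun m => ⟦modelPermGroup χ m⟧) '' {.inl ⊥, .inr false} := by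
  ext c
  constructor
  · rintro ⟨⟨G, hG⟩, rfl, hreg⟩
    obtain ⟨f, m, h⟩ := exists_map_eq_modelGroup hq hpq hχ (hreg.regularSet_nonempty (by lia))
    have hm : IsRegularSubgroup (modelGroup χ m) := h ▸ isRegularSubgroup_map f hreg
    exact ⟨m, (isRegularSubgroup_modelGroup_iff (neg_one_ne_one_units (by lia))).1 hm,
      mk_modelPermGroup_eq_iff.2 ⟨f, h⟩⟩
  · rintro ⟨m, hm, rfl⟩
    exact ⟨_, rfl, (isRegular_modelPermGroup_iff (by lia)).2 hm⟩

theorem ncard_regular_classes (hq : 3 ≤ q) (hpq : p = 2 * q + 1) :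
    {c : Quotient (TransPermGroup.setoid (p * q)) | ∃ G : TransPermGroup (p * q), ⟦G⟧ = c ∧
      G.IsRegular}.ncard = 2 := by
  obtain ⟨χ, hχ⟩ := exists_char_ne_one hpq
  rw [regular_classes_eq_image hq hpq hχ,
    Set.ncard_image_of_injective _ (mk_modelPermGroup_injective hq (by lia) hχ),
    Set.ncard_pair Sum.inl_ne_inr]

theorem ncard_regularSet_modelGroup (hq : 3 ≤ q) (hpq : p = 2 * q + 1) (hχ : χ ≠ 1)
    (hm : m ≠ .inr false) : (regularSet (modelGroup χ m) (Cyc (p * q))).ncard = 1 := by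
  rcases m with A | _ | _
  · exact (congrArg Set.ncard (regularSet_holGroup (by lia) A)).trans (Set.ncard_singleton _)
  · exact absurd rfl hm
  · exact ncard_regularSet_excGroup hq hpq hχ (fun _ => pow_two_eq_one_of_mem_signGroup)
      (mt (signGroup_eq_bot_iff (neg_one_ne_one_units (by lia))).1 Bool.true_eq_false.mp)

variable {X : Type*} [Nonempty X] {G : Subgroup (Equiv.Perm X)} [MulAction.IsPretransitive G X]

theorem ncard_regularSet_eq_one (hq : 3 ≤ q) (hpq : p = 2 * q + 1)
    (hne : (regularSet G (Cyc (p * q))).Nonempty)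
    (hcomm : IsRegularSubgroup G → IsMulCommutative G) :
    (regularSet G (Cyc (p * q))).ncard = 1 := by
  obtain ⟨χ, hχ⟩ := exists_char_ne_one hpq
  obtain ⟨f, m, h⟩ := exists_map_eq_modelGroup hq hpq hχ hne
  rw [← isRegularSubgroup_map_iff f, ← isMulCommutative_map_iff f, h] at hcomm
  rw [← ncard_regularSet_map f, h]
  refine ncard_regularSet_modelGroup hq hpq hχ ?_
  rintro rfl
  exact not_isMulCommutative_excGroup_bot hχ (hcomm (isRegularSubgroup_excGroup_bot χ))

theorem ncard_regularSet_eq_of_not_isMulCommutative (hq : 3 ≤ q) (hpq : p = 2 * q + 1)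
    (hX : Nat.card X = p * q) (hG : IsRegularSubgroup G) (hcomm : ¬ IsMulCommutative G) :
    (regularSet G (Cyc (p * q))).ncard = p := by
  obtain ⟨χ, hχ⟩ := exists_char_ne_one hpq
  obtain ⟨f, m, h⟩ := exists_map_eq_modelGroup hq hpq hχ
    (regularSet_nonempty_of_isRegularSubgroup (by lia) hX hG)
  rw [← isRegularSubgroup_map_iff f, h,
    isRegularSubgroup_modelGroup_iff (neg_one_ne_one_units (by lia))] at hG
  rw [← isMulCommutative_map_iff f, h] at hcomm
  rw [← ncard_regularSet_map f, h]
  rcases hG with rfl | rfl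
  · have := isCyclic_modelGroup_inl_bot (coprime_of_lt (by lia)) χ
    exact absurd IsCyclic.isMulCommutative hcomm
  · exact ncard_regularSet_excGroup_bot hq hpq hχ

theorem exists_isRegularSubgroup_le_of_regularSet_nonempty (hq : 3 ≤ q) (hpq : p = 2 * q + 1)
    (hne : (regularSet G (Cyc (p * q))).Nonempty) :
    ∃ C ≤ G, IsRegularSubgroup C ∧ G ≤ Subgroup.normalizer (C : Set (Equiv.Perm X)) := by
  obtain ⟨χ, hχ⟩ := exists_char_ne_one hpq
  obtain ⟨f, m, h⟩ := exists_map_eq_modelGroup hq hpq hχ hne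
  obtain ⟨C, hle, hreg, hnorm⟩ := exists_isRegularSubgroup_le_modelGroup χ m
  rw [← map_permCongrHom_symm f G, h]
  exact ⟨C.map f.symm.permCongrHom.toMonoidHom, Subgroup.map_mono hle,
    isRegularSubgroup_map f.symm hreg,
    (Subgroup.map_mono hnorm).trans (Subgroup.le_normalizer_map _)⟩

end Degree

end HopfGalois

end

theorem mainTheorem3 (p q r s : ℕ) (hp : p.Prime) (hq : q.Prime) (hq3 : 3 ≤ q)
    (hpq : p = 2 * q + 1) (hs : Odd s) (hrs : q - 1 = 2 ^ r * s) :
    -- the number of isomorphism types of permutation groups realised by cyclic type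
    {c : Quotient (HopfGalois.TransPermGroup.setoid (p * q)) |
        ∃ G : HopfGalois.TransPermGroup (p * q), ⟦G⟧ = c ∧
          HopfGalois.TransPermGroup.RealisedByType.{u} G (HopfGalois.Cyc (p * q))}.ncard =
      (6 * r + 4) * ArithmeticFunction.sigma 0 s + 2 ∧
    -- there are two isomorphism types of regular groups, one cyclic and one non-abelian
    {c : Quotient (HopfGalois.TransPermGroup.setoid (p * q)) |
        ∃ G : HopfGalois.TransPermGroup (p * q), ⟦G⟧ = c ∧ G.IsRegular}.ncard = 2 ∧
    (∃ G : HopfGalois.TransPermGroup (p * q), G.IsRegular ∧ IsCyclic G.1) ∧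
    (∃ G : HopfGalois.TransPermGroup (p * q), G.IsRegular ∧ ¬ IsMulCommutative G.1) ∧
    -- the regular groups are realised, and the extensions realising them are Galois with
    -- `1`, respectively `p`, Hopf-Galois structures of cyclic type
    (∀ G : HopfGalois.TransPermGroup (p * q), G.IsRegular →
      HopfGalois.TransPermGroup.RealisedByType.{u} G (HopfGalois.Cyc (p * q)) ∧
      ∀ (K L : Type u) [Field K] [Field L] [Algebra K L] [FiniteDimensional K L]
        [Algebra.IsSeparable K L], HopfGalois.Realises K L G.1 (Fin (p * q)) →
        IsGalois K L ∧
        (IsCyclic G.1 → HopfGalois.numStructures K L (HopfGalois.Cyc (p * q)) = 1) ∧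
        (¬ IsMulCommutative G.1 →
          HopfGalois.numStructures K L (HopfGalois.Cyc (p * q)) = p)) ∧
    -- all the remaining groups
    (∀ G : HopfGalois.TransPermGroup (p * q),
      HopfGalois.TransPermGroup.RealisedByType.{u} G (HopfGalois.Cyc (p * q)) →
      ¬ G.IsRegular →
      ∀ (K L : Type u) [Field K] [Field L] [Algebra K L] [FiniteDimensional K L]
        [Algebra.IsSeparable K L], HopfGalois.Realises K L G.1 (Fin (p * q)) →
        HopfGalois.AlmostClassicallyGalois K L ∧
        HopfGalois.numStructures K L (HopfGalois.Cyc (p * q)) = 1) := by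
  have : Fact p.Prime := ⟨hp⟩
  have : Fact q.Prime := ⟨hq⟩
  have : NeZero (p * q) := ⟨Nat.mul_ne_zero hp.ne_zero hq.ne_zero⟩
  refine ⟨?_, HopfGalois.ncard_regular_classes hq3 hpq,
    HopfGalois.exists_isRegular_isCyclic hpq,
    HopfGalois.exists_isRegular_not_isMulCommutative hpq, ?_, ?_⟩
  · rw [HopfGalois.ncard_realised_classes hq3 hpq,
      HopfGalois.card_subgroup_units hq3 hpq hs hrs, ArithmeticFunction.sigma_zero_apply]
  · rintro ⟨G, _⟩ hG
    have hne := hG.regularSet_nonempty (by lia)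
    refine ⟨(HopfGalois.realisedByType_iff (HopfGalois.card_cyc _)).2 hne, ?_⟩
    intro K L _ _ _ _ _ hR
    rw [HopfGalois.numStructures_of_realises hR (HopfGalois.card_cyc _)]
    exact ⟨HopfGalois.isGalois_of_realises hR hG,
      fun _ => HopfGalois.ncard_regularSet_eq_one hq3 hpq hne fun _ => IsCyclic.isMulCommutative,
      HopfGalois.ncard_regularSet_eq_of_not_isMulCommutative hq3 hpq (Nat.card_fin _) hG⟩
  · rintro ⟨G, _⟩ hG hreg K L _ _ _ _ _ hR
    have hne := (HopfGalois.realisedByType_iff (HopfGalois.card_cyc _)).1 hG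
    obtain ⟨C, hle, hC, hnorm⟩ :=
      HopfGalois.exists_isRegularSubgroup_le_of_regularSet_nonempty hq3 hpq hne
    rw [HopfGalois.numStructures_of_realises hR (HopfGalois.card_cyc _)]
    exact ⟨HopfGalois.almostClassicallyGalois_of_realises hR hC hle hnorm,
      HopfGalois.ncard_regularSet_eq_one hq3 hpq hne fun h => absurd h hreg⟩
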